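/- Let $E_8\subset\mathbb R^8$ be the $E_8$ root lattice, $L=\sqrt2E_8=\{\sqrt2\,v\mid v\in E_8\}$, and let $L^*=\{v\in\mathbb R^8\mid (v,L)\subset\mathbb Z\}$ be its dual lattice. Put $R(L)=L^*/L$, which is an $8$-dimensional vector space over $\mathbb F_2$ carrying the quadratic form $q_L(v+L)=(v,v)\bmod 2$. Define $w:R(L)\to\{0,1,2\}$ by $w(0)=0$, $w(a)=1$ if $q_L(a)=1$, and $w(a)=2$ if $a\ne0$ and $q_L(a)=0$. On $R(L)^3$ put $q_L^3(a_1,a_2,a_3)=\sum_i q_L(a_i)$ and $w^3(a_1,a_2,a_3)=\sum_i w(a_i)$, and let $\mathrm{Aut}(R(L)^3,w^3)$ be the subgroup of $\mathrm{GL}(R(L)^3)$ preserving $w^3$. Let $\mathcal S$ be a maximal totally singular subspace of $(R(L)^3,q_L^3)$ such that $w^3(v)\ge4$ for all $v\in\mathcal S\setminus\{0\}$. Let $\mathfrak L(\mathcal S)\subset(L^*)^3\subset\mathbb R^{24}$ be the inverse image of $\mathcal S$ under the canonical map $(L^*)^3\to R(L)^3$, let $\mathrm{Aut}(\mathfrak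 L(\mathcal S))$ be the group of linear isometries of $\mathbb R^{24}$ mapping $\mathfrak L(\mathcal S)$ onto itself, and let $G$ be the stabilizer in $\mathrm{Aut}(\mathfrak L(\mathcal S))$ of the orthogonal direct sum $L^3\subset\mathfrak L(\mathcal S)$ of three copies of $L$. Then: (1) $\mathrm{Aut}(\mathfrak L(\mathcal S))$ acts transitively on the set of all sublattices of $\mathfrak L(\mathcal S)$ isomorphic to the orthogonal direct sum $(\sqrt2E_8)^3$ of three copies of $\sqrt2E_8$. (2) $G$ is isomorphic to an extension of the stabilizer of $\mathcal S$ in $\mathrm{Aut}(R(L)^3,w^3)$ by an elementary abelian $2$-group of order $2^3$ (which is the normal subgroup), and this stabilizer of $\mathcal S$ is a split extension of $\mathrm{SL}_4(2)\times\mathrm{Sym}_3$ by an elementary abelian $2$-group of order $2^{12}$; thus $G$ has the shape $2^3.(2^{12}:(\mathrm{SL}_4(2)\times\mathrm{Sym}_3))$. -/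

import Mathlib

open scoped Pointwise

noncomputable section

/-! ### Lattices in Euclidean spaces -/

section Lattices

variable {E F : Type*} [NormedAddCommGroup E] [InnerProductSpace ℝ E]
  [NormedAddCommGroup F] [InnerProductSpace ℝ F]

/-- The dual lattice `L* = {v | (v, L) ⊆ ℤ}`. -/
abbrev dualLattice (L : Submodule ℤ E) : Submodule ℤ E :=
  LinearMap.BilinForm.dualSubmodule (innerₗ E) L

/-- The discriminant group `R(L) = L* / L` (for `L ⊆ L*`). -/
abbrev DiscGroup (L : Submodule ℤ E) : Type _ :=
  dualLattice L ⧸ L.submoduleOf (dualLattice L)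

/-- The canonical map `φ_L : L* → R(L)`, `v ↦ v + L`. -/
abbrev discMap (L : Submodule ℤ E) : dualLattice L →ₗ[ℤ] DiscGroup L :=
  (L.submoduleOf (dualLattice L)).mkQ

/-- The orthogonal direct sum `L^k` of `k` copies of `L`, inside the orthogonal direct sum
`E^k` of `k` copies of the ambient Euclidean space. -/
def powLattice (L : Submodule ℤ E) (k : ℕ) : Submodule ℤ (PiLp 2 fun _ : Fin k => E) where
  carrier := {x | ∀ i, x i ∈ L}
  add_mem' hx hy i := L.add_mem (hx i) (hy i)
  zero_mem' _ := L.zero_mem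
  smul_mem' c _ hx i := L.smul_mem c (hx i)

/-- The canonical map `φ_L^k : (L*)^k → R(L)^k`, `(v_i) ↦ (φ_L(v_i))`. -/
def discMapPow (L : Submodule ℤ E) (k : ℕ) :
    powLattice (dualLattice L) k →ₗ[ℤ] (Fin k → DiscGroup L) where
  toFun v i := discMap L ⟨v.1 i, v.2 i⟩
  map_add' v w := by
    funext i
    exact (discMap L).map_add ⟨v.1 i, v.2 i⟩ ⟨w.1 i, w.2 i⟩
  map_smul' c v := by
    funext i
    exact (discMap L).map_smul c ⟨v.1 i, v.2 i⟩

/-- The lattice `𝔏(S) = (φ_L^k)⁻¹(S)` attached to a subspace `S` of `R(L)^k`. -/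
def latticeOf (L : Submodule ℤ E) [Module (ZMod 2) (DiscGroup L)] {k : ℕ}
    (S : Submodule (ZMod 2) (Fin k → DiscGroup L)) :
    Submodule ℤ (PiLp 2 fun _ : Fin k => E) :=
  (S.toAddSubgroup.toIntSubmodule.comap (discMapPow L k)).map
    (powLattice (dualLattice L) k).subtype

/-- The group of linear isometries `g` of the ambient space with `g(M) = M`. For a lattice `M`
of full rank this is the automorphism group `Aut(M)`. -/
def latticeAut (M : Submodule ℤ E) : Subgroup (E ≃ₗᵢ[ℝ] E) where
  carrier := {g | ∀ x, g x ∈ M ↔ x ∈ M}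
  one_mem' _ := Iff.rfl
  mul_mem' {g h} hg hh x := (hg (h x)).trans (hh x)
  inv_mem' {g} hg x := by
    have h := hg (g⁻¹ x)
    rw [show g (g⁻¹ x) = x from g.apply_symm_apply x] at h
    exact h.symm

/-- Two lattices are isomorphic when there is a group isomorphism between them that preserves
the inner product. -/
def LatticeIsomorphic (M : Submodule ℤ E) (N : Submodule ℤ F) : Prop :=
  ∃ f : M ≃ₗ[ℤ] N, ∀ x y : M, inner ℝ (f x : F) (f y : F) = inner ℝ (x : E) (y : E)

end Lattices

/-! ### Quadratic spaces over the field with two elements -/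

section QuadraticSpaces

variable {R : Type*} [AddCommGroup R] [Module (ZMod 2) R]

/-- The quadratic form `q^k` on `R^k`, `(a_i) ↦ ∑ q(a_i)`. -/
abbrev quadPow (q : QuadraticForm (ZMod 2) R) (k : ℕ) : QuadraticForm (ZMod 2) (Fin k → R) :=
  QuadraticMap.pi fun _ => q

/-- A subspace is totally singular when `q` vanishes on it. -/
def IsTotallySingular (q : QuadraticForm (ZMod 2) R) (Φ : Submodule (ZMod 2) R) : Prop :=
  ∀ v ∈ Φ, q v = 0

/-- A maximal totally singular subspace. -/
def IsMaxTotallySingular (q : QuadraticForm (ZMod 2) R) (Φ : Submodule (ZMod 2) R) : Prop :=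
  Maximal (IsTotallySingular q) Φ

open scoped Classical in
/-- `w(a) = 0` if `a = 0`, `w(a) = 1` if `q(a) = 1`, and `w(a) = 2` if `a ≠ 0` and
`q(a) = 0`. -/
def wt (q : QuadraticForm (ZMod 2) R) (a : R) : ℕ :=
  if a = 0 then 0 else if q a = 1 then 1 else 2

/-- `w^k(a_1, …, a_k) = ∑ w(a_i)`. -/
def wtPow (q : QuadraticForm (ZMod 2) R) (k : ℕ) (v : Fin k → R) : ℕ :=
  ∑ i, wt q (v i)

/-- `Aut(R^k, w^k)`, the subgroup of `GL(R^k)` preserving `w^k`. -/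
def autWt (q : QuadraticForm (ZMod 2) R) (k : ℕ) :
    Subgroup ((Fin k → R) ≃ₗ[ZMod 2] (Fin k → R)) where
  carrier := {g | ∀ v, wtPow q k (g v) = wtPow q k v}
  one_mem' _ := rfl
  mul_mem' {g h} hg hh v := (hg (h v)).trans (hh v)
  inv_mem' {g} hg v := by
    have h := hg (g⁻¹ v)
    rw [show g (g⁻¹ v) = v from g.apply_symm_apply v] at h
    exact h.symm

/-- The stabilizer `{g ∈ GL(W) | g(S) = S}` of a subspace `S` of `W`. -/
def subspaceStabilizer {W : Type*} [AddCommGroup W] [Module (ZMod 2) W]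
    (S : Submodule (ZMod 2) W) : Subgroup (W ≃ₗ[ZMod 2] W) where
  carrier := {g | ∀ v, g v ∈ S ↔ v ∈ S}
  one_mem' _ := Iff.rfl
  mul_mem' {g h} hg hh v := (hg (h v)).trans (hh v)
  inv_mem' {g} hg v := by
    have h := hg (g⁻¹ v)
    rw [show g (g⁻¹ v) = v from g.apply_symm_apply v] at h
    exact h.symm

end QuadraticSpaces

/-! ### The lattices `E₈` and `√2 E₈` -/

/-- The `E₈` root lattice: vectors of `ℝ⁸` whose coordinates are all integers or all
half-odd-integers, with even coordinate sum. -/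
def latticeE8 : Submodule ℤ (EuclideanSpace ℝ (Fin 8)) where
  carrier := {x | ((∀ i, ∃ n : ℤ, x i = n) ∨ (∀ i, ∃ n : ℤ, x i = n + 1 / 2)) ∧
    ∃ s : ℤ, ∑ i, x i = 2 * s}
  zero_mem' := ⟨Or.inl fun _ => ⟨0, by simp⟩, 0, by simp⟩
  add_mem' := by
    rintro x y ⟨hx, s, hs⟩ ⟨hy, t, ht⟩
    refine ⟨?_, s + t, by simp [Finset.sum_add_distrib, hs, ht]; ring⟩
    rcases hx with hx | hx <;> rcases hy with hy | hy
    · left; intro i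
      obtain ⟨a, ha⟩ := hx i
      obtain ⟨b, hb⟩ := hy i
      exact ⟨a + b, by simp [ha, hb]⟩
    · right; intro i
      obtain ⟨a, ha⟩ := hx i
      obtain ⟨b, hb⟩ := hy i
      exact ⟨a + b, by simp [ha, hb]; ring⟩
    · right; intro i
      obtain ⟨a, ha⟩ := hx i
      obtain ⟨b, hb⟩ := hy i
      exact ⟨a + b, by simp [ha, hb]; ring⟩
    · left; intro i
      obtain ⟨a, ha⟩ := hx i
      obtain ⟨b, hb⟩ := hy i
      exact ⟨a + b + 1, by simp [ha, hb]; ring⟩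
  smul_mem' := by
    rintro c x ⟨hx, s, hs⟩
    refine ⟨?_, c * s, by simp [← Finset.mul_sum, hs]; ring⟩
    rcases hx with hx | hx
    · left; intro i
      obtain ⟨a, ha⟩ := hx i
      exact ⟨c * a, by simp [ha]⟩
    · rcases Int.even_or_odd' c with ⟨d, rfl | rfl⟩
      · left; intro i
        obtain ⟨a, ha⟩ := hx i
        exact ⟨2 * d * a + d, by simp [ha]; ring⟩
      · right; intro i
        obtain ⟨a, ha⟩ := hx i
        exact ⟨(2 * d + 1) * a + d, by simp [ha]; ring⟩

/-- `√2 E₈ = {√2 v | v ∈ E₈}`. -/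
def sqrtTwoE8 : Submodule ℤ (EuclideanSpace ℝ (Fin 8)) :=
  Real.sqrt 2 • latticeE8

theorem latticeE8_even {x : EuclideanSpace ℝ (Fin 8)} (hx : x ∈ latticeE8) :
    ∃ n : ℤ, inner ℝ x x = 2 * (n : ℝ) := by
  obtain ⟨hx, s, hs⟩ := hx
  rcases hx with hx | hx
  · choose a ha using hx
    have hsum : ∑ i, a i = 2 * s := by
      have : ((∑ i, a i : ℤ) : ℝ) = ((2 * s : ℤ) : ℝ) := by
        push_cast; rw [← hs]; simp [ha]
      exact_mod_cast this
    have key : ∀ i, ∃ b : ℤ, a i * a i = a i + 2 * b := by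
      intro i
      obtain ⟨b, hb⟩ := (Int.even_mul_succ_self (a i - 1))
      exact ⟨b, by linarith⟩
    choose b hb using key
    refine ⟨s + ∑ i, b i, ?_⟩
    have : ∑ i, a i * a i = 2 * (s + ∑ i, b i) := by
      simp only [hb, Finset.sum_add_distrib, ← Finset.mul_sum, hsum]; ring
    rw [PiLp.inner_apply]
    simp only [ha]
    have h2 : ((∑ i, a i * a i : ℤ) : ℝ) = ((2 * (s + ∑ i, b i) : ℤ) : ℝ) := by rw [this]
    push_cast at h2 ⊢
    simpa [sq] using h2
  · choose a ha using hx
    have key : ∀ i, ∃ b : ℤ, a i * a i + a i = 2 * b := by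
      intro i
      obtain ⟨b, hb⟩ := (Int.even_mul_succ_self (a i))
      exact ⟨b, by linarith⟩
    choose b hb using key
    refine ⟨1 + ∑ i, b i, ?_⟩
    have h2 : ∀ i, x i * x i = 2 * (b i : ℝ) + 1 / 4 := by
      intro i
      have : ((a i * a i + a i : ℤ) : ℝ) = ((2 * b i : ℤ) : ℝ) := by rw [hb]
      push_cast at this
      rw [ha]; linarith
    rw [PiLp.inner_apply]
    have h3 : ∑ i, x i * x i = 2 * (1 + ∑ i, (b i : ℝ)) := by
      simp only [h2, Finset.sum_add_distrib, ← Finset.mul_sum]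
      norm_num
      ring
    push_cast
    simpa [sq] using h3

theorem latticeE8_integral {x y : EuclideanSpace ℝ (Fin 8)} (hx : x ∈ latticeE8)
    (hy : y ∈ latticeE8) : ∃ n : ℤ, inner ℝ x y = (n : ℝ) := by
  obtain ⟨a, ha⟩ := latticeE8_even hx
  obtain ⟨b, hb⟩ := latticeE8_even hy
  obtain ⟨c, hc⟩ := latticeE8_even (add_mem hx hy)
  refine ⟨c - a - b, ?_⟩
  rw [inner_add_left, inner_add_right, inner_add_right, real_inner_comm x y] at hc
  push_cast
  linarith

/-- The lattice `E₈` contains its dual. -/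
theorem mem_latticeE8_of_dual {x : EuclideanSpace ℝ (Fin 8)}
    (h : ∀ y ∈ latticeE8, ∃ n : ℤ, inner ℝ x y = (n : ℝ)) : x ∈ latticeE8 := by
  have hadd : ∀ i j, ∃ n : ℤ, x i + x j = n := by
    intro i j
    obtain ⟨n, hn⟩ := h (EuclideanSpace.single i 1 + EuclideanSpace.single j 1)
      ⟨Or.inl fun k => ⟨(if k = i then 1 else 0) + (if k = j then 1 else 0), by simp⟩,
        1, by simp [Finset.sum_add_distrib]; norm_num⟩
    refine ⟨n, ?_⟩
    rw [← hn, inner_add_right]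
    simp [EuclideanSpace.inner_single_right]
  have hsub : ∀ i j, ∃ n : ℤ, x i - x j = n := by
    intro i j
    obtain ⟨n, hn⟩ := h (EuclideanSpace.single i 1 - EuclideanSpace.single j 1)
      ⟨Or.inl fun k => ⟨(if k = i then 1 else 0) - (if k = j then 1 else 0), by simp⟩,
        0, by simp [Finset.sum_sub_distrib]⟩
    refine ⟨n, ?_⟩
    rw [← hn, inner_sub_right]
    simp [EuclideanSpace.inner_single_right]
  constructor
  · obtain ⟨m, hm⟩ := hadd 0 0
    rcases Int.even_or_odd' m with ⟨d, rfl | rfl⟩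
    · left; intro i
      obtain ⟨n, hn⟩ := hsub i 0
      refine ⟨n + d, ?_⟩
      push_cast at hm ⊢
      linarith
    · right; intro i
      obtain ⟨n, hn⟩ := hsub i 0
      refine ⟨n + d, ?_⟩
      push_cast at hm ⊢
      linarith
  · obtain ⟨n, hn⟩ := h (WithLp.toLp 2 fun _ => 1 / 2)
      ⟨Or.inr fun _ => ⟨0, by simp⟩, 2, by simp; norm_num⟩
    refine ⟨n, ?_⟩
    rw [← hn, PiLp.inner_apply]
    simp [← Finset.mul_sum]

theorem mem_dual_sqrtTwoE8 {v : EuclideanSpace ℝ (Fin 8)} (hv : v ∈ dualLattice sqrtTwoE8) :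
    Real.sqrt 2 • v ∈ latticeE8 := by
  apply mem_latticeE8_of_dual
  intro y hy
  have h := hv (Real.sqrt 2 • y) (Submodule.smul_mem_pointwise_smul y _ _ hy)
  obtain ⟨n, hn⟩ := Submodule.mem_one.mp h
  refine ⟨n, ?_⟩
  rw [real_inner_smul_left, ← real_inner_smul_right]
  exact hn.symm

theorem inner_dual_sqrtTwoE8 {v : EuclideanSpace ℝ (Fin 8)} (hv : v ∈ dualLattice sqrtTwoE8) :
    ∃ n : ℤ, inner ℝ v v = (n : ℝ) := by
  obtain ⟨n, hn⟩ := latticeE8_even (mem_dual_sqrtTwoE8 hv)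
  refine ⟨n, ?_⟩
  rw [real_inner_smul_left, real_inner_smul_right, ← mul_assoc,
    Real.mul_self_sqrt (by norm_num)] at hn
  linarith

/-- `2 L* ⊆ L` for `L = √2 E₈`. -/
theorem two_smul_dual_sqrtTwoE8 {v : EuclideanSpace ℝ (Fin 8)}
    (hv : v ∈ dualLattice sqrtTwoE8) : 2 • v ∈ sqrtTwoE8 := by
  have h := Submodule.smul_mem_pointwise_smul _ (Real.sqrt 2) _ (mem_dual_sqrtTwoE8 hv)
  rw [smul_smul, Real.mul_self_sqrt (by norm_num)] at h
  have h2 : (2 • v : EuclideanSpace ℝ (Fin 8)) = (2 : ℝ) • v := by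
    rw [two_smul, two_smul]
  rw [h2]
  exact h

/-- `R(√2 E₈)` is a vector space over the field with two elements. -/
instance discGroupModule : Module (ZMod 2) (DiscGroup sqrtTwoE8) :=
  AddCommGroup.zmodModule (n := 2) fun x => by
    induction x using Submodule.Quotient.induction_on with
    | H v =>
      rw [← Submodule.Quotient.mk_smul, Submodule.Quotient.mk_eq_zero]
      exact two_smul_dual_sqrtTwoE8 v.2

theorem inner_dual_sqrtTwoE8' {v w : EuclideanSpace ℝ (Fin 8)}
    (hv : v ∈ dualLattice sqrtTwoE8) (hw : w ∈ dualLattice sqrtTwoE8) :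
    ∃ n : ℤ, 2 * inner ℝ v w = (n : ℝ) := by
  obtain ⟨n, hn⟩ := latticeE8_integral (mem_dual_sqrtTwoE8 hv) (mem_dual_sqrtTwoE8 hw)
  refine ⟨n, ?_⟩
  rw [real_inner_smul_left, real_inner_smul_right, ← mul_assoc,
    Real.mul_self_sqrt (by norm_num)] at hn
  exact hn

/-- The residue mod `2` of `(v, v)`, an integer for `v ∈ L*`, depends only on `v + L`. -/
theorem floor_inner_eq_of_sub_mem {v w : EuclideanSpace ℝ (Fin 8)}
    (hv : v ∈ dualLattice sqrtTwoE8) (hw : w ∈ dualLattice sqrtTwoE8)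
    (h : v - w ∈ sqrtTwoE8) :
    ((⌊(inner ℝ v v : ℝ)⌋ : ℤ) : ZMod 2) = ((⌊(inner ℝ w w : ℝ)⌋ : ℤ) : ZMod 2) := by
  obtain ⟨a, ha⟩ := inner_dual_sqrtTwoE8 hv
  obtain ⟨b, hb⟩ := inner_dual_sqrtTwoE8 hw
  obtain ⟨c, hc⟩ : ∃ c : ℤ, inner ℝ w (v - w) = (c : ℝ) := by
    obtain ⟨c, hc⟩ := Submodule.mem_one.mp (hw _ h)
    exact ⟨c, hc.symm⟩
  obtain ⟨y, hy, hyl⟩ := (Submodule.mem_smul_pointwise_iff_exists _ _ _).mp h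
  obtain ⟨d, hd⟩ := latticeE8_even hy
  have hl : inner ℝ (v - w) (v - w) = 4 * (d : ℝ) := by
    rw [← hyl, real_inner_smul_left, real_inner_smul_right, ← mul_assoc,
      Real.mul_self_sqrt (by norm_num), hd]
    ring
  have hab : a = b + 2 * (c + 2 * d) := by
    have e : inner ℝ v v = inner ℝ w w + 2 * inner ℝ w (v - w) + inner ℝ (v - w) (v - w) := by
      simp only [inner_sub_left, inner_sub_right, real_inner_comm v w]
      ring
    rw [ha, hb, hc, hl] at e
    have : (a : ℝ) = ((b + 2 * (c + 2 * d) : ℤ) : ℝ) := by push_cast; linarith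
    exact_mod_cast this
  rw [ha, hb, Int.floor_intCast, Int.floor_intCast, hab]
  push_cast
  rw [show (2 : ZMod 2) = 0 from rfl]
  ring

/-- The map `R(L) → 𝔽₂`, `v + L ↦ (v, v) mod 2`, for `L = √2 E₈`. -/
def discQuadFun (x : DiscGroup sqrtTwoE8) : ZMod 2 :=
  Quotient.liftOn' x
    (fun v : dualLattice sqrtTwoE8 =>
      ((⌊(inner ℝ (v : EuclideanSpace ℝ (Fin 8)) v : ℝ)⌋ : ℤ) : ZMod 2))
    fun v w h => floor_inner_eq_of_sub_mem v.2 w.2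
      (show v - w ∈ sqrtTwoE8.submoduleOf (dualLattice sqrtTwoE8) from
        (Submodule.quotientRel_def _).mp h)

theorem discQuadFun_mk {v : EuclideanSpace ℝ (Fin 8)} (hv : v ∈ dualLattice sqrtTwoE8)
    {n : ℤ} (hn : inner ℝ v v = (n : ℝ)) :
    discQuadFun (discMap sqrtTwoE8 ⟨v, hv⟩) = (n : ZMod 2) := by
  change ((⌊(inner ℝ v v : ℝ)⌋ : ℤ) : ZMod 2) = n
  rw [hn, Int.floor_intCast]

theorem polar_discQuadFun_mk {v w : EuclideanSpace ℝ (Fin 8)}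
    (hv : v ∈ dualLattice sqrtTwoE8) (hw : w ∈ dualLattice sqrtTwoE8)
    {n : ℤ} (hn : 2 * inner ℝ v w = (n : ℝ)) :
    QuadraticMap.polar discQuadFun (discMap sqrtTwoE8 ⟨v, hv⟩) (discMap sqrtTwoE8 ⟨w, hw⟩)
      = (n : ZMod 2) := by
  obtain ⟨a, ha⟩ := inner_dual_sqrtTwoE8 hv
  obtain ⟨b, hb⟩ := inner_dual_sqrtTwoE8 hw
  have hs : inner ℝ (v + w) (v + w) = ((a + b + n : ℤ) : ℝ) := by
    rw [inner_add_left, inner_add_right, inner_add_right, real_inner_comm v w, ha, hb]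
    push_cast
    linarith
  have e := discQuadFun_mk (add_mem hv hw) hs
  rw [QuadraticMap.polar, ← map_add, discQuadFun_mk hv ha, discQuadFun_mk hw hb,
    show (⟨v, hv⟩ + ⟨w, hw⟩ : dualLattice sqrtTwoE8) = ⟨v + w, add_mem hv hw⟩ from rfl, e]
  push_cast
  ring

theorem polar_discQuadFun_add (x y z : DiscGroup sqrtTwoE8) :
    QuadraticMap.polar discQuadFun (x + y) z =
      QuadraticMap.polar discQuadFun x z + QuadraticMap.polar discQuadFun y z := by
  obtain ⟨⟨u, hu⟩, rfl⟩ := Submodule.mkQ_surjective _ x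
  obtain ⟨⟨v, hv⟩, rfl⟩ := Submodule.mkQ_surjective _ y
  obtain ⟨⟨w, hw⟩, rfl⟩ := Submodule.mkQ_surjective _ z
  obtain ⟨a, ha⟩ := inner_dual_sqrtTwoE8' hu hw
  obtain ⟨b, hb⟩ := inner_dual_sqrtTwoE8' hv hw
  have hs : 2 * inner ℝ (u + v) w = ((a + b : ℤ) : ℝ) := by
    rw [inner_add_left]
    push_cast
    linarith
  have e := polar_discQuadFun_mk (add_mem hu hv) hw hs
  rw [← map_add, polar_discQuadFun_mk hu hw ha, polar_discQuadFun_mk hv hw hb,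
    show (⟨u, hu⟩ + ⟨v, hv⟩ : dualLattice sqrtTwoE8) = ⟨u + v, add_mem hu hv⟩ from rfl, e]
  push_cast
  ring

theorem discQuadFun_zero : discQuadFun 0 = 0 := by
  have e := discQuadFun_mk (dualLattice sqrtTwoE8).zero_mem (n := 0) (by simp)
  rw [show (⟨0, (dualLattice sqrtTwoE8).zero_mem⟩ : dualLattice sqrtTwoE8) = 0 from rfl,
    map_zero] at e
  simpa using e

theorem zmod_two_eq (a : ZMod 2) : a = 0 ∨ a = 1 := by
  revert a
  decide

/-- The quadratic form `q_L` on `R(L)`, `q_L(v + L) = (v, v) mod 2`, for `L = √2 E₈`. -/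
def discQuad : QuadraticForm (ZMod 2) (DiscGroup sqrtTwoE8) :=
  QuadraticMap.ofPolar discQuadFun
    (fun a x => by
      rcases zmod_two_eq a with rfl | rfl
      · simp [discQuadFun_zero]
      · simp)
    polar_discQuadFun_add
    (fun a x y => by
      rcases zmod_two_eq a with rfl | rfl
      · simp [QuadraticMap.polar, discQuadFun_zero]
      · simp)

end

/-! Rescaling by `√2` identifies `R(L)` with `E₈/2E₈`, where the quadratic form is `(x, x)/2 mod 2`
and its polar form is `(x, y) mod 2`. Every class of `E₈/2E₈` contains a vector of norm at most 4,
so `w` is half the minimal norm of a class. Norms thereby translate into weights: isometries of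
`E₈³` preserve `w³`. Conversely, `𝔏(S)` is even, contains its dual and has minimal norm at least 4
when `S` is totally singular, contains its orthogonal space and has minimal weight at least 4.

On the finite side, `exists_glue_frames` shows that `S` is unique up to isometries of the three
summands. With suitable hyperbolic bases `V ⊕ V` of the summands, `V = 𝔽₂⁴`, it is `glueCode`: a
common second coordinate, and first coordinates with sum zero. The weight bound makes the vectors of
`S` with a vanishing component have singular components, and a dimension count turns these into
4-dimensional totally singular subspaces of each summand. An automorphism of `w³` permutes the
summands (`exists_perm_of_mem_autWt`), because vectors of weight one are the nonsingular vectors of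
single summands and these are connected by non-orthogonality. Block matrices then give the
stabilizer: `SL₄(2)` acting diagonally, `Sym₃` permuting the summands, and the maps `(a, f) ↦ (a +
Nᵢ f, f)` with `Nᵢ` alternating and of sum zero, which form a group of order `2^(6+6)`.

The two sides meet in `Aut(E₈³) → Aut(R(L)³, w³)`. It is onto (`exists_isometry_of_mem_autWt`):
classes of simple roots go to classes of roots, whose Gram matrix is determined up to signs, and the
signs can be corrected because the Dynkin diagram is a tree. Its kernel consists of a sign on each
summand (`exists_signs_of_inducedAut_eq_one`). This gives the extension by `2³`. For transitivity, a
sublattice isomorphic to `L³` is the image of `L³` under an isometry `h`; then `h⁻¹(𝔏(S)) = 𝔏(T)`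
for another `T` of the same kind, and uniqueness of the glue code carries `S` to `T` by an isometry
preserving `L³`. -/

noncomputable section

/-! ### Totally singular subspaces and hyperbolic complements over `𝔽₂`. -/

section HyperbolicFrames

open QuadraticMap Module

variable {R : Type*} [AddCommGroup R] [Module (ZMod 2) R]

theorem IsTotallySingular.polar_eq_zero {q : QuadraticForm (ZMod 2) R}
    {U : Submodule (ZMod 2) R} (hU : IsTotallySingular q U) {x y : R} (hx : x ∈ U)
    (hy : y ∈ U) : polar q x y = 0 := by
  simp [polar, hU _ hx, hU _ hy, hU _ (U.add_mem hx hy)]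

theorem polar_self_eq_zero (q : QuadraticForm (ZMod 2) R) (x : R) : polar q x x = 0 := by
  rw [polar_self, two_smul]
  exact CharTwo.add_self_eq_zero _

theorem isTotallySingular_span {q : QuadraticForm (ZMod 2) R} {s : Set R}
    (h0 : ∀ x ∈ s, q x = 0) (h1 : ∀ x ∈ s, ∀ y ∈ s, polar q x y = 0) :
    IsTotallySingular q (Submodule.span (ZMod 2) s) := by
  have h2 : ∀ x ∈ s, ∀ y ∈ Submodule.span (ZMod 2) s, polar q x y = 0 := fun x hx y hy => by
    have : Submodule.span (ZMod 2) s ≤ LinearMap.ker (polarBilin q x) :=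
      Submodule.span_le.2 (h1 x hx)
    exact this hy
  have h3 : ∀ x ∈ Submodule.span (ZMod 2) s, ∀ y ∈ Submodule.span (ZMod 2) s,
      polar q x y = 0 := fun x hx y hy => by
    have : Submodule.span (ZMod 2) s ≤ LinearMap.ker (polarBilin q y) :=
      Submodule.span_le.2 fun z hz => by
        simpa [polar_comm q y] using h2 z hz y hy
    rw [polar_comm (⇑q)]
    exact this hx
  intro x hx
  induction hx using Submodule.span_induction with
  | mem x hx => exact h0 x hx
  | zero => exact QuadraticMap.map_zero q
  | add x y hx hy ihx ihy => rw [QuadraticMap.map_add q, ihx, ihy, h3 x hx y hy]; simp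
  | smul a x _ ih => rw [QuadraticMap.map_smul, ih, smul_zero]

theorem polar_quadPow (q : QuadraticForm (ZMod 2) R) {k : ℕ} (x y : Fin k → R) :
    polar (quadPow q k) x y = ∑ i, polar q (x i) (y i) := by
  simp [polar, QuadraticMap.pi_apply, Finset.sum_sub_distrib]

theorem quadPow_polarBilin_nondegenerate {q : QuadraticForm (ZMod 2) R}
    (hq : ∀ x, (∀ y, polar q x y = 0) → x = 0) {k : ℕ} (x : Fin k → R)
    (hx : ∀ y, polar (quadPow q k) x y = 0) : x = 0 := by
  funext i
  refine hq _ fun y => ?_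
  have h := hx (Pi.single i y)
  rw [polar_quadPow, Finset.sum_eq_single i] at h
  · simpa using h
  · intro j _ hj
    simp [Pi.single_eq_of_ne hj]
  · simp

theorem polarBilin_nondegenerate {q : QuadraticForm (ZMod 2) R}
    (hq : ∀ x, (∀ y, polar q x y = 0) → x = 0) :
    LinearMap.BilinForm.Nondegenerate (polarBilin q) :=
  ⟨hq, fun x h => hq x fun y => by rw [polar_comm]; exact h y⟩

theorem exists_polar_eq [FiniteDimensional (ZMod 2) R] {q : QuadraticForm (ZMod 2) R}
    (hq : ∀ x, (∀ y, polar q x y = 0) → x = 0) (g : Dual (ZMod 2) R) :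
    ∃ x, ∀ y, polar q x y = g y := by
  obtain ⟨x, hx⟩ := (LinearMap.BilinForm.toDual (polarBilin q)
    (polarBilin_nondegenerate hq)).surjective g
  exact ⟨x, fun y => by rw [← hx, LinearMap.BilinForm.toDual_def]; rfl⟩

/-- A functional on a subspace pulled back through an injection is represented by the polar
form. -/
theorem exists_polar_comp_eq [FiniteDimensional (ZMod 2) R] {q : QuadraticForm (ZMod 2) R}
    (hq : ∀ x, (∀ y, polar q x y = 0) → x = 0) {V : Type*} [AddCommGroup V]
    [Module (ZMod 2) V] (p : V →ₗ[ZMod 2] R) (g : Dual (ZMod 2) V)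
    (hg : ∀ v, p v = 0 → g v = 0) : ∃ x, ∀ v, polar q x (p v) = g v := by
  have h : g ∈ LinearMap.range p.dualMap := by
    rw [LinearMap.range_dualMap_eq_dualAnnihilator_ker, Submodule.mem_dualAnnihilator]
    exact hg
  obtain ⟨g', rfl⟩ := h
  obtain ⟨x, hx⟩ := exists_polar_eq hq g'
  exact ⟨x, fun v => hx _⟩

theorem finrank_orthogonal_polarBilin [FiniteDimensional (ZMod 2) R]
    {q : QuadraticForm (ZMod 2) R} (hq : ∀ x, (∀ y, polar q x y = 0) → x = 0)
    (U : Submodule (ZMod 2) R) :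
    finrank (ZMod 2) U + finrank (ZMod 2) (LinearMap.BilinForm.orthogonal (polarBilin q) U)
      = finrank (ZMod 2) R := by
  rw [LinearMap.BilinForm.finrank_orthogonal (polarBilin_nondegenerate hq)]
  have := Submodule.finrank_le U
  omega

theorem IsTotallySingular.le_orthogonal {q : QuadraticForm (ZMod 2) R}
    {U : Submodule (ZMod 2) R} (hU : IsTotallySingular q U) :
    U ≤ LinearMap.BilinForm.orthogonal (polarBilin q) U :=
  fun _ hx _ hu => hU.polar_eq_zero hu hx

/-- If a totally singular subspace of half the dimension exists, then every maximal totally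
singular subspace is its own orthogonal space. -/
theorem IsMaxTotallySingular.orthogonal_le [FiniteDimensional (ZMod 2) R]
    {q : QuadraticForm (ZMod 2) R} (hq : ∀ x, (∀ y, polar q x y = 0) → x = 0)
    {U S : Submodule (ZMod 2) R} (hU : IsTotallySingular q U)
    (hU2 : 2 * finrank (ZMod 2) U = finrank (ZMod 2) R) (hS : IsMaxTotallySingular q S) :
    LinearMap.BilinForm.orthogonal (polarBilin q) S ≤ S := by
  let P := LinearMap.BilinForm.orthogonal (polarBilin q)
  have hSt : IsTotallySingular q S := hS.prop
  have hUP : U = P U := Submodule.eq_of_le_of_finrank_eq hU.le_orthogonal (by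
    have : _ + finrank (ZMod 2) (P U) = _ := finrank_orthogonal_polarBilin hq U
    omega)
  -- Adjoining to `S` the singular vectors of `U` orthogonal to it keeps it totally singular, so
  -- maximality absorbs them.
  have h1 : U ⊓ P S ≤ S := by
    have h2 : IsTotallySingular q (S ⊔ (U ⊓ P S)) := by
      intro v hv
      obtain ⟨s, hs, u, hu, rfl⟩ := Submodule.mem_sup.1 hv
      rw [QuadraticMap.map_add q, hSt s hs, hU u hu.1, show polar q s u = 0 from hu.2 s hs]
      simp
    exact le_sup_right.trans (hS.le_of_ge h2 le_sup_left)
  have h3 : P (U ⊔ S) ≤ U ⊓ S := by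
    intro x hx
    have hxU : x ∈ U := by
      rw [hUP]; exact fun u hu => hx u (Submodule.mem_sup_left hu)
    exact ⟨hxU, h1 ⟨hxU, fun u hu => hx u (Submodule.mem_sup_right hu)⟩⟩
  -- From `(U + S)^⊥ ≤ U ∩ S`, the formula for `dim (U + S) + dim (U ∩ S)` gives `dim S ≥ dim R -
  -- dim U`, which is half of `dim R`.
  have h4 : _ + finrank (ZMod 2) (P (U ⊔ S)) = _ := finrank_orthogonal_polarBilin hq (U ⊔ S)
  have h5 : _ + finrank (ZMod 2) (P S) = _ := finrank_orthogonal_polarBilin hq S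
  have h6 := Submodule.finrank_sup_add_finrank_inf_eq U S
  have h7 := Submodule.finrank_mono h3
  exact (Submodule.eq_of_le_of_finrank_le hSt.le_orthogonal (by
    change finrank (ZMod 2) (P S) ≤ _
    omega)).ge

/-- The space `𝔽₂⁴`. -/
abbrev V4 : Type := Fin 4 → ZMod 2

/-- A totally singular copy of `𝔽₂⁴` is half of a hyperbolic frame. -/
theorem exists_hyperbolic_complement [FiniteDimensional (ZMod 2) R]
    {q : QuadraticForm (ZMod 2) R} (hq : ∀ x, (∀ y, polar q x y = 0) → x = 0)
    (φ : V4 →ₗ[ZMod 2] R) (hφ : Function.Injective φ) (hs : ∀ v, q (φ v) = 0) :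
    ∃ ψ : V4 →ₗ[ZMod 2] R, (∀ f, q (ψ f) = 0) ∧ ∀ v f, polar q (φ v) (ψ f) = v ⬝ᵥ f := by
  have h1 : ∀ f : V4, ∃ x, ∀ v, polar q x (φ v) = v ⬝ᵥ f := by
    intro f
    exact exists_polar_comp_eq hq φ ((dotProductBilin (ZMod 2) (ZMod 2)).flip f) (by
      intro v hv
      have : v = 0 := hφ (by simpa using hv)
      simp [this])
  choose x hx using fun j : Fin 4 => h1 (Pi.single j 1)
  -- The `x j` pair correctly with `φ` but need not be singular or mutually orthogonal. Adding `φ (c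
  -- j)` leaves the pairing unchanged; the diagonal entry cancels `q (x j)`. As `c` is triangular,
  -- exactly one of `c i j`, `c j i` enters for each pair and cancels `polar q (x i) (x j)`.
  let c : Fin 4 → V4 := fun j i =>
    if i = j then q (x j) else if i < j then polar q (x i) (x j) else 0
  let y : Fin 4 → R := fun j => x j + φ (c j)
  have hφφ : ∀ u v, polar q (φ u) (φ v) = 0 := fun u v => by
    rw [polar, ← φ.map_add, hs, hs, hs]; simp
  have hqy : ∀ j, q (y j) = 0 := by
    intro j
    have : q (y j) = q (x j) + q (φ (c j)) + polar q (x j) (φ (c j)) := QuadraticMap.map_add q _ _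
    rw [this, hs, hx]
    simp only [c, dotProduct_single, if_true, add_zero, mul_one]
    exact CharTwo.add_self_eq_zero _
  have hyy : ∀ i j, polar q (y i) (y j) = 0 := by
    have key : ∀ i j, i < j → polar q (y i) (y j) = 0 := by
      intro i j hij
      simp only [y]
      rw [polar_add_left, polar_add_right, polar_add_right, hx, hφφ, polar_comm _ (φ (c i)), hx]
      simp only [c, dotProduct_single, mul_one, if_neg hij.ne, if_pos hij, if_neg hij.ne',
        if_neg hij.not_gt, add_zero]
      exact CharTwo.add_self_eq_zero _
    intro i j
    rcases lt_trichotomy i j with h | rfl | h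
    · exact key i j h
    · exact polar_self_eq_zero q _
    · rw [polar_comm]; exact key j i h
  have hφy : ∀ v j, polar q (φ v) (y j) = v j := by
    intro v j
    rw [polar_add_right, hφφ, polar_comm, hx]
    simp
  refine ⟨Fintype.linearCombination (ZMod 2) y, fun f => ?_, fun v f => ?_⟩
  · refine isTotallySingular_span (s := Set.range y) ?_ ?_ _ ?_
    · rintro _ ⟨j, rfl⟩
      exact hqy j
    · rintro _ ⟨i, rfl⟩ _ ⟨j, rfl⟩
      exact hyy i j
    · rw [← Fintype.range_linearCombination]
      exact ⟨f, rfl⟩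
  · rw [Fintype.linearCombination_apply, ← polarBilin_apply_apply, map_sum]
    simp [hφy, dotProduct, mul_comm]

end HyperbolicFrames

/-! ### Uniqueness of the glue code. -/

section GlueFrames

open QuadraticMap Module

/-- The subspace `{(a_i, f)_i | a_0 + a_1 + a_2 = 0}` of `(V ⊕ V)³`. -/
def glueCode : Submodule (ZMod 2) (Fin 3 → V4 × V4) where
  carrier := {m | (m 0).2 = (m 1).2 ∧ (m 1).2 = (m 2).2 ∧ (m 0).1 + (m 1).1 + (m 2).1 = 0}
  zero_mem' := by simp
  add_mem' := by
    rintro a b ⟨h1, h2, h3⟩ ⟨h4, h5, h6⟩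
    refine ⟨by simp [h1, h4], by simp [h2, h5], ?_⟩
    simp only [Pi.add_apply, Prod.fst_add]
    rw [← add_zero (0 : V4)]
    nth_rewrite 1 [← h3]
    rw [← h6]
    abel
  smul_mem' := by
    rintro c a ⟨h1, h2, h3⟩
    refine ⟨by simp [h1], by simp [h2], ?_⟩
    simp only [Pi.smul_apply, Prod.smul_fst, ← smul_add, h3, smul_zero]

/-- Preimages need only be chosen on the four standard basis vectors, since `V4` is free. -/
theorem exists_linear_lift {M N : Type*} [AddCommGroup M] [AddCommGroup N]
    [Module (ZMod 2) M] [Module (ZMod 2) N] (p : M →ₗ[ZMod 2] N) (f : V4 →ₗ[ZMod 2] N)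
    (h : ∀ v, ∃ m, p m = f v) : ∃ g : V4 →ₗ[ZMod 2] M, ∀ v, p (g v) = f v := by
  choose m hm using h
  refine ⟨Fintype.linearCombination (ZMod 2) fun j => m (Pi.single j 1), fun v => ?_⟩
  have : p ∘ₗ (Fintype.linearCombination (ZMod 2) fun j => m (Pi.single j 1)) = f := by
    apply LinearMap.pi_ext'
    intro j
    ext
    simp [hm]
  exact DFunLike.congr_fun this v

variable {R : Type*} [AddCommGroup R] [Module (ZMod 2) R]

theorem wt_le_two (q : QuadraticForm (ZMod 2) R) (a : R) : wt q a ≤ 2 := by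
  unfold wt; split_ifs <;> simp

theorem wt_zero (q : QuadraticForm (ZMod 2) R) : wt q 0 = 0 := by simp [wt]

theorem wt_of_eq_one {q : QuadraticForm (ZMod 2) R} {a : R} (h : q a = 1) : wt q a = 1 := by
  have : a ≠ 0 := by rintro rfl; simp at h
  simp [wt, h, this]

/-- The weight determines the quadratic form mod 2, so maps preserving `wtPow` also preserve
`quadPow` and its polar form. -/
theorem natCast_wt (q : QuadraticForm (ZMod 2) R) (a : R) : (wt q a : ZMod 2) = q a := by
  unfold wt
  split_ifs with h1 h2
  · simp [h1]
  · simp [h2]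
  · rw [(zmod_two_eq (q a)).resolve_right h2]; rfl

theorem natCast_wtPow (q : QuadraticForm (ZMod 2) R) {k : ℕ} (v : Fin k → R) :
    (wtPow q k v : ZMod 2) = quadPow q k v := by
  simp [wtPow, natCast_wt]

/-- A hyperbolic frame of an eight-dimensional quadratic space. -/
theorem exists_frame_equiv [FiniteDimensional (ZMod 2) R] {q : QuadraticForm (ZMod 2) R}
    (hR : finrank (ZMod 2) R = 8) (φ ψ : V4 →ₗ[ZMod 2] R) (hφ : ∀ v, q (φ v) = 0)
    (hψ : ∀ v, q (ψ v) = 0) (h : ∀ v f, polar q (φ v) (ψ f) = v ⬝ᵥ f) :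
    ∃ e : (V4 × V4) ≃ₗ[ZMod 2] R, (∀ m, e m = φ m.1 + ψ m.2) ∧ ∀ m, q (e m) = m.1 ⬝ᵥ m.2 := by
  have hφφ : ∀ u v, polar q (φ u) (φ v) = 0 := fun u v => by
    rw [polar, ← φ.map_add, hφ, hφ, hφ]; simp
  have hψψ : ∀ u v, polar q (ψ u) (ψ v) = 0 := fun u v => by
    rw [polar, ← ψ.map_add, hψ, hψ, hψ]; simp
  have hinj : Function.Injective (φ.coprod ψ) := by
    rw [← LinearMap.ker_eq_bot, LinearMap.ker_eq_bot']
    rintro ⟨v, f⟩ hvf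
    have hvf : φ v + ψ f = 0 := by simpa using hvf
    have h1 : v = 0 := by
      rw [← dotProduct_eq_zero_iff]
      intro g
      have := polar_add_left q (φ v) (ψ f) (ψ g)
      rwa [hvf, hψψ, h, add_zero, polar_zero_left, eq_comm] at this
    have h2 : f = 0 := by
      rw [← dotProduct_eq_zero_iff]
      intro g
      have := polar_add_right q (φ g) (φ v) (ψ f)
      rwa [hvf, hφφ, h, zero_add, polar_zero_right, eq_comm, dotProduct_comm] at this
    simp [h1, h2]
  refine ⟨LinearEquiv.ofInjectiveOfFinrankEq (φ.coprod ψ) hinj (by simp [hR]), fun m => rfl, fun m => ?_⟩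
  change q (φ m.1 + ψ m.2) = _
  rw [QuadraticMap.map_add q, hφ, hψ, h]
  simp

theorem polar_frame {q : QuadraticForm (ZMod 2) R} (e : (V4 × V4) ≃ₗ[ZMod 2] R)
    (he : ∀ m, q (e m) = m.1 ⬝ᵥ m.2) (m n : V4 × V4) :
    polar q (e m) (e n) = m.1 ⬝ᵥ n.2 + n.1 ⬝ᵥ m.2 := by
  rw [polar, ← map_add, he, he, he]
  simp [add_dotProduct, dotProduct_add]
  ring

theorem eq_of_dotProduct_eq {f g : V4} (h : ∀ v, v ⬝ᵥ f + v ⬝ᵥ g = 0) : f = g := by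
  refine CharTwo.add_eq_zero.1 ((dotProduct_eq_zero_iff).1 fun v => ?_)
  rw [add_dotProduct, dotProduct_comm f, dotProduct_comm g, h]

/-- A self-orthogonal totally singular subspace of `R³` of minimal weight at least four is the
glue code with respect to suitable hyperbolic frames of the three summands. -/
theorem exists_glue_frames [FiniteDimensional (ZMod 2) R] {q : QuadraticForm (ZMod 2) R}
    (hq : ∀ x, (∀ y, polar q x y = 0) → x = 0) (hR : finrank (ZMod 2) R = 8)
    (S : Submodule (ZMod 2) (Fin 3 → R)) (hS : IsTotallySingular (quadPow q 3) S)
    (hS' : LinearMap.BilinForm.orthogonal (polarBilin (quadPow q 3)) S ≤ S)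
    (hw : ∀ v ∈ S, v ≠ 0 → 4 ≤ wtPow q 3 v) :
    ∃ ι : Fin 3 → ((V4 × V4) ≃ₗ[ZMod 2] R), (∀ i m, q (ι i m) = m.1 ⬝ᵥ m.2) ∧
      ∀ m : Fin 3 → V4 × V4, (fun i => ι i (m i)) ∈ S ↔ m ∈ glueCode := by
  have hq3 := @quadPow_polarBilin_nondegenerate R _ _ q hq 3
  have hdim : finrank (ZMod 2) S = 12 := by
    have h1 := finrank_orthogonal_polarBilin hq3 S
    have h2 := Submodule.finrank_mono hS'
    have h3 := Submodule.finrank_mono hS.le_orthogonal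
    have h4 : finrank (ZMod 2) (Fin 3 → R) = 24 := by
      rw [Module.finrank_pi_fintype]; simp [hR]
    omega
  let p : Fin 3 → (S →ₗ[ZMod 2] R) := fun i => LinearMap.proj i ∘ₗ S.subtype
  have hp : ∀ i (s : S), p i s = s.1 i := fun _ _ => rfl
  have hwsum : ∀ s : S, s ≠ 0 → 4 ≤ wt q (p 0 s) + wt q (p 1 s) + wt q (p 2 s) := by
    intro s hs
    have := hw s.1 s.2 (by simpa using hs)
    rwa [wtPow, Fin.sum_univ_three] at this
  -- A vector with one nonzero component has weight at most 2, below the bound 4.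
  have F1 : ∀ i j, i ≠ j → ∀ s, p i s = 0 → p j s = 0 → s = 0 := by
    intro i j hij s hi hj
    by_contra hs
    have h1 := hwsum s hs
    have h20 := wt_le_two q (p 0 s)
    have h21 := wt_le_two q (p 1 s)
    have h22 := wt_le_two q (p 2 s)
    have h3 : wt q (p i s) = 0 := by rw [hi, wt_zero]
    have h4 : wt q (p j s) = 0 := by rw [hj, wt_zero]
    fin_cases i <;> fin_cases j <;> simp at hij h3 h4 <;> omega
  -- If one component vanishes, the other two must both have the maximal weight 2, which excludes
  -- nonsingular components.
  have F2 : ∀ i j s, p i s = 0 → q (p j s) = 0 := by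
    intro i j s hi
    by_cases hs : s = 0
    · simp [hs]
    by_contra hj
    have hj' := wt_of_eq_one ((zmod_two_eq _).resolve_left hj)
    have h1 := hwsum s hs
    have h20 := wt_le_two q (p 0 s)
    have h21 := wt_le_two q (p 1 s)
    have h22 := wt_le_two q (p 2 s)
    have h3 : wt q (p i s) = 0 := by rw [hi, wt_zero]
    fin_cases i <;> fin_cases j <;> simp at hj' h3 <;> omega
  have hpol : ∀ s t : S, polar q (p 0 s) (p 0 t) + polar q (p 1 s) (p 1 t)
      + polar q (p 2 s) (p 2 t) = 0 := by
    intro s t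
    have := hS.polar_eq_zero s.2 t.2
    rwa [polar_quadPow, Fin.sum_univ_three] at this
  let Φ : Fin 3 → Fin 3 → Submodule (ZMod 2) R := fun i j => (LinearMap.ker (p i)).map (p j)
  have hΦs : ∀ i j, IsTotallySingular q (Φ i j) := by
    rintro i j _ ⟨s, hs, rfl⟩
    exact F2 i j s hs
  have hinj : ∀ i j, i ≠ j → Function.Injective ((p j).domRestrict (LinearMap.ker (p i))) := by
    intro i j hij
    rw [← LinearMap.ker_eq_bot, LinearMap.ker_eq_bot']
    rintro ⟨s, hs⟩ h
    exact Subtype.ext (F1 i j hij s hs h)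
  have hΦd : ∀ i j, i ≠ j → finrank (ZMod 2) (Φ i j) = finrank (ZMod 2) (LinearMap.ker (p i)) := by
    intro i j hij
    have := LinearMap.finrank_range_of_inj (hinj i j hij)
    rwa [LinearMap.range_domRestrict] at this
  have hfour : ∀ U : Submodule (ZMod 2) R, IsTotallySingular q U → finrank (ZMod 2) U ≤ 4 := by
    intro U hU
    have h1 := finrank_orthogonal_polarBilin hq U
    have h2 := Submodule.finrank_mono hU.le_orthogonal
    omega
  -- The kernel embeds as a totally singular subspace of dimension at most 4, while rank-nullity
  -- with `dim S = 12` and an image of dimension at most 8 gives at least 4.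
  have hK : ∀ i, finrank (ZMod 2) (LinearMap.ker (p i)) = 4 := by
    intro i
    have h1 := LinearMap.finrank_range_add_finrank_ker (p i)
    have h2 := Submodule.finrank_le (LinearMap.range (p i))
    obtain ⟨j, hij⟩ : ∃ j : Fin 3, i ≠ j := ⟨i + 1, by fin_cases i <;> simp⟩
    have h3 := hfour _ (hΦs i j)
    rw [hΦd i j hij] at h3
    omega
  -- Vectors of `S` of the forms `(0, *, *)` and `(*, *, 0)` overlap only in the middle slot, so
  -- their middle components are orthogonal. `Φ 2 1` has half the dimension and hence equals its
  -- orthogonal space.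
  have hΦ01 : Φ 0 1 ≤ Φ 2 1 := by
    have h1 : LinearMap.BilinForm.orthogonal (polarBilin q) (Φ 2 1) = Φ 2 1 := by
      refine (Submodule.eq_of_le_of_finrank_eq (hΦs 2 1).le_orthogonal ?_).symm
      have := finrank_orthogonal_polarBilin hq (Φ 2 1)
      rw [hΦd 2 1 (by decide), hK, hR] at this
      rw [hΦd 2 1 (by decide), hK]
      omega
    rw [← h1]
    rintro _ ⟨t, ht, rfl⟩ _ ⟨s, hs, rfl⟩
    have := hpol s t
    rw [show p 0 t = 0 from ht, show p 2 s = 0 from hs] at this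
    simpa using this
  have hΦeq : Φ 0 1 = Φ 2 1 := Submodule.eq_of_le_of_finrank_eq hΦ01 (by
    rw [hΦd 0 1 (by decide), hΦd 2 1 (by decide), hK, hK])
  let e : V4 ≃ₗ[ZMod 2] LinearMap.ker (p 2) := LinearEquiv.ofFinrankEq _ _ (by rw [hK]; simp)
  let A : V4 →ₗ[ZMod 2] S := (LinearMap.ker (p 2)).subtype ∘ₗ e.toLinearMap
  have hA2 : ∀ v, p 2 (A v) = 0 := fun v => (e v).2
  have hAinj : Function.Injective A := Subtype.val_injective.comp e.injective
  -- `A v` has the form `(*, φ₁ v, 0)`. `T v` is the vector `(0, φ₁ v, *)` of `S` with the same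
  -- middle component, so the parametrizations of the three subspaces are matched.
  obtain ⟨T, hT⟩ := exists_linear_lift ((p 1).domRestrict (LinearMap.ker (p 0))) (p 1 ∘ₗ A) (by
    intro v
    have : p 1 (A v) ∈ Φ 0 1 := by
      rw [hΦeq]; exact ⟨A v, hA2 v, rfl⟩
    obtain ⟨s, hs, h⟩ := this
    exact ⟨⟨s, hs⟩, h⟩)
  have hT0 : ∀ v, p 0 (T v).1 = 0 := fun v => (T v).2
  have hT1 : ∀ v, p 1 (T v).1 = p 1 (A v) := hT
  have hTsurj : ∀ s, p 0 s = 0 → ∃ v, s = (T v).1 := by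
    intro s hs
    have : p 1 s ∈ Φ 2 1 := by rw [← hΦeq]; exact ⟨s, hs, rfl⟩
    obtain ⟨t, ht, hts⟩ := this
    obtain ⟨v, hv⟩ := e.surjective ⟨t, ht⟩
    refine ⟨v, ?_⟩
    rw [← sub_eq_zero]
    refine F1 0 1 (by decide) _ (by rw [map_sub, hs, hT0, sub_zero]) ?_
    rw [map_sub, hT1, ← hts, show A v = t from congrArg Subtype.val hv, sub_self]
  have hzero : ∀ v, A v = 0 → v = 0 := fun v hv => hAinj (by rw [hv, map_zero])
  have hφ1inj : Function.Injective (p 1 ∘ₗ A) := by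
    rw [← LinearMap.ker_eq_bot, LinearMap.ker_eq_bot']
    intro v hv
    exact hzero v (F1 1 2 (by decide) _ hv (hA2 v))
  let φ2 : V4 →ₗ[ZMod 2] R := p 2 ∘ₗ (LinearMap.ker (p 0)).subtype ∘ₗ T
  have hφ2 : ∀ v, φ2 v = p 2 (T v).1 := fun _ => rfl
  have hφ2inj : Function.Injective φ2 := by
    rw [← LinearMap.ker_eq_bot, LinearMap.ker_eq_bot']
    intro v hv
    have h0 := F1 0 2 (by decide) _ (hT0 v) hv
    refine hφ1inj ?_
    rw [map_zero, LinearMap.comp_apply, ← hT1, h0, map_zero]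
  have hs1 : ∀ v, q ((p 1 ∘ₗ A) v) = 0 := fun v => F2 2 1 _ (hA2 v)
  have hs2 : ∀ v, q (φ2 v) = 0 := fun v => F2 0 2 _ (hT0 v)
  obtain ⟨ψ1, hψ1, hφψ1⟩ := exists_hyperbolic_complement hq (p 1 ∘ₗ A) hφ1inj hs1
  obtain ⟨ψ2, hψ2, hφψ2⟩ := exists_hyperbolic_complement hq φ2 hφ2inj hs2
  -- The complements in slots 1 and 2 are chosen freely. The one in slot 0 is then forced by
  -- requiring `(x, ψ1 f, ψ2 f) ∈ S^⊥ ≤ S`. The condition on `x` is solvable because its right-hand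
  -- side on `T v` is `v ⬝ᵥ f + v ⬝ᵥ f = 0`.
  obtain ⟨D, hD⟩ := exists_linear_lift ((p 1).prod (p 2)) (ψ1.prod ψ2) (by
    intro f
    obtain ⟨x, hx⟩ := exists_polar_comp_eq hq (p 0)
      ((polarBilin q (ψ1 f)) ∘ₗ p 1 + (polarBilin q (ψ2 f)) ∘ₗ p 2) (by
        intro s hs
        obtain ⟨v, rfl⟩ := hTsurj s hs
        have h1 := hφψ1 v f
        have h2 := hφψ2 v f
        rw [polar_comm] at h1 h2
        simp only [LinearMap.add_apply, LinearMap.comp_apply, polarBilin_apply_apply, hT1]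
        rw [← hφ2, h2]
        rw [LinearMap.comp_apply] at h1
        rw [h1]
        exact CharTwo.add_self_eq_zero _)
    have hmem : ![x, ψ1 f, ψ2 f] ∈ S := by
      apply hS'
      intro s hs
      have h := hx ⟨s, hs⟩
      simp only [LinearMap.add_apply, LinearMap.comp_apply, polarBilin_apply_apply, hp] at h
      change polar (quadPow q 3) s _ = 0
      rw [polar_comm, polar_quadPow, Fin.sum_univ_three]
      simp only [Matrix.cons_val]
      rw [h, add_assoc]
      exact CharTwo.add_self_eq_zero _
    exact ⟨⟨_, hmem⟩, rfl⟩)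
  have hD1 : ∀ f, p 1 (D f) = ψ1 f := fun f => congrArg Prod.fst (hD f)
  have hD2 : ∀ f, p 2 (D f) = ψ2 f := fun f => congrArg Prod.snd (hD f)
  have hs0 : ∀ v, q ((p 0 ∘ₗ A) v) = 0 := fun v => F2 2 0 _ (hA2 v)
  have hψ0 : ∀ f, q ((p 0 ∘ₗ D) f) = 0 := by
    intro f
    have h : ∑ i, q ((D f).1 i) = 0 := by
      simpa using hS _ (D f).2
    rw [Fin.sum_univ_three] at h
    simp only [← hp, hD1, hD2, hψ1, hψ2, add_zero] at h
    exact h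
  have hφψ0 : ∀ v f, polar q ((p 0 ∘ₗ A) v) ((p 0 ∘ₗ D) f) = v ⬝ᵥ f := by
    intro v f
    have h := hpol (A v) (D f)
    have h1 := hφψ1 v f
    rw [LinearMap.comp_apply] at h1
    rw [hA2, polar_zero_left, hD1, h1, add_zero] at h
    exact CharTwo.add_eq_zero.1 h
  obtain ⟨ι0, hι0, hqι0⟩ := exists_frame_equiv hR _ _ hs0 hψ0 hφψ0
  obtain ⟨ι1, hι1, hqι1⟩ := exists_frame_equiv hR _ _ hs1 hψ1 hφψ1
  obtain ⟨ι2, hι2, hqι2⟩ := exists_frame_equiv hR _ _ hs2 hψ2 hφψ2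
  refine ⟨![ι0, ι1, ι2], ?_, ?_⟩
  · intro i
    fin_cases i
    exacts [hqι0, hqι1, hqι2]
  intro m
  have hm : (fun i => ![ι0, ι1, ι2] i (m i)) = ![ι0 (m 0), ι1 (m 1), ι2 (m 2)] := by
    funext i; fin_cases i <;> rfl
  rw [hm]
  have e0 : ∀ v, p 0 (A v) = ι0 (v, 0) := fun v => by rw [hι0]; simp
  have e1 : ∀ v, p 1 (A v) = ι1 (v, 0) := fun v => by rw [hι1]; simp
  have e1' : ∀ v, p 1 (T v).1 = ι1 (v, 0) := fun v => by rw [hT1, e1]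
  have e2 : ∀ v, p 2 (T v).1 = ι2 (v, 0) := fun v => by rw [hι2]; simp [hφ2]
  have d0 : ∀ f, p 0 (D f) = ι0 (0, f) := fun f => by rw [hι0]; simp
  have d1 : ∀ f, p 1 (D f) = ι1 (0, f) := fun f => by rw [hι1, hD1]; simp
  have d2 : ∀ f, p 2 (D f) = ι2 (0, f) := fun f => by rw [hι2, hD2]; simp
  have zero_dotProduct' : ∀ v : V4, v ⬝ᵥ (0 : V4) = 0 := dotProduct_zero
  have hP := @polar_frame R _ _ q
  constructor
  · intro h
    -- Orthogonality to the vectors `A v`, `T v` and `D f` of `S` gives, in turn, the three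
    -- equations of `glueCode`.
    have hpp : ∀ s : S, polar q (p 0 s) (ι0 (m 0)) + polar q (p 1 s) (ι1 (m 1))
      + polar q (p 2 s) (ι2 (m 2)) = 0 := fun s => hpol s ⟨_, h⟩
    have h01 : (m 0).2 = (m 1).2 := by
      refine eq_of_dotProduct_eq fun v => ?_
      have := hpp (A v)
      rwa [e0, e1, hA2, polar_zero_left, hP ι0 hqι0, hP ι1 hqι1, zero_dotProduct', zero_dotProduct',
        add_zero, add_zero, add_zero] at this
    have h12 : (m 1).2 = (m 2).2 := by
      refine eq_of_dotProduct_eq fun v => ?_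
      have := hpp (T v).1
      rwa [e1', e2, hT0, polar_zero_left, hP ι1 hqι1, hP ι2 hqι2, zero_dotProduct', zero_dotProduct',
        zero_add, add_zero, add_zero] at this
    refine ⟨h01, h12, ?_⟩
    rw [← dotProduct_eq_zero_iff]
    intro f
    have := hpp (D f)
    rw [d0, d1, d2, hP ι0 hqι0, hP ι1 hqι1, hP ι2 hqι2] at this
    simpa [add_dotProduct] using this
  · rintro ⟨h1, h2, h3⟩
    have h4 : (m 1).1 = (m 0).1 + (m 2).1 := by
      rw [add_right_comm] at h3
      exact (CharTwo.add_eq_zero.1 h3).symm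
    have : ![ι0 (m 0), ι1 (m 1), ι2 (m 2)]
        = (A (m 0).1 + (T (m 2).1).1 + D (m 0).2 : S).1 := by
      funext i
      rw [← hp]
      simp only [map_add]
      fin_cases i
      · simp only [Fin.zero_eta, e0, hT0, d0, add_zero]
        rw [← map_add]
        simp
      · simp only [Fin.mk_one, e1, e1', d1, ← map_add]
        simp [← h4, h1]
      · simp only [Fin.reduceFinMk, hA2, e2, d2, zero_add, ← map_add]
        simp [h1, h2]
    rw [this]
    exact Subtype.prop _

end GlueFrames

/-! ### A criterion for split extensions inside an ambient group. -/

section SplitExtensions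

/-- A group that factors as a normal subgroup and a complement is a split extension. -/
theorem exists_split_extension {N Q G : Type*} [Group N] [Group Q] [Group G]
    (K H : Subgroup G) (i : N →* G) (s : Q →* G) (hi : Function.Injective i)
    (hiK : ∀ n, i n ∈ K) (hiH : ∀ n, i n ∈ H) (hsK : ∀ q, s q ∈ K) (hsH : ∀ q, s q ∈ H)
    (hconj : ∀ q n, ∃ n', s q * i n = i n' * s q)
    (hsurj : ∀ g ∈ K, g ∈ H → ∃ n q, g = i n * s q) (htriv : ∀ n q, i n = s q → q = 1) :
    ∃ X : GroupExtension N (H.subgroupOf K) Q, Nonempty X.Splitting := by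
  -- `htriv` says that the two images meet trivially and, at `n = 1`, that `s` is injective. Hence
  -- the `Q`-component of a factorization is unique, and it defines the projection `r`.
  have huniq : ∀ n q n' q', i n * s q = i n' * s q' → q = q' := by
    intro n q n' q' h
    have h1 : i (n'⁻¹ * n) = s (q' * q⁻¹) := by
      rw [map_mul, map_inv, map_mul, map_inv, inv_mul_eq_iff_eq_mul, ← mul_assoc, ← h,
        mul_inv_cancel_right]
    exact (mul_inv_eq_one.1 (htriv _ _ h1)).symm
  choose f r hfr using fun e : H.subgroupOf K => hsurj e.1.1 e.1.2 e.2
  let rh : H.subgroupOf K →* Q := MonoidHom.mk' r fun a b => by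
    obtain ⟨n', hn'⟩ := hconj (r a) (f b)
    refine huniq (f (a * b)) _ (f a * n') _ ?_
    rw [← hfr, map_mul, map_mul, mul_assoc (i (f a)), ← mul_assoc (i n'), ← hn', mul_assoc (s _),
      ← hfr b, ← mul_assoc, ← hfr]
    rfl
  let inl : N →* H.subgroupOf K :=
    { toFun := fun n => ⟨⟨i n, hiK n⟩, hiH n⟩
      map_one' := by ext; simp
      map_mul' := fun a b => by ext; simp }
  let sec : Q →* H.subgroupOf K :=
    { toFun := fun q => ⟨⟨s q, hsK q⟩, hsH q⟩
      map_one' := by ext; simp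
      map_mul' := fun a b => by ext; simp }
  have hsec : ∀ q, rh (sec q) = q := fun q =>
    huniq (f (sec q)) _ 1 q (by rw [map_one, one_mul]; exact (hfr (sec q)).symm)
  refine ⟨⟨inl, rh, ?_, ?_, fun q => ⟨sec q, hsec q⟩⟩, ⟨⟨sec, hsec⟩⟩⟩
  · intro a b hab
    exact hi (congrArg (fun x : H.subgroupOf K => x.1.1) hab)
  · ext e
    rw [MonoidHom.mem_range, MonoidHom.mem_ker]
    constructor
    · rintro ⟨n, rfl⟩
      exact huniq (f (inl n)) _ n 1 (by rw [map_one, mul_one]; exact (hfr (inl n)).symm)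
    · intro he
      refine ⟨f e, Subtype.ext (Subtype.ext ?_)⟩
      have := hfr e
      rw [show r e = 1 from he, map_one, mul_one] at this
      exact this.symm

end SplitExtensions

/-! ### Automorphisms of the weight permute the summands. -/

section Slots

open QuadraticMap Module

variable {R : Type*} [AddCommGroup R] [Module (ZMod 2) R]

theorem wtPow_single (q : QuadraticForm (ZMod 2) R) {k : ℕ} (i : Fin k) (x : R) :
    wtPow q k (Pi.single i x) = wt q x := by
  rw [wtPow, Finset.sum_eq_single i]
  · simp
  · intro j _ hj
    rw [Pi.single_eq_of_ne hj, wt_zero]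
  · simp

/-- This is how the weight function sees the decomposition: a sum of natural numbers equal to one
has a single nonzero term. -/
theorem eq_single_of_wtPow_eq_one {q : QuadraticForm (ZMod 2) R} {k : ℕ} {v : Fin k → R}
    (h : wtPow q k v = 1) : ∃ i x, v = Pi.single i x ∧ q x = 1 := by
  have h0 : ∀ a, wt q a = 0 → a = 0 := by
    intro a; unfold wt; split_ifs <;> simp [*]
  rw [wtPow] at h
  obtain ⟨i, -, hi⟩ := Finset.exists_ne_zero_of_sum_ne_zero (h.symm ▸ one_ne_zero : _ ≠ 0)
  rw [← Finset.add_sum_erase _ _ (Finset.mem_univ i)] at h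
  have h1 : wt q (v i) = 1 := by omega
  have h2 : ∑ x ∈ Finset.univ.erase i, wt q (v x) = 0 := by omega
  rw [Finset.sum_eq_zero_iff] at h2
  refine ⟨i, v i, funext fun j => ?_, ?_⟩
  · by_cases hj : j = i
    · subst hj; simp
    · rw [Pi.single_eq_of_ne hj]
      exact h0 _ (h2 j (by simp [hj]))
  · rw [← natCast_wt, h1]; rfl

theorem quadPow_of_mem_autWt {q : QuadraticForm (ZMod 2) R} {k : ℕ}
    {g : (Fin k → R) ≃ₗ[ZMod 2] (Fin k → R)} (hg : g ∈ autWt q k) (v : Fin k → R) :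
    quadPow q k (g v) = quadPow q k v := by
  rw [← natCast_wtPow, hg v, natCast_wtPow]

theorem polar_of_mem_autWt {q : QuadraticForm (ZMod 2) R} {k : ℕ}
    {g : (Fin k → R) ≃ₗ[ZMod 2] (Fin k → R)} (hg : g ∈ autWt q k) (v w : Fin k → R) :
    polar (quadPow q k) (g v) (g w) = polar (quadPow q k) v w := by
  rw [polar, ← map_add, quadPow_of_mem_autWt hg, quadPow_of_mem_autWt hg,
    quadPow_of_mem_autWt hg]
  rfl

theorem polar_single_single (q : QuadraticForm (ZMod 2) R) {k : ℕ} (i j : Fin k) (x y : R) :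
    polar (quadPow q k) (Pi.single i x) (Pi.single j y) = if i = j then polar q x y else 0 := by
  rw [polar_quadPow]
  split_ifs with h
  · subst h
    rw [Finset.sum_eq_single i]
    · simp
    · intro l _ hl
      simp [Pi.single_eq_of_ne hl]
    · simp
  · refine Finset.sum_eq_zero fun l _ => ?_
    by_cases hl : l = i
    · subst hl
      simp [Pi.single_eq_of_ne h]
    · simp [Pi.single_eq_of_ne hl]

theorem sum_single_apply {k : ℕ} (g : (Fin k → R) →ₗ[ZMod 2] (Fin k → R)) (m : Fin k → R) :
    g m = ∑ l, g (Pi.single l (m l)) := by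
  rw [← map_sum, Finset.univ_sum_single]

/-- When the nonsingular vectors of `R` contain a connected generating family, automorphisms of
`(R³, w³)` permute the three summands. -/
theorem exists_perm_of_mem_autWt {q : QuadraticForm (ZMod 2) R} {n k : ℕ} (r : Fin (n + 1) → R)
    (hr : ∀ a, q (r a) = 1) (hspan : Submodule.span (ZMod 2) (Set.range r) = ⊤)
    (hconn : ∀ a, a ≠ 0 → ∃ b < a, polar q (r b) (r a) = 1)
    {g : (Fin k → R) ≃ₗ[ZMod 2] (Fin k → R)} (hg : g ∈ autWt q k) :
    ∃ (σ : Equiv.Perm (Fin k)) (h : Fin k → (R →ₗ[ZMod 2] R)),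
      (∀ m i, g m i = h i (m (σ⁻¹ i))) ∧ ∀ i x, q (h i x) = q x := by
  have h1 : ∀ i a, ∃ j x, g (Pi.single i (r a)) = Pi.single j x ∧ q x = 1 := fun i a =>
    eq_single_of_wtPow_eq_one (q := q) (by rw [hg, wtPow_single, wt_of_eq_one (hr a)])
  choose j x hx hqx using h1
  -- Vectors in different slots are orthogonal, so two non-orthogonal nonsingular vectors of one
  -- slot land in a common slot. Each index is linked to a smaller one, which allows induction down
  -- to `0`.
  have hj : ∀ i a, j i a = j i 0 := by
    intro i a
    induction a using WellFoundedLT.induction with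
    | ind a ih =>
      by_cases ha : a = 0
      · rw [ha]
      obtain ⟨b, hb, hba⟩ := hconn a ha
      rw [← ih b hb]
      by_contra hne
      have h2 := polar_of_mem_autWt hg (Pi.single i (r b)) (Pi.single i (r a))
      rw [hx, hx, polar_single_single, polar_single_single, if_neg (Ne.symm hne), if_pos rfl,
        hba] at h2
      exact zero_ne_one h2
  have hτ : ∀ i l y, l ≠ j i 0 → g (Pi.single i y) l = 0 := by
    intro i l y hl
    let f : R →ₗ[ZMod 2] R := LinearMap.proj l ∘ₗ g.toLinearMap ∘ₗ LinearMap.single (ZMod 2) (fun _ => R) i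
    have : (⊤ : Submodule (ZMod 2) R) ≤ LinearMap.ker f := by
      rw [← hspan, Submodule.span_le]
      rintro _ ⟨a, rfl⟩
      change g (Pi.single i (r a)) l = 0
      rw [hx, hj, Pi.single_eq_of_ne hl]
    exact this (Submodule.mem_top (x := y))
  -- A slot missed by every image could not contain the nonzero vector `r 0`, contradicting
  -- surjectivity of `g`.
  have hsurj : Function.Surjective fun i => j i 0 := by
    intro l
    by_contra! hl
    obtain ⟨m, hm⟩ := g.surjective (Pi.single l (r 0))
    have h2 := sum_single_apply g.toLinearMap m
    have h3 : r 0 = 0 := by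
      have h4 := congrFun (hm.symm.trans h2) l
      rw [Pi.single_eq_same, Finset.sum_apply] at h4
      rw [h4]
      exact Finset.sum_eq_zero fun i _ => hτ i l _ (hl i).symm
    have := hr 0
    rw [h3] at this
    simp at this
  let σ := Equiv.ofBijective _ (Finite.surjective_iff_bijective.1 hsurj)
  have hσ : ∀ i, j i 0 = σ i := fun _ => rfl
  have hg1 : ∀ i y, g (Pi.single i y) = Pi.single (σ i) (g (Pi.single i y) (σ i)) := by
    intro i y
    funext l
    by_cases hl : l = σ i
    · subst hl; simp
    · rw [hτ i l y hl, Pi.single_eq_of_ne hl]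
  refine ⟨σ, fun i => LinearMap.proj i ∘ₗ g.toLinearMap ∘ₗ LinearMap.single (ZMod 2) (fun _ => R) (σ⁻¹ i),
    fun m i => ?_, fun i y => ?_⟩
  · have h2 : g m = _ := sum_single_apply g.toLinearMap m
    rw [h2, Finset.sum_apply, Finset.sum_eq_single (σ⁻¹ i)]
    · rfl
    · intro l _ hl
      refine hτ l i _ fun h => hl ?_
      rw [hσ] at h
      simp [h]
    · simp
  · change q (g (Pi.single (σ⁻¹ i) y) i) = q y
    have h3 := quadPow_of_mem_autWt hg (Pi.single (σ⁻¹ i) y)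
    rw [hg1] at h3
    rw [← natCast_wtPow, ← natCast_wtPow, wtPow_single, wtPow_single, natCast_wt, natCast_wt] at h3
    simpa using h3

end Slots

/-! ### Unipotent and Levi subgroups stabilizing the glue code. -/

section GlueStabilizer

open QuadraticMap Module Matrix

/-- The hyperbolic quadratic form `(v, f) ↦ v ⬝ f`. -/
def hypForm : QuadraticForm (ZMod 2) (V4 × V4) :=
  LinearMap.BilinMap.toQuadraticMap
    ((dotProductBilin (ZMod 2) (ZMod 2)).compl₁₂ (LinearMap.fst _ V4 V4) (LinearMap.snd _ V4 V4))

theorem hypForm_apply (m : V4 × V4) : hypForm m = m.1 ⬝ᵥ m.2 := rfl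

theorem polar_hypForm (m n : V4 × V4) :
    polar hypForm m n = m.1 ⬝ᵥ n.2 + n.1 ⬝ᵥ m.2 :=
  polar_frame (LinearEquiv.refl _ _) hypForm_apply m n

/-- The alternating `4 × 4` matrix with given upper triangle. -/
def altMatrix : (Fin 6 → ZMod 2) →+ Matrix (Fin 4) (Fin 4) (ZMod 2) where
  toFun y := !![0, y 0, y 1, y 2; y 0, 0, y 3, y 4; y 1, y 3, 0, y 5; y 2, y 4, y 5, 0]
  map_zero' := by ext i j; fin_cases i <;> fin_cases j <;> rfl
  map_add' x y := by ext i j; fin_cases i <;> fin_cases j <;> simp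

theorem altMatrix_injective : Function.Injective altMatrix := by
  intro x y h
  funext i
  have h' := fun a b => congrFun (congrFun h a) b
  fin_cases i
  exacts [h' 0 1, h' 0 2, h' 0 3, h' 1 2, h' 1 3, h' 2 3]

theorem altMatrix_dotProduct (y : Fin 6 → ZMod 2) (f : V4) : f ⬝ᵥ altMatrix y *ᵥ f = 0 := by
  have h2 : (2 : ZMod 2) = 0 := rfl
  simp only [altMatrix, AddMonoidHom.coe_mk, ZeroHom.coe_mk, dotProduct, mulVec, Fin.sum_univ_four,
    Matrix.of_apply, Matrix.cons_val', Matrix.cons_val]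
  -- By symmetry every off-diagonal product occurs twice, and there is no diagonal contribution.
  linear_combination (y 0 * f 0 * f 1 + y 1 * f 0 * f 2 + y 2 * f 0 * f 3 + y 3 * f 1 * f 2 +
    y 4 * f 1 * f 3 + y 5 * f 2 * f 3) * h2

/-- Testing on basis vectors kills the diagonal; testing on sums of two of them gives symmetry. -/
theorem exists_altMatrix {N : Matrix (Fin 4) (Fin 4) (ZMod 2)}
    (h : ∀ f : V4, f ⬝ᵥ N *ᵥ f = 0) : ∃ y, N = altMatrix y := by
  have hd : ∀ i, N i i = 0 := fun i => by
    have := h (Pi.single i 1)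
    simpa using this
  have hs : ∀ i j, N i j = N j i := fun i j => by
    have := h (Pi.single i 1 + Pi.single j 1)
    rw [mulVec_add, add_dotProduct, dotProduct_add, dotProduct_add] at this
    simp only [mulVec_single_one, single_one_dotProduct, col_apply, hd] at this
    exact CharTwo.add_eq_zero.1 (by simpa using this)
  refine ⟨![N 0 1, N 0 2, N 0 3, N 1 2, N 1 3, N 2 3], ?_⟩
  ext i j
  fin_cases i <;> fin_cases j <;> simp [altMatrix, hd] <;> apply hs

/-- Triples of alternating matrices with sum zero. -/
def altTriple : (Fin 12 → ZMod 2) →+ (Fin 3 → Matrix (Fin 4) (Fin 4) (ZMod 2)) where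
  toFun x := ![altMatrix fun i => x (Fin.castAdd 6 i), altMatrix fun i => x (Fin.natAdd 6 i),
    (altMatrix fun i => x (Fin.castAdd 6 i)) + altMatrix fun i => x (Fin.natAdd 6 i)]
  map_zero' := by
    funext i
    have : altMatrix (fun _ => 0) = 0 := map_zero altMatrix
    fin_cases i <;> simp [this]
  map_add' x y := by
    have h : ∀ e : Fin 6 → Fin 12, altMatrix (fun i => (x + y) (e i)) =
      altMatrix (fun i => x (e i)) + altMatrix (fun i => y (e i)) := fun e => map_add altMatrix _ _
    funext i
    fin_cases i
    · exact h _
    · exact h _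
    · simp only [h]
      simp
      abel

theorem altTriple_zero (x : Fin 12 → ZMod 2) :
    altTriple x 0 = altMatrix fun i => x (Fin.castAdd 6 i) := rfl

theorem altTriple_one (x : Fin 12 → ZMod 2) :
    altTriple x 1 = altMatrix fun i => x (Fin.natAdd 6 i) := rfl

theorem altTriple_two (x : Fin 12 → ZMod 2) :
    altTriple x 2 = altTriple x 0 + altTriple x 1 := rfl

theorem altTriple_injective : Function.Injective altTriple := by
  intro x y h
  have h0 := congrFun h 0
  have h1 := congrFun h 1
  rw [altTriple_zero, altTriple_zero] at h0
  rw [altTriple_one, altTriple_one] at h1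
  replace h0 := altMatrix_injective h0
  replace h1 := altMatrix_injective h1
  funext i
  refine Fin.addCases (m := 6) (n := 6) (fun j => ?_) (fun j => ?_) i
  exacts [congrFun h0 j, congrFun h1 j]

theorem altTriple_sum (x : Fin 12 → ZMod 2) : altTriple x 0 + altTriple x 1 + altTriple x 2 = 0 := by
  rw [altTriple_two]
  ext i j
  exact CharTwo.add_self_eq_zero ((altTriple x 0 + altTriple x 1) i j)

theorem altTriple_dotProduct (x : Fin 12 → ZMod 2) (i : Fin 3) (f : V4) :
    f ⬝ᵥ altTriple x i *ᵥ f = 0 := by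
  have h0 : f ⬝ᵥ altTriple x 0 *ᵥ f = 0 := by rw [altTriple_zero, altMatrix_dotProduct]
  have h1 : f ⬝ᵥ altTriple x 1 *ᵥ f = 0 := by rw [altTriple_one, altMatrix_dotProduct]
  have h2 : f ⬝ᵥ altTriple x 2 *ᵥ f = 0 := by
    rw [altTriple_two, add_mulVec, dotProduct_add, h0, h1, add_zero]
  fin_cases i
  exacts [h0, h1, h2]

theorem exists_altTriple {P : Fin 3 → Matrix (Fin 4) (Fin 4) (ZMod 2)}
    (h : ∀ i (f : V4), f ⬝ᵥ P i *ᵥ f = 0) (hs : P 0 + P 1 + P 2 = 0) : ∃ x, P = altTriple x := by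
  obtain ⟨y, hy⟩ := exists_altMatrix (h 0)
  obtain ⟨z, hz⟩ := exists_altMatrix (h 1)
  have h2 : P 2 = P 0 + P 1 := by
    ext i j
    exact (CharTwo.add_eq_zero.1 (congrFun (congrFun hs i) j)).symm
  let x : Fin 12 → ZMod 2 := Fin.append y z
  have h0 : altTriple x 0 = P 0 := by
    rw [altTriple_zero, hy]; congr 1; funext i; exact Fin.append_left y z i
  have h1 : altTriple x 1 = P 1 := by
    rw [altTriple_one, hz]; congr 1; funext i; exact Fin.append_right y z i
  refine ⟨x, funext fun i => ?_⟩
  fin_cases i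
  exacts [h0.symm, h1.symm, by simpa [altTriple_two, h0, h1] using h2]

/-- The unipotent maps `(a_i, f_i) ↦ (a_i + N_i f_i, f_i)`. -/
def glueUnipotent (x : Fin 12 → ZMod 2) : (Fin 3 → V4 × V4) →ₗ[ZMod 2] (Fin 3 → V4 × V4) where
  toFun m i := ((m i).1 + altTriple x i *ᵥ (m i).2, (m i).2)
  map_add' m n := by
    funext i
    ext1
    · simp only [Pi.add_apply, Prod.fst_add, Prod.snd_add, mulVec_add]; abel
    · rfl
  map_smul' c m := by
    funext i
    ext1
    · simp [mulVec_smul]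
    · rfl

theorem glueUnipotent_comp (x y : Fin 12 → ZMod 2) :
    glueUnipotent x ∘ₗ glueUnipotent y = glueUnipotent (x + y) := by
  refine LinearMap.ext fun m => funext fun i => Prod.ext ?_ rfl
  simp [glueUnipotent, add_mulVec]
  abel

theorem glueUnipotent_zero : glueUnipotent 0 = LinearMap.id := by
  refine LinearMap.ext fun m => funext fun i => Prod.ext ?_ rfl
  simp [glueUnipotent]

theorem glueUnipotent_comp_self (x : Fin 12 → ZMod 2) :
    glueUnipotent x ∘ₗ glueUnipotent x = LinearMap.id := by
  rw [glueUnipotent_comp, ← glueUnipotent_zero]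
  congr 1
  funext i
  exact CharTwo.add_self_eq_zero _

/-- The group of the maps `glueUnipotent`. -/
def glueInl : Multiplicative (Fin 12 → ZMod 2) →*
    ((Fin 3 → V4 × V4) ≃ₗ[ZMod 2] (Fin 3 → V4 × V4)) :=
  MonoidHom.mk' (fun x => LinearEquiv.ofLinearMap (glueUnipotent x.toAdd) (glueUnipotent x.toAdd)
    (glueUnipotent_comp_self _) (glueUnipotent_comp_self _)) fun _ _ =>
      LinearEquiv.toLinearMap_injective (glueUnipotent_comp _ _).symm

theorem glueInl_apply (x : Multiplicative (Fin 12 → ZMod 2)) (m : Fin 3 → V4 × V4) (i : Fin 3) :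
    glueInl x m i = ((m i).1 + altTriple x.toAdd i *ᵥ (m i).2, (m i).2) := rfl

/-- The inverse transpose of a matrix in `SL₄(2)`. -/
def contragredient (A : SpecialLinearGroup (Fin 4) (ZMod 2)) : Matrix (Fin 4) (Fin 4) (ZMod 2) :=
  transpose (A⁻¹).val

theorem contragredient_mul (A B : SpecialLinearGroup (Fin 4) (ZMod 2)) :
    contragredient (A * B) = contragredient A * contragredient B := by
  rw [contragredient, contragredient, contragredient, ← transpose_mul, _root_.mul_inv_rev]
  rfl

theorem contragredient_one : contragredient 1 = 1 := by
  simp [contragredient]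

theorem transpose_mul_contragredient (A : SpecialLinearGroup (Fin 4) (ZMod 2)) :
    transpose A.val * contragredient A = 1 := by
  have h : (A⁻¹).val * A.val = 1 := congrArg Subtype.val (inv_mul_cancel A)
  rw [contragredient, ← transpose_mul, h, transpose_one]

theorem contragredient_mul_transpose (A : SpecialLinearGroup (Fin 4) (ZMod 2)) :
    contragredient A * transpose A.val = 1 :=
  mul_eq_one_comm.1 (transpose_mul_contragredient A)

/-- The action of `SL₄(2) × Sym₃` on `(V ⊕ V)³`, diagonally and by permutations. -/
def glueLevi (A : SpecialLinearGroup (Fin 4) (ZMod 2) × Equiv.Perm (Fin 3)) :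
    (Fin 3 → V4 × V4) →ₗ[ZMod 2] (Fin 3 → V4 × V4) where
  toFun m i := ((A.1 : Matrix _ _ (ZMod 2)) *ᵥ (m (A.2⁻¹ i)).1,
    contragredient A.1 *ᵥ (m (A.2⁻¹ i)).2)
  map_add' m n := by
    funext i
    simp [mulVec_add]
  map_smul' c m := by
    funext i
    simp [mulVec_smul]

theorem glueLevi_apply (A : SpecialLinearGroup (Fin 4) (ZMod 2) × Equiv.Perm (Fin 3))
    (m : Fin 3 → V4 × V4) (i : Fin 3) :
    glueLevi A m i = ((A.1 : Matrix _ _ (ZMod 2)) *ᵥ (m (A.2⁻¹ i)).1,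
      contragredient A.1 *ᵥ
        (m (A.2⁻¹ i)).2) := rfl

theorem glueLevi_comp (A B : SpecialLinearGroup (Fin 4) (ZMod 2) × Equiv.Perm (Fin 3)) :
    glueLevi A ∘ₗ glueLevi B = glueLevi (A * B) := by
  refine LinearMap.ext fun m => funext fun i => Prod.ext ?_ ?_
  · simp only [LinearMap.comp_apply, glueLevi_apply, mulVec_mulVec]
    rfl
  · simp only [LinearMap.comp_apply, glueLevi_apply, mulVec_mulVec]
    rw [← contragredient_mul]
    rfl

theorem glueLevi_one : glueLevi 1 = LinearMap.id := by
  refine LinearMap.ext fun m => funext fun i => Prod.ext ?_ ?_ <;>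
    simp [glueLevi, contragredient_one]

def glueSection : SpecialLinearGroup (Fin 4) (ZMod 2) × Equiv.Perm (Fin 3) →*
    ((Fin 3 → V4 × V4) ≃ₗ[ZMod 2] (Fin 3 → V4 × V4)) :=
  MonoidHom.mk' (fun A => LinearEquiv.ofLinearMap (glueLevi A) (glueLevi A⁻¹)
    (by rw [glueLevi_comp, mul_inv_cancel, glueLevi_one])
    (by rw [glueLevi_comp, inv_mul_cancel, glueLevi_one])) fun x y =>
      LinearEquiv.toLinearMap_injective (glueLevi_comp _ _).symm

theorem glueSection_apply (A : SpecialLinearGroup (Fin 4) (ZMod 2) × Equiv.Perm (Fin 3))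
    (m : Fin 3 → V4 × V4) (i : Fin 3) :
    glueSection A m i = ((A.1 : Matrix _ _ (ZMod 2)) *ᵥ (m (A.2⁻¹ i)).1,
      contragredient A.1 *ᵥ
        (m (A.2⁻¹ i)).2) := rfl

theorem mem_subspaceStabilizer_of_hom {N W : Type*} [Group N] [AddCommGroup W]
    [Module (ZMod 2) W] {S : Submodule (ZMod 2) W} (i : N →* (W ≃ₗ[ZMod 2] W))
    (h : ∀ n, ∀ v ∈ S, i n v ∈ S) (n : N) : i n ∈ subspaceStabilizer S := by
  refine fun v => ⟨fun hv => ?_, h n v⟩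
  have := h n⁻¹ _ hv
  rwa [← LinearEquiv.mul_apply, ← map_mul, inv_mul_cancel, map_one] at this

theorem wt_eq_wt {R R' : Type*} [AddCommGroup R] [Module (ZMod 2) R] [AddCommGroup R']
    [Module (ZMod 2) R'] {q : QuadraticForm (ZMod 2) R} {q' : QuadraticForm (ZMod 2) R'}
    {x : R} {y : R'} (h0 : x = 0 ↔ y = 0) (h : q x = q' y) : wt q x = wt q' y := by
  unfold wt
  rw [h]
  by_cases hx : x = 0
  · rw [if_pos hx, if_pos (h0.1 hx)]
  · rw [if_neg hx, if_neg (mt h0.2 hx)]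

/-- The form `a ⬝ᵥ f` changes by `f ⬝ᵥ Nᵢ f`, which vanishes because `Nᵢ` is alternating. -/
theorem glueInl_mem_autWt (x : Multiplicative (Fin 12 → ZMod 2)) :
    glueInl x ∈ autWt hypForm 3 := by
  refine fun m => Finset.sum_congr rfl fun i _ => wt_eq_wt ?_ ?_
  · rw [glueInl_apply]
    constructor
    · intro h
      have h2 : (m i).2 = 0 := congrArg Prod.snd h
      have h1 := congrArg Prod.fst h
      simp only [h2, mulVec_zero, add_zero] at h1
      exact Prod.ext h1 h2
    · intro h; simp [h]
  · rw [glueInl_apply, hypForm_apply, hypForm_apply, add_dotProduct, dotProduct_comm (_ *ᵥ _),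
      altTriple_dotProduct, add_zero]

/-- On a codeword all `f` coincide, so the sum of first coordinates changes by `(N₀ + N₁ + N₂) f =
0`. This is why the triples are required to have sum zero. -/
theorem glueInl_mem_stabilizer (x : Multiplicative (Fin 12 → ZMod 2)) :
    glueInl x ∈ subspaceStabilizer glueCode := by
  refine mem_subspaceStabilizer_of_hom glueInl (fun x m hm => ?_) x
  obtain ⟨h1, h2, h3⟩ := hm
  refine ⟨h1, h2, ?_⟩
  simp only [glueInl_apply, h1, h2]
  have h4 := congrArg (· *ᵥ (m 2).2) (altTriple_sum x.toAdd)
  simp only [add_mulVec, zero_mulVec] at h4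
  rw [← add_zero (0 : V4)]
  nth_rewrite 1 [← h3]
  rw [← h4]
  abel

theorem mulVec_dotProduct_contragredient (A : SpecialLinearGroup (Fin 4) (ZMod 2)) (v f : V4) :
    (A.val *ᵥ v) ⬝ᵥ (contragredient A *ᵥ f) = v ⬝ᵥ f := by
  rw [← vecMul_transpose, ← dotProduct_mulVec, mulVec_mulVec, transpose_mul_contragredient,
    one_mulVec]

theorem glueSection_mem_autWt (A : SpecialLinearGroup (Fin 4) (ZMod 2) × Equiv.Perm (Fin 3)) :
    glueSection A ∈ autWt hypForm 3 := by
  intro m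
  rw [wtPow, wtPow, ← Equiv.sum_comp A.2⁻¹ fun i => wt hypForm (m i)]
  refine Finset.sum_congr rfl fun i _ => wt_eq_wt ?_ ?_
  · rw [glueSection_apply]
    constructor
    · intro h
      have hA : (A.1⁻¹).val * A.1.val = 1 := congrArg Subtype.val (inv_mul_cancel A.1)
      have h1 := congrArg (fun u : V4 × V4 => (A.1⁻¹).val *ᵥ u.1) h
      have h2 := congrArg (fun u : V4 × V4 => transpose A.1.val *ᵥ u.2) h
      simp only [mulVec_mulVec, hA, transpose_mul_contragredient, one_mulVec, Prod.fst_zero,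
        Prod.snd_zero, mulVec_zero] at h1 h2
      exact Prod.ext h1 h2
    · intro h
      rw [h]
      simp
  · rw [glueSection_apply, hypForm_apply, hypForm_apply, mulVec_dotProduct_contragredient]

theorem mem_glueCode_iff (m : Fin 3 → V4 × V4) :
    m ∈ glueCode ↔ (∀ i j, (m i).2 = (m j).2) ∧ ∑ i, (m i).1 = 0 := by
  rw [Fin.sum_univ_three]
  constructor
  · rintro ⟨h1, h2, h3⟩
    refine ⟨fun i j => ?_, h3⟩
    fin_cases i <;> fin_cases j <;> simp [h1, h2]
  · rintro ⟨h1, h2⟩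
    exact ⟨h1 0 1, h1 1 2, h2⟩

theorem glueSection_mem_stabilizer
    (A : SpecialLinearGroup (Fin 4) (ZMod 2) × Equiv.Perm (Fin 3)) :
    glueSection A ∈ subspaceStabilizer glueCode := by
  refine mem_subspaceStabilizer_of_hom glueSection (fun A m hm => ?_) A
  rw [mem_glueCode_iff] at hm ⊢
  refine ⟨fun i j => ?_, ?_⟩
  · rw [glueSection_apply, glueSection_apply, hm.1 (A.2⁻¹ i) (A.2⁻¹ j)]
  · simp only [glueSection_apply]
    rw [← mulVec_sum, Equiv.sum_comp A.2⁻¹ fun i => (m i).1, hm.2, mulVec_zero]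

end GlueStabilizer

/-! ### Structure of the stabilizer of the glue code. -/

section GlueStabilizerStructure

open QuadraticMap Module Matrix

/-- Conjugation by `(A, σ)` replaces `Nᵢ` by `A N_{σ⁻¹ i} Aᵀ`, again a triple of alternating
matrices with sum zero. -/
theorem glueSection_conj (A : SpecialLinearGroup (Fin 4) (ZMod 2) × Equiv.Perm (Fin 3))
    (x : Multiplicative (Fin 12 → ZMod 2)) :
    ∃ y, glueSection A * glueInl x = glueInl y * glueSection A := by
  obtain ⟨y, hy⟩ := exists_altTriple
    (P := fun i => A.1.val * altTriple x.toAdd (A.2⁻¹ i) * transpose A.1.val) (by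
      intro i f
      rw [← mulVec_mulVec, ← mulVec_mulVec, dotProduct_mulVec, ← mulVec_transpose,
        altTriple_dotProduct]) (by
      rw [← Fin.sum_univ_three fun i => A.1.val * altTriple x.toAdd (A.2⁻¹ i) * transpose A.1.val,
        Equiv.sum_comp A.2⁻¹ fun i => A.1.val * altTriple x.toAdd i * transpose A.1.val,
        ← Finset.sum_mul, ← Finset.mul_sum, Fin.sum_univ_three, altTriple_sum]
      simp)
  refine ⟨Multiplicative.ofAdd y, LinearEquiv.ext fun m => funext fun i => ?_⟩
  rw [LinearEquiv.mul_apply, LinearEquiv.mul_apply, glueSection_apply, glueInl_apply,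
    glueInl_apply, glueSection_apply, toAdd_ofAdd, ← hy]
  ext1
  · simp only [mulVec_add, mulVec_mulVec]
    rw [mul_assoc _ _ (contragredient _), transpose_mul_contragredient, mul_one]
  · rfl

/-- The unipotent maps fix all vectors with vanishing second coordinates; these already detect both
the matrix and the permutation. -/
theorem glueInl_eq_glueSection (x : Multiplicative (Fin 12 → ZMod 2))
    (A : SpecialLinearGroup (Fin 4) (ZMod 2) × Equiv.Perm (Fin 3))
    (h : glueInl x = glueSection A) : A = 1 := by
  have h1 : ∀ (m : Fin 3 → V4 × V4) i,
      (m i).1 + altTriple x.toAdd i *ᵥ (m i).2 = A.1.val *ᵥ (m (A.2⁻¹ i)).1 :=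
    fun m i => congrArg Prod.fst (congrFun (DFunLike.congr_fun h m) i)
  have h2 : ∀ v, A.1.val *ᵥ v = v := fun v => by
    simpa using (h1 (fun _ => (v, 0)) 0).symm
  have h3 : A.1 = 1 := by
    refine Subtype.ext (Matrix.toLin'.injective (LinearMap.ext fun v => ?_))
    rw [toLin'_apply, h2]
    simp
  have h4 : A.2 = 1 := by
    rw [← inv_eq_one]
    ext i
    by_contra hne
    have hne : A.2⁻¹ i ≠ i := fun h => hne (by rw [h]; rfl)
    have := h1 (Pi.single i (Pi.single 0 1, 0)) i
    rw [Pi.single_eq_same, Pi.single_eq_of_ne hne] at this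
    have := congrFun this 0
    simp at this
  exact Prod.ext h3 h4

theorem glueInl_injective : Function.Injective glueInl := by
  intro x y h
  have h1 : ∀ i v, altTriple x.toAdd i *ᵥ v = altTriple y.toAdd i *ᵥ v := fun i v => by
    simpa [glueInl_apply] using congrArg Prod.fst
      (congrFun (DFunLike.congr_fun h fun _ => ((0 : V4), v)) i)
  refine Multiplicative.toAdd.injective (altTriple_injective (funext fun i => ?_))
  refine Matrix.toLin'.injective (LinearMap.ext fun v => ?_)
  rw [toLin'_apply, toLin'_apply, h1]

/-- The empty third slot forces the common second coordinate to be zero. -/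
theorem single_add_single_mem_glueCode {i j : Fin 3} (hij : i ≠ j) (u v : V4 × V4) :
    (Pi.single i u + Pi.single j v : Fin 3 → V4 × V4) ∈ glueCode ↔
      u.2 = 0 ∧ v.2 = 0 ∧ u.1 + v.1 = 0 := by
  have hs : ∑ l, ((Pi.single i u + Pi.single j v : Fin 3 → V4 × V4) l).1 = u.1 + v.1 := by
    rw [← Prod.fst_sum]
    simp [Finset.sum_add_distrib]
  rw [mem_glueCode_iff, hs]
  refine ⟨fun h => ?_, fun h => ⟨fun l l' => ?_, h.2.2⟩⟩
  · obtain ⟨k, hki, hkj⟩ : ∃ k : Fin 3, k ≠ i ∧ k ≠ j := by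
      have : ∀ i j : Fin 3, ∃ k, k ≠ i ∧ k ≠ j := by decide
      exact this i j
    have h1 := h.1 i k
    have h2 := h.1 j k
    simp only [Pi.add_apply, Pi.single_eq_same, Pi.single_eq_of_ne hij, Pi.single_eq_of_ne hij.symm,
      Pi.single_eq_of_ne hki, Pi.single_eq_of_ne hkj, add_zero, zero_add] at h1 h2
    exact ⟨h1, h2, h.2⟩
  · have h0 : ∀ l, ((Pi.single i u + Pi.single j v : Fin 3 → V4 × V4) l).2 = 0 := by
      intro l
      simp only [Pi.add_apply, Prod.snd_add]
      rw [Pi.apply_single (fun _ (w : V4 × V4) => w.2) (fun _ => rfl),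
        Pi.apply_single (fun _ (w : V4 × V4) => w.2) (fun _ => rfl), h.1, h.2.1]
      simp
    rw [h0, h0]

/-- The stabilizer of the glue code is generated by the unipotent maps and the Levi
complement. -/
theorem exists_glueInl_mul_glueSection {n : ℕ} (r : Fin (n + 1) → V4 × V4)
    (hr : ∀ a, hypForm (r a) = 1) (hspan : Submodule.span (ZMod 2) (Set.range r) = ⊤)
    (hconn : ∀ a, a ≠ 0 → ∃ b < a, polar hypForm (r b) (r a) = 1)
    {g : (Fin 3 → V4 × V4) ≃ₗ[ZMod 2] (Fin 3 → V4 × V4)} (hg : g ∈ autWt hypForm 3)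
    (hgS : g ∈ subspaceStabilizer glueCode) :
    ∃ x A, g = glueInl x * glueSection A := by
  obtain ⟨σ, h, hgh, hqh⟩ := exists_perm_of_mem_autWt r hr hspan hconn hg
  -- The code is invariant under permutations of the slots, so the slotwise part of `g` preserves it
  -- as well.
  have hmem : ∀ u : Fin 3 → V4 × V4, u ∈ glueCode → (fun i => h i (u i)) ∈ glueCode := by
    intro u hu
    have h1 : (fun i => u (σ i)) ∈ glueCode := by
      rw [mem_glueCode_iff] at hu ⊢
      exact ⟨fun i j => hu.1 _ _, by rw [Equiv.sum_comp σ fun i => (u i).1, hu.2]⟩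
    have h2 := (hgS _).2 h1
    have h3 : g (fun i => u (σ i)) = fun i => h i (u i) := by
      funext i; rw [hgh]; simp
    rwa [h3] at h2
  -- Each `h i` is now brought to block triangular form. Codewords `(a, 0)` in two slots yield a
  -- zero lower left block and an upper left block `A` independent of the slot; preservation of the
  -- pairing makes the lower right block contragredient to `A`.
  have hpol : ∀ i u v, polar hypForm (h i u) (h i v) = polar hypForm u v := by
    intro i u v
    rw [polar, ← map_add, hqh, hqh, hqh]; rfl
  have hA1 : ∀ i j, i ≠ j → ∀ a : V4, (h i (a, 0)).2 = 0 ∧ (h i (a, 0)).1 = (h j (a, 0)).1 := by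
    intro i j hij a
    have hm := hmem (Pi.single i (a, 0) + Pi.single j (a, 0)) (by
      rw [single_add_single_mem_glueCode hij]
      exact ⟨rfl, rfl, CharTwo.add_self_eq_zero _⟩)
    have e : (fun l => h l ((Pi.single i (a, 0) + Pi.single j (a, 0) : Fin 3 → V4 × V4) l)) =
        Pi.single i (h i (a, 0)) + Pi.single j (h j (a, 0)) := by
      funext l
      rw [Pi.add_apply, map_add, Pi.apply_single (fun l => h l) (fun l => map_zero _),
        Pi.apply_single (fun l => h l) (fun l => map_zero _)]
      rfl
    rw [e, single_add_single_mem_glueCode hij] at hm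
    exact ⟨hm.1, CharTwo.add_eq_zero.1 hm.2.2⟩
  let A : Matrix (Fin 4) (Fin 4) (ZMod 2) :=
    LinearMap.toMatrix' (LinearMap.fst _ _ _ ∘ₗ h 0 ∘ₗ LinearMap.inl (ZMod 2) V4 V4)
  let B : Fin 3 → Matrix (Fin 4) (Fin 4) (ZMod 2) := fun i =>
    LinearMap.toMatrix' (LinearMap.fst _ _ _ ∘ₗ h i ∘ₗ LinearMap.inr (ZMod 2) V4 V4)
  let C : Fin 3 → Matrix (Fin 4) (Fin 4) (ZMod 2) := fun i =>
    LinearMap.toMatrix' (LinearMap.snd _ _ _ ∘ₗ h i ∘ₗ LinearMap.inr (ZMod 2) V4 V4)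
  have hA : ∀ i a, h i (a, 0) = (A *ᵥ a, 0) := by
    intro i a
    have e : A *ᵥ a = (h 0 (a, 0)).1 := LinearMap.toMatrix'_mulVec _ _
    refine Prod.ext ?_ ?_
    · by_cases hi : i = 0
      · subst hi; exact e.symm
      · rw [(hA1 i 0 hi a).2, e]
    · exact (hA1 i (i + 1) (by fin_cases i <;> simp) a).1
  have hBC : ∀ i f, h i (0, f) = (B i *ᵥ f, C i *ᵥ f) := fun i f =>
    Prod.ext
      (LinearMap.toMatrix'_mulVec (LinearMap.fst _ _ _ ∘ₗ h i ∘ₗ LinearMap.inr (ZMod 2) V4 V4) _).symm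
      (LinearMap.toMatrix'_mulVec (LinearMap.snd _ _ _ ∘ₗ h i ∘ₗ LinearMap.inr (ZMod 2) V4 V4) _).symm
  have hAC : ∀ i, transpose A * C i = 1 := by
    intro i
    refine Matrix.toLin'.injective (LinearMap.ext fun f => ?_)
    rw [toLin'_apply, toLin'_one, LinearMap.id_apply, ← mulVec_mulVec]
    refine eq_of_dotProduct_eq fun v => ?_
    have h1 := hpol i (v, 0) (0, f)
    rw [hA, hBC, polar_hypForm, polar_hypForm] at h1
    simp only [dotProduct_zero, add_zero] at h1
    rw [dotProduct_mulVec, vecMul_transpose, h1]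
    exact CharTwo.add_self_eq_zero _
  have hdet : A.det = 1 := by
    have h1 := congrArg Matrix.det (hAC 0)
    rw [det_mul, det_transpose, det_one] at h1
    refine (zmod_two_eq _).resolve_left fun h0 => ?_
    rw [h0, zero_mul] at h1
    exact zero_ne_one h1
  let A' : SpecialLinearGroup (Fin 4) (ZMod 2) := ⟨A, hdet⟩
  have hC : ∀ i, C i = contragredient A' := by
    intro i
    rw [← one_mul (C i), ← contragredient_mul_transpose A', mul_assoc]
    change _ * (transpose A * C i) = _
    rw [hAC, mul_one]
  -- In `g = glueInl x * glueSection (A', σ)` the upper right block is `B i = Nᵢ A⁻ᵀ`, hence `Nᵢ = B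
  -- i Aᵀ`. Singularity of `(0, Aᵀ f)` makes it alternating, and the codewords with all entries `(0,
  -- f)` give sum zero.
  obtain ⟨x, hx⟩ := exists_altTriple (P := fun i => B i * transpose A) (by
      intro i f
      have h1 := hqh i (0, transpose A *ᵥ f)
      rw [hBC, hypForm_apply, hypForm_apply, hC] at h1
      simp only [zero_dotProduct, mulVec_mulVec] at h1
      have e : contragredient A' * transpose A = 1 := contragredient_mul_transpose A'
      rwa [e, one_mulVec, dotProduct_comm] at h1) (by
      have hs : B 0 + B 1 + B 2 = 0 := by
        refine Matrix.toLin'.injective (LinearMap.ext fun f => ?_)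
        have hm := hmem (fun _ => (0, f)) (by rw [mem_glueCode_iff]; simp)
        have := hm.2.2
        simp only [hBC] at this
        rw [toLin'_apply, add_mulVec, add_mulVec, this]
        simp
      rw [← add_mul, ← add_mul, hs, zero_mul])
  refine ⟨Multiplicative.ofAdd x, (A', σ), LinearEquiv.ext fun m => funext fun i => ?_⟩
  rw [LinearEquiv.mul_apply, glueInl_apply, glueSection_apply, toAdd_ofAdd, ← hx, hgh]
  have e : m (σ⁻¹ i) = ((m (σ⁻¹ i)).1, 0) + (0, (m (σ⁻¹ i)).2) := by simp
  have e2 : transpose A * contragredient A' = 1 := transpose_mul_contragredient A'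
  conv_lhs => rw [e, map_add, hA, hBC]
  ext1
  · change _ + _ = A *ᵥ _ + _
    rw [mulVec_mulVec, mul_assoc, e2, mul_one]
  · change _ + _ = _
    rw [hC, zero_add]

variable {R : Type*} [AddCommGroup R] [Module (ZMod 2) R]

/-- The stabilizer in `Aut(R³, w³)` of a glue code with respect to hyperbolic frames has the shape
`2¹² : (SL₄(2) × Sym₃)`. -/
theorem exists_split_extension_stabilizer {q : QuadraticForm (ZMod 2) R}
    {n : ℕ} (r : Fin (n + 1) → R)
    (hr : ∀ a, q (r a) = 1) (hspan : Submodule.span (ZMod 2) (Set.range r) = ⊤)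
    (hconn : ∀ a, a ≠ 0 → ∃ b < a, polar q (r b) (r a) = 1)
    {S : Submodule (ZMod 2) (Fin 3 → R)} (ι : Fin 3 → ((V4 × V4) ≃ₗ[ZMod 2] R))
    (hι : ∀ i m, q (ι i m) = m.1 ⬝ᵥ m.2)
    (hS : ∀ m : Fin 3 → V4 × V4, (fun i => ι i (m i)) ∈ S ↔ m ∈ glueCode) :
    ∃ X : GroupExtension (Multiplicative (Fin 12 → ZMod 2))
        ((subspaceStabilizer S).subgroupOf (autWt q 3))
        (SpecialLinearGroup (Fin 4) (ZMod 2) × Equiv.Perm (Fin 3)),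
      Nonempty X.Splitting := by
  let J : (Fin 3 → V4 × V4) ≃ₗ[ZMod 2] (Fin 3 → R) := LinearEquiv.piCongrRight ι
  let c : ((Fin 3 → V4 × V4) ≃ₗ[ZMod 2] (Fin 3 → V4 × V4)) ≃*
      ((Fin 3 → R) ≃ₗ[ZMod 2] (Fin 3 → R)) :=
    { toFun := fun g => (J.symm.trans g).trans J
      invFun := fun g => (J.trans g).trans J.symm
      left_inv := fun g => by ext1; simp
      right_inv := fun g => by ext1; simp
      map_mul' := fun g h => by ext1; simp [LinearEquiv.mul_apply] }
  have hJw : ∀ m, wtPow q 3 (J m) = wtPow hypForm 3 m := fun m =>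
    Finset.sum_congr rfl fun i _ => wt_eq_wt (LinearEquiv.map_eq_zero_iff (ι i)) (hι i (m i))
  have hJS : ∀ m, J m ∈ S ↔ m ∈ glueCode := hS
  have hc : ∀ g m, c g (J m) = J (g m) := fun g m => by
    change J (g (J.symm (J m))) = _
    rw [J.symm_apply_apply]
  have hK : ∀ g, c g ∈ autWt q 3 ↔ g ∈ autWt hypForm 3 := by
    intro g
    constructor
    · intro h m
      rw [← hJw, ← hc, h, hJw]
    · intro h v
      obtain ⟨m, rfl⟩ := J.surjective v
      rw [hc, hJw, h, hJw]
  have hH : ∀ g, c g ∈ subspaceStabilizer S ↔ g ∈ subspaceStabilizer glueCode := by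
    intro g
    constructor
    · intro h m
      rw [← hJS, ← hc, h, hJS]
    · intro h v
      obtain ⟨m, rfl⟩ := J.surjective v
      rw [hc, hJS, h, hJS]
  -- The frames identify weight and code on both sides, so conjugation by `J` transports the
  -- factorization found for `glueCode`.
  refine exists_split_extension (autWt q 3) (subspaceStabilizer S)
    (c.toMonoidHom.comp glueInl) (c.toMonoidHom.comp glueSection)
    (c.injective.comp glueInl_injective)
    (fun x => (hK _).2 (glueInl_mem_autWt x)) (fun x => (hH _).2 (glueInl_mem_stabilizer x))
    (fun A => (hK _).2 (glueSection_mem_autWt A)) (fun A => (hH _).2 (glueSection_mem_stabilizer A))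
    (fun A x => ?_) (fun g hg hgS => ?_) (fun x A h => ?_)
  · obtain ⟨y, hy⟩ := glueSection_conj A x
    refine ⟨y, ?_⟩
    change c _ * c _ = c _ * c _
    rw [← map_mul, hy, map_mul]
  · obtain ⟨g, rfl⟩ := c.surjective g
    have hq : ∀ u, hypForm ((ι 0).symm u) = q u := fun u => by
      rw [hypForm_apply, ← hι 0, LinearEquiv.apply_symm_apply]
    obtain ⟨x, A, h⟩ := exists_glueInl_mul_glueSection (fun a => (ι 0).symm (r a))
      (fun a => by rw [hq, hr]) (by
        have := congrArg (Submodule.map (ι 0).symm.toLinearMap) hspan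
        rw [Submodule.map_span, ← Set.range_comp, Submodule.map_top, LinearEquiv.range] at this
        exact this)
      (fun a ha => by
        obtain ⟨b, hb, h⟩ := hconn a ha
        refine ⟨b, hb, ?_⟩
        rw [polar, ← map_add, hq, hq, hq]
        exact h) ((hK g).1 hg) ((hH g).1 hgS)
    refine ⟨x, A, ?_⟩
    rw [h, map_mul]
    rfl
  · exact glueInl_eq_glueSection x A (c.injective h)

end GlueStabilizerStructure

/-! ### Short representatives of the classes of `E₈/2E₈`. -/

section ShortVectors

abbrev E8Space : Type := EuclideanSpace ℝ (Fin 8)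

theorem half_sub_mem_latticeE8 {n : Fin 8 → ℤ} (hn : Even (∑ i, n i)) :
    (WithLp.toLp 2 fun i => 1 / 2 - (n i : ℝ) : E8Space) ∈ latticeE8 := by
  obtain ⟨s, hs⟩ := hn
  refine ⟨Or.inr fun i => ⟨-n i, by simp; ring⟩, 2 - s, ?_⟩
  have : (∑ i, (n i : ℝ)) = s + s := by exact_mod_cast hs
  simp only [Finset.sum_sub_distrib, this]
  simp
  ring

theorem single_add_single_mem_latticeE8 (i j : Fin 8) (s t : ℤ) (h : Even (s + t)) :
    (EuclideanSpace.single i (s : ℝ) + EuclideanSpace.single j (t : ℝ) : E8Space) ∈ latticeE8 := by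
  obtain ⟨m, hm⟩ := h
  refine ⟨Or.inl fun k => ⟨(if k = i then s else 0) + (if k = j then t else 0), by simp⟩, m, ?_⟩
  have : (s : ℝ) + t = m + m := by exact_mod_cast hm
  simp [Finset.sum_add_distrib, this]
  ring

theorem inner_self_eq_sum_sq (u : E8Space) : inner ℝ u u = ∑ i, u i ^ 2 := by
  rw [PiLp.inner_apply]
  simp [sq]

/-- The hypothesis says that `u` is shortest in `u + 2E₈`, since `|u - 2f|² - |u|² = 4((f, f) - (u,
f))`. Testing it on the roots `±eᵢ ± eⱼ` and `(±1/2, …, ±1/2)` suffices. -/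
theorem inner_self_le_four_of_forall_inner_le {u : E8Space} (hu : u ∈ latticeE8)
    (h : ∀ f ∈ latticeE8, inner ℝ u f ≤ inner ℝ f f) : inner ℝ u u ≤ 4 := by
  have hst : ∀ i j, i ≠ j → ∀ s t : ℤ, s * s = 1 → t * t = 1 → Even (s + t) →
      s * u i + t * u j ≤ 2 := by
    intro i j hij s t hs ht hst
    have hs' : (s : ℝ) * s = 1 := by exact_mod_cast hs
    have ht' : (t : ℝ) * t = 1 := by exact_mod_cast ht
    have h1 := h _ (single_add_single_mem_latticeE8 i j s t hst)
    simp only [inner_add_right, inner_add_left, EuclideanSpace.inner_single_right] at h1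
    simp [hij, hij.symm, hs', ht'] at h1
    linarith
  have habs : ∀ i j, i ≠ j → |u i| + |u j| ≤ 2 := by
    intro i j hij
    have h1 := hst i j hij 1 1 rfl rfl (by decide)
    have h2 := hst i j hij 1 (-1) rfl rfl (by decide)
    have h3 := hst i j hij (-1) 1 rfl rfl (by decide)
    have h4 := hst i j hij (-1) (-1) rfl rfl (by decide)
    push_cast at h1 h2 h3 h4
    rcases abs_cases (u i) with ⟨e1, -⟩ | ⟨e1, -⟩ <;>
      rcases abs_cases (u j) with ⟨e2, -⟩ | ⟨e2, -⟩ <;> rw [e1, e2] <;> linarith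
  rw [inner_self_eq_sum_sq]
  have hsplit : ∀ (j : Fin 8) (c : ℝ), (∀ i, i ≠ j → |u i| ≤ c) →
      ∑ i, u i ^ 2 ≤ 7 * c ^ 2 + |u j| ^ 2 := by
    intro j c hc
    rw [← Finset.sum_erase_add _ _ (Finset.mem_univ j), sq_abs]
    gcongr
    have : ∑ i ∈ Finset.univ.erase j, u i ^ 2 ≤ ∑ i ∈ Finset.univ.erase j, c ^ 2 := by
      refine Finset.sum_le_sum fun i hi => ?_
      rw [← sq_abs]
      exact pow_le_pow_left₀ (abs_nonneg _) (hc i (Finset.ne_of_mem_erase hi)) 2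
    refine this.trans ?_
    simp
  rcases hu.1 with hz | hz
  · choose n hn using hz
    by_cases hbig : ∃ j, 1 < |u j|
    · obtain ⟨j, hj⟩ := hbig
      have h0 : ∀ i, i ≠ j → |u i| ≤ 0 := by
        intro i hij
        have h1 := habs i j hij
        have h2 : |u i| < 1 := by linarith
        rw [hn i] at h2 ⊢
        have h2' : |(n i : ℝ)| < 1 := h2
        have h3 : |n i| < 1 := by exact_mod_cast h2'
        rw [Int.abs_lt_one_iff] at h3
        simp [h3]
      have h1 := hsplit j 0 h0
      obtain ⟨i, hij⟩ := exists_ne j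
      have h2 := habs i j hij
      have h3 : |u j| ≤ 2 := by linarith [abs_nonneg (u i)]
      nlinarith [abs_nonneg (u j)]
    push Not at hbig
    have hsq : ∀ i, u i ^ 2 = |u i| := by
      intro i
      have h1 := hbig i
      rw [hn i] at h1 ⊢
      have h1' : |(n i : ℝ)| ≤ 1 := h1
      have h2 : |n i| ≤ 1 := by exact_mod_cast h1'
      have h3 := abs_le.1 h2
      have h4 : n i = -1 ∨ n i = 0 ∨ n i = 1 := by omega
      rcases h4 with h4 | h4 | h4 <;> simp [h4]
    simp only [hsq]
    -- All coordinates are now `0` or `±1`, so the norm is `∑ |u i|`. The vector `1/2 - m` has the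
    -- signs of `u` and lies in `E₈` when the number of negative coordinates is even; it then gives
    -- `∑ |u i| / 2 ≤ 2`.
    let m : Fin 8 → ℤ := fun i => if u i < 0 then 1 else 0
    have hm : ∀ i, u i * (1 / 2 - m i) = |u i| / 2 := by
      intro i
      simp only [m]
      split_ifs with hi
      · rw [abs_of_neg hi]; push_cast; ring
      · rw [abs_of_nonneg (not_lt.1 hi)]; push_cast; ring
    have hm2 : ∀ i, ((1 / 2 : ℝ) - m i) ^ 2 = 1 / 4 := by
      intro i
      simp only [m]
      split_ifs <;> norm_num
    rcases Int.even_or_odd (∑ i, m i) with hev | hodd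
    · have h1 := h _ (half_sub_mem_latticeE8 hev)
      rw [inner_self_eq_sum_sq, PiLp.inner_apply] at h1
      simp only [hm2] at h1
      have h2 : ∑ i, |u i| / 2 ≤ 2 := by
        calc _ = ∑ i, u i * (1 / 2 - m i) := by simp only [hm]
          _ ≤ _ := by
            refine le_trans (le_of_eq ?_) (h1.trans ?_)
            · simp [mul_comm]
            · norm_num
      rw [← Finset.sum_div] at h2
      linarith
    -- For odd parity the sign at one coordinate `j` is flipped, at the cost of `|u j|`. This costs
    -- nothing at a zero coordinate; without zeros it would give `8 ≤ 4 + 2`.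
    · have hfl : ∀ j, ∑ i, |u i| ≤ 4 + 2 * |u j| := by
        intro j
        have hev : Even (∑ i, Function.update m j (1 - m j) i) := by
          rw [Finset.sum_update_of_mem (Finset.mem_univ j)]
          rw [← Finset.add_sum_erase _ _ (Finset.mem_univ j), Finset.erase_eq] at hodd
          rw [Int.odd_iff] at hodd
          rw [Int.even_iff]
          omega
        have h1 := h _ (half_sub_mem_latticeE8 hev)
        rw [inner_self_eq_sum_sq, PiLp.inner_apply] at h1
        have e1 : ∀ i, ((1 / 2 : ℝ) - (Function.update m j (1 - m j) i : ℤ)) ^ 2 = 1 / 4 := by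
          intro i
          by_cases hi : i = j
          · subst hi; rw [Function.update_self, ← hm2 i]; push_cast; ring
          · rw [Function.update_of_ne hi, hm2]
        simp only [e1] at h1
        have e2 : ∀ i, u i * ((1 / 2 : ℝ) - (Function.update m j (1 - m j) i : ℤ)) =
            |u i| / 2 - if i = j then |u j| else 0 := by
          intro i
          by_cases hi : i = j
          · subst hi
            rw [Function.update_self, if_pos rfl]
            have := hm i
            push_cast
            linarith
          · rw [Function.update_of_ne hi, hm, if_neg hi, sub_zero]
        have h2 : ∑ i, (|u i| / 2 - if i = j then |u j| else 0) ≤ 2 := by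
          simp only [← e2]
          refine le_trans (le_of_eq ?_) (h1.trans ?_)
          · simp [mul_comm]
          · norm_num
        rw [Finset.sum_sub_distrib, ← Finset.sum_div] at h2
        simp at h2
        linarith
      by_cases hzero : ∃ j, u j = 0
      · obtain ⟨j, hj⟩ := hzero
        simpa [hj] using hfl j
      push Not at hzero
      exfalso
      have hone : ∀ i, |u i| = 1 := by
        intro i
        refine le_antisymm (hbig i) ?_
        have h1 := hzero i
        rw [hn i] at h1 ⊢
        have h1' : (n i : ℝ) ≠ 0 := h1
        have h2 : (1 : ℝ) ≤ |(n i : ℝ)| := by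
          exact_mod_cast Int.one_le_abs (by exact_mod_cast h1')
        exact h2
      have := hfl 0
      simp only [hone] at this
      norm_num at this
  · choose n hn using hz
    have hlow : ∀ i, 1 / 2 ≤ |u i| := by
      intro i
      rw [hn i, le_abs']
      rcases le_or_gt 0 (n i) with h1 | h1
      · right
        have : (0 : ℝ) ≤ n i := by exact_mod_cast h1
        linarith
      · left
        have : (n i : ℝ) ≤ -1 := by exact_mod_cast (by omega : n i ≤ -1)
        linarith
    have hval : ∀ i, 1 / 2 < |u i| → 3 / 2 ≤ |u i| := by
      intro i
      rw [hn i, lt_abs, le_abs']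
      rintro (h1 | h1)
      · right
        have h2 : (0 : ℝ) < n i := by linarith
        have : (1 : ℝ) ≤ n i := by exact_mod_cast (by exact_mod_cast h2 : 0 < n i)
        linarith
      · left
        have h2 : (n i : ℝ) < ((-1 : ℤ) : ℝ) := by push_cast; linarith
        have h3 : n i < -1 := by exact_mod_cast h2
        have : (n i : ℝ) ≤ -2 := by exact_mod_cast (by omega : n i ≤ -2)
        linarith
    -- A coordinate `±3/2` forces the others to be `±1/2`, with norm `9/4 + 7/4 = 4`; otherwise the
    -- norm is `8/4 = 2`.
    by_cases hbig : ∃ j, 1 / 2 < |u j|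
    · obtain ⟨j, hj⟩ := hbig
      have hj' := hval j hj
      have h1 := hsplit j (1 / 2) fun i hij => by linarith [habs i j hij]
      obtain ⟨i, hij⟩ := exists_ne j
      have h2 := habs i j hij
      have h3 : |u j| ≤ 3 / 2 := by linarith [hlow i]
      nlinarith [abs_nonneg (u j)]
    · push Not at hbig
      have h1 := hsplit 0 (1 / 2) fun i _ => hbig i
      have h2 := hbig 0
      nlinarith [abs_nonneg (u 0)]

/-- Every class of `E₈ / 2E₈` contains a vector of norm at most `4`. -/
theorem exists_short_mem_latticeE8 {v : E8Space} (hv : v ∈ latticeE8) :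
    ∃ e ∈ latticeE8, inner ℝ (v - (2 : ℝ) • e) (v - (2 : ℝ) • e) ≤ 4 := by
  classical
  have hmem : ∀ w e : E8Space, w ∈ latticeE8 → e ∈ latticeE8 → w - (2 : ℝ) • e ∈ latticeE8 := by
    intro w e hw he
    rw [two_smul]
    exact sub_mem hw (add_mem he he)
  -- Norms in `E₈` are even and nonnegative, so half the norm is a natural number and a minimum over
  -- the class exists.
  have hex : ∃ n : ℕ, ∃ e ∈ latticeE8,
      inner ℝ (v - (2 : ℝ) • e) (v - (2 : ℝ) • e) = (n : ℝ) * 2 := by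
    obtain ⟨n, hn⟩ := latticeE8_even hv
    have h0 : (0 : ℝ) ≤ inner ℝ v v := real_inner_self_nonneg
    rw [hn] at h0
    have h1 : 0 ≤ n := by
      have : (0 : ℝ) ≤ n := by linarith
      exact_mod_cast this
    lift n to ℕ using h1
    refine ⟨n, 0, zero_mem _, ?_⟩
    rw [smul_zero, sub_zero, hn]
    push_cast
    ring
  obtain ⟨e, he, hen⟩ := Nat.find_spec hex
  refine ⟨e, he, inner_self_le_four_of_forall_inner_le (hmem _ _ hv he) fun f hf => ?_⟩
  have hf2 : v - (2 : ℝ) • (e + f) = v - (2 : ℝ) • e - (2 : ℝ) • f := by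
    rw [smul_add]; abel
  obtain ⟨m, hm⟩ := latticeE8_even (hmem _ _ hv (add_mem he hf))
  have h0 : (0 : ℝ) ≤ inner ℝ (v - (2 : ℝ) • (e + f)) (v - (2 : ℝ) • (e + f)) :=
    real_inner_self_nonneg
  rw [hm] at h0
  have h1 : 0 ≤ m := by
    have : (0 : ℝ) ≤ m := by linarith
    exact_mod_cast this
  lift m to ℕ using h1
  have h2 : Nat.find hex ≤ m := Nat.find_min' hex ⟨e + f, add_mem he hf, by rw [hm]; push_cast; ring⟩
  have h3 : ((Nat.find hex : ℕ) : ℝ) ≤ m := by exact_mod_cast h2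
  rw [hf2] at hm
  generalize v - (2 : ℝ) • e = u at hm hen ⊢
  rw [inner_sub_left, inner_sub_right, inner_sub_right, hen, inner_smul_left, inner_smul_right,
    inner_smul_left, inner_smul_right, real_inner_comm u f] at hm
  simp only [RCLike.conj_to_real] at hm
  push_cast at hm
  linarith

end ShortVectors

/-! ### Simple roots and fundamental weights of `E₈`. -/

section SimpleRoots

/-- Twice the coordinates of the simple roots of `E₈`. -/
def rootCoord : Matrix (Fin 8) (Fin 8) ℤ :=
  !![1, -1, -1, -1, -1, -1, -1, 1;
    -2, 2, 0, 0, 0, 0, 0, 0;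
    0, -2, 2, 0, 0, 0, 0, 0;
    2, 2, 0, 0, 0, 0, 0, 0;
    0, 0, -2, 2, 0, 0, 0, 0;
    0, 0, 0, -2, 2, 0, 0, 0;
    0, 0, 0, 0, -2, 2, 0, 0;
    0, 0, 0, 0, 0, -2, 2, 0]

/-- The Cartan matrix of `E₈`. -/
def cartanE8 : Matrix (Fin 8) (Fin 8) ℤ :=
  !![2, -1, 0, 0, 0, 0, 0, 0;
    -1, 2, -1, 0, 0, 0, 0, 0;
    0, -1, 2, -1, -1, 0, 0, 0;
    0, 0, -1, 2, 0, 0, 0, 0;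
    0, 0, -1, 0, 2, -1, 0, 0;
    0, 0, 0, 0, -1, 2, -1, 0;
    0, 0, 0, 0, 0, -1, 2, -1;
    0, 0, 0, 0, 0, 0, -1, 2]

/-- The inverse of the Cartan matrix of `E₈`. -/
def cartanE8Inv : Matrix (Fin 8) (Fin 8) ℤ :=
  !![4, 7, 10, 5, 8, 6, 4, 2;
    7, 14, 20, 10, 16, 12, 8, 4;
    10, 20, 30, 15, 24, 18, 12, 6;
    5, 10, 15, 8, 12, 9, 6, 3;
    8, 16, 24, 12, 20, 15, 10, 5;
    6, 12, 18, 9, 15, 12, 8, 4;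
    4, 8, 12, 6, 10, 8, 6, 3;
    2, 4, 6, 3, 5, 4, 3, 2]

/-- The neighbour of a node of the Dynkin diagram that is closer to the node `0`. -/
def dynkinParent : Fin 8 → Fin 8 := ![0, 0, 1, 2, 2, 4, 5, 6]

theorem dynkinParent_lt {k : Fin 8} (hk : k ≠ 0) : dynkinParent k < k := by
  revert k; decide

theorem cartanE8_dynkinParent {k : Fin 8} (hk : k ≠ 0) : cartanE8 (dynkinParent k) k = -1 := by
  revert k; decide

/-- The Dynkin diagram is a tree: its edges are exactly those joining a nonzero node to its parent.
-/
theorem cartanE8_cases (k l : Fin 8) : (k = l ∧ cartanE8 k l = 2) ∨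
    (k ≠ 0 ∧ l = dynkinParent k ∧ cartanE8 k l = -1) ∨
    (l ≠ 0 ∧ k = dynkinParent l ∧ cartanE8 k l = -1) ∨ (k ≠ l ∧ cartanE8 k l = 0) := by
  fin_cases k <;> fin_cases l <;> decide

theorem rootCoord_gram (k l : Fin 8) :
    ∑ j, rootCoord k j * rootCoord l j = 4 * cartanE8 k l := by
  revert k l; decide

theorem cartanE8Inv_mul (k l : Fin 8) :
    ∑ j, cartanE8Inv k j * cartanE8 j l = if k = l then 1 else 0 := by
  revert k l; decide

/-- The simple roots of `E₈`. -/
def simpleRoot (k : Fin 8) : E8Space := WithLp.toLp 2 fun j => (rootCoord k j : ℝ) / 2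

theorem simpleRoot_mem (k : Fin 8) : simpleRoot k ∈ latticeE8 := by
  constructor
  · have h : (∀ j, ∃ n : ℤ, rootCoord k j = 2 * n) ∨ (∀ j, ∃ n : ℤ, rootCoord k j = 2 * n + 1) := by
      have : (∀ j, rootCoord k j = 2 * (rootCoord k j / 2)) ∨
        (∀ j, rootCoord k j = 2 * (rootCoord k j / 2) + 1) := by fin_cases k <;> decide
      exact this.imp (fun h j => ⟨_, h j⟩) (fun h j => ⟨_, h j⟩)
    refine h.imp (fun h j => ?_) (fun h j => ?_) <;> obtain ⟨n, hn⟩ := h j <;> refine ⟨n, ?_⟩ <;>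
      simp only [simpleRoot, hn] <;> push_cast <;> ring
  · have h : ∃ s : ℤ, ∑ j, rootCoord k j = 4 * s :=
      ⟨(∑ j, rootCoord k j) / 4, by revert k; decide⟩
    obtain ⟨s, hs⟩ := h
    refine ⟨s, ?_⟩
    have : (∑ j, (rootCoord k j : ℝ)) = 4 * s := by exact_mod_cast hs
    simp only [simpleRoot]
    rw [← Finset.sum_div, this]
    ring

theorem inner_simpleRoot (k l : Fin 8) :
    inner ℝ (simpleRoot k) (simpleRoot l) = (cartanE8 k l : ℝ) := by
  have h : (∑ j, (rootCoord k j : ℝ) * rootCoord l j) = 4 * cartanE8 k l := by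
    exact_mod_cast rootCoord_gram k l
  rw [PiLp.inner_apply]
  have : ∀ j, inner ℝ (simpleRoot k j) (simpleRoot l j) =
      (rootCoord k j : ℝ) * rootCoord l j / 4 := by
    intro j
    simp [simpleRoot]
    ring
  simp only [this]
  rw [← Finset.sum_div, h]
  ring

/-- The basis of `E₈` dual to the simple roots. -/
def fundWeight (k : Fin 8) : E8Space := ∑ l, cartanE8Inv k l • simpleRoot l

theorem fundWeight_mem (k : Fin 8) : fundWeight k ∈ latticeE8 :=
  sum_mem fun l _ => Submodule.smul_mem _ _ (simpleRoot_mem l)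

theorem inner_fundWeight (k l : Fin 8) :
    inner ℝ (fundWeight k) (simpleRoot l) = if k = l then (1 : ℝ) else 0 := by
  have h : (∑ j, (cartanE8Inv k j : ℝ) * cartanE8 j l) = if k = l then (1 : ℝ) else 0 := by
    exact_mod_cast cartanE8Inv_mul k l
  rw [fundWeight, sum_inner, ← h]
  refine Finset.sum_congr rfl fun j _ => ?_
  rw [← Int.cast_smul_eq_zsmul ℝ, real_inner_smul_left, inner_simpleRoot]

end SimpleRoots

/-! ### Bases and isometries of `E₈³`. -/

section TripleE8

/-- The ambient space of the orthogonal sum of three copies of `E₈`. -/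
abbrev TripleSpace : Type := PiLp 2 fun _ : Fin 3 => E8Space

/-- The orthogonal sum of three copies of `E₈`. -/
abbrev tripleE8 : Submodule ℤ TripleSpace := powLattice latticeE8 3

theorem single_mem_tripleE8 (i : Fin 3) {x : E8Space} (hx : x ∈ latticeE8) :
    PiLp.single 2 i x ∈ tripleE8 := by
  intro j
  by_cases h : j = i
  · subst h; simpa
  · rw [PiLp.single_eq_of_ne _ h]; exact zero_mem _

theorem inner_single_left' (i : Fin 3) (x : E8Space) (y : TripleSpace) :
    inner ℝ (PiLp.single 2 i x : TripleSpace) y = inner ℝ x (y i) := by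
  rw [PiLp.inner_apply, Finset.sum_eq_single i]
  · simp
  · intro j _ hj
    rw [PiLp.single_eq_of_ne _ hj, inner_zero_left]
  · simp

theorem tripleE8_even {x : TripleSpace} (hx : x ∈ tripleE8) :
    ∃ n : ℤ, inner ℝ x x = 2 * (n : ℝ) := by
  choose n hn using fun i => latticeE8_even (hx i)
  refine ⟨∑ i, n i, ?_⟩
  rw [PiLp.inner_apply]
  simp only [hn]
  push_cast
  rw [Finset.mul_sum]

theorem tripleE8_integral {x y : TripleSpace} (hx : x ∈ tripleE8) (hy : y ∈ tripleE8) :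
    ∃ n : ℤ, inner ℝ x y = (n : ℝ) := by
  choose n hn using fun i => latticeE8_integral (hx i) (hy i)
  refine ⟨∑ i, n i, ?_⟩
  rw [PiLp.inner_apply]
  simp only [hn]
  push_cast
  rfl

theorem mem_tripleE8_of_dual {x : TripleSpace}
    (h : ∀ y ∈ tripleE8, ∃ n : ℤ, inner ℝ x y = (n : ℝ)) : x ∈ tripleE8 := by
  refine fun i => mem_latticeE8_of_dual fun y hy => ?_
  obtain ⟨n, hn⟩ := h _ (single_mem_tripleE8 i hy)
  refine ⟨n, ?_⟩
  rw [← hn, real_inner_comm, ← inner_single_left', real_inner_comm]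

/-- The simple roots of the three copies of `E₈`. -/
def slotRoot (p : Fin 3 × Fin 8) : TripleSpace := PiLp.single 2 p.1 (simpleRoot p.2)

def slotWeight (p : Fin 3 × Fin 8) : TripleSpace := PiLp.single 2 p.1 (fundWeight p.2)

theorem slotRoot_mem (p : Fin 3 × Fin 8) : slotRoot p ∈ tripleE8 :=
  single_mem_tripleE8 _ (simpleRoot_mem _)

theorem slotWeight_mem (p : Fin 3 × Fin 8) : slotWeight p ∈ tripleE8 :=
  single_mem_tripleE8 _ (fundWeight_mem _)

/-- The Gram matrix of `slotRoot`. -/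
def slotGram (p q : Fin 3 × Fin 8) : ℤ := if p.1 = q.1 then cartanE8 p.2 q.2 else 0

theorem inner_slotRoot (p q : Fin 3 × Fin 8) :
    inner ℝ (slotRoot p) (slotRoot q) = (slotGram p q : ℝ) := by
  rw [slotRoot, inner_single_left', slotRoot, slotGram]
  split_ifs with h
  · rw [h, PiLp.single_eq_same, inner_simpleRoot]
  · rw [PiLp.single_eq_of_ne _ h, inner_zero_right, Int.cast_zero]

theorem inner_slotWeight (p q : Fin 3 × Fin 8) :
    inner ℝ (slotWeight p) (slotRoot q) = if p = q then (1 : ℝ) else 0 := by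
  rw [slotWeight, inner_single_left', slotRoot]
  by_cases h : p.1 = q.1
  · rw [h, PiLp.single_eq_same, inner_fundWeight]
    simp [Prod.ext_iff, h]
  · rw [PiLp.single_eq_of_ne _ h, inner_zero_right, if_neg fun e => h (congrArg Prod.fst e)]

theorem linearIndependent_slotRoot : LinearIndependent ℝ slotRoot := by
  rw [Fintype.linearIndependent_iff]
  intro g hg p
  have := congrArg (fun v => inner ℝ (slotWeight p) v) hg
  simpa [inner_sum, real_inner_smul_right, inner_slotWeight] using this

def slotBasis : Module.Basis (Fin 3 × Fin 8) ℝ TripleSpace :=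
  basisOfLinearIndependentOfCardEqFinrank linearIndependent_slotRoot (by
    rw [(WithLp.linearEquiv 2 ℝ (Fin 3 → E8Space)).finrank_eq, Module.finrank_pi_fintype]
    simp)

theorem slotBasis_apply (p : Fin 3 × Fin 8) : slotBasis p = slotRoot p := by
  simp [slotBasis]

theorem eq_sum_slotRoot (x : TripleSpace) : x = ∑ p, inner ℝ (slotWeight p) x • slotRoot p := by
  have h : ∀ p, inner ℝ (slotWeight p) x = slotBasis.repr x p := by
    intro p
    conv_lhs => rw [← slotBasis.sum_repr x]
    simp [inner_sum, real_inner_smul_right, slotBasis_apply, inner_slotWeight]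
  conv_lhs => rw [← slotBasis.sum_repr x]
  simp only [h, slotBasis_apply]

/-- The Cartan matrix has an integral inverse, so the dual basis lies in the lattice; pairing with
it shows that the coordinates of lattice vectors are integers. -/
theorem tripleE8_eq_span : tripleE8 = Submodule.span ℤ (Set.range slotRoot) := by
  apply le_antisymm
  · intro x hx
    rw [eq_sum_slotRoot x]
    refine sum_mem fun p _ => ?_
    obtain ⟨n, hn⟩ := tripleE8_integral (slotWeight_mem p) hx
    rw [hn, Int.cast_smul_eq_zsmul]
    exact Submodule.smul_mem _ _ (Submodule.subset_span ⟨p, rfl⟩)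
  · rw [Submodule.span_le]
    rintro _ ⟨p, rfl⟩
    exact slotRoot_mem p

/-- A family with the Gram matrix of the simple roots is their image under an isometry. -/
theorem exists_isometry_of_gram (u : Fin 3 × Fin 8 → TripleSpace)
    (hu : ∀ p q, inner ℝ (u p) (u q) = (slotGram p q : ℝ)) :
    ∃ γ : TripleSpace ≃ₗᵢ[ℝ] TripleSpace, ∀ p, γ (slotRoot p) = u p := by
  let f : TripleSpace →ₗ[ℝ] TripleSpace := slotBasis.constr ℝ u
  have hf : ∀ p, f (slotRoot p) = u p := fun p => by
    rw [← slotBasis_apply]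
    exact slotBasis.constr_basis ℝ u p
  have hf' : ∀ x y, inner ℝ (f x) (f y) = inner ℝ x y := by
    intro x y
    rw [eq_sum_slotRoot x, eq_sum_slotRoot y]
    simp only [map_sum, map_smul, hf, sum_inner, inner_sum, real_inner_smul_left,
      real_inner_smul_right, hu, inner_slotRoot]
  exact ⟨(f.isometryOfInner hf').toLinearIsometryEquiv rfl, hf⟩

/-- One inclusion suffices: if `γ x` is in the lattice, then `x` pairs integrally with it because
`γ` preserves inner products, and the lattice contains its dual. -/
theorem mem_latticeAut_tripleE8 {γ : TripleSpace ≃ₗᵢ[ℝ] TripleSpace}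
    (h : ∀ p, γ (slotRoot p) ∈ tripleE8) : γ ∈ latticeAut tripleE8 := by
  have h1 : ∀ x ∈ tripleE8, γ x ∈ tripleE8 := by
    have : tripleE8 ≤ tripleE8.comap (γ.toLinearEquiv.toLinearMap.restrictScalars ℤ) := by
      conv_lhs => rw [tripleE8_eq_span]
      rw [Submodule.span_le]
      rintro _ ⟨p, rfl⟩
      exact h p
    exact this
  refine fun x => ⟨fun hx => mem_tripleE8_of_dual fun y hy => ?_, h1 x⟩
  obtain ⟨n, hn⟩ := tripleE8_integral hx (h1 y hy)
  exact ⟨n, by rw [← hn, γ.inner_map_map]⟩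

end TripleE8

/-! ### The discriminant space as `E₈/2E₈`. -/

section Classes

open QuadraticMap Module

theorem sqrt_two_inv_smul_mem_dual {x : E8Space} (hx : x ∈ latticeE8) :
    (Real.sqrt 2)⁻¹ • x ∈ dualLattice sqrtTwoE8 := by
  rw [LinearMap.BilinForm.mem_dualSubmodule]
  intro y hy
  obtain ⟨z, hz, rfl⟩ := (Submodule.mem_smul_pointwise_iff_exists _ _ _).1 hy
  obtain ⟨n, hn⟩ := latticeE8_integral hx hz
  refine Submodule.mem_one.2 ⟨n, ?_⟩
  change (n : ℝ) = inner ℝ ((Real.sqrt 2)⁻¹ • x) (Real.sqrt 2 • z)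
  rw [real_inner_smul_left, real_inner_smul_right, hn, inv_mul_cancel_left₀ (by positivity)]

theorem mem_dual_sqrtTwoE8_iff {x : E8Space} :
    x ∈ dualLattice sqrtTwoE8 ↔ Real.sqrt 2 • x ∈ latticeE8 := by
  refine ⟨mem_dual_sqrtTwoE8, fun h => ?_⟩
  simpa [smul_smul] using sqrt_two_inv_smul_mem_dual h

theorem sqrt_two_inv_smul_mem_iff {x : E8Space} :
    (Real.sqrt 2)⁻¹ • x ∈ sqrtTwoE8 ↔ ∃ y ∈ latticeE8, x = (2 : ℝ) • y := by
  have h2 : Real.sqrt 2 * Real.sqrt 2 = 2 := Real.mul_self_sqrt (by norm_num)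
  rw [sqrtTwoE8, Submodule.mem_smul_pointwise_iff_exists]
  refine exists_congr fun y => and_congr_right fun _ => ?_
  rw [eq_inv_smul_iff₀ (by positivity), smul_smul, h2, eq_comm]

/-- The canonical map `E₈ → R(√2 E₈)`, `x ↦ x / √2 + L`. -/
def e8Class : latticeE8 →ₗ[ℤ] DiscGroup sqrtTwoE8 :=
  discMap sqrtTwoE8 ∘ₗ
    { toFun := fun x => ⟨(Real.sqrt 2)⁻¹ • x.1, sqrt_two_inv_smul_mem_dual x.2⟩
      map_add' := fun _ _ => Subtype.ext (smul_add _ _ _)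
      map_smul' := fun _ _ => Subtype.ext (smul_comm _ _ _) }

theorem e8Class_mk {x : E8Space} (hx : x ∈ latticeE8) :
    e8Class ⟨x, hx⟩ = discMap sqrtTwoE8 ⟨_, sqrt_two_inv_smul_mem_dual hx⟩ := rfl

theorem e8Class_surjective (a : DiscGroup sqrtTwoE8) : ∃ x hx, e8Class ⟨x, hx⟩ = a := by
  obtain ⟨⟨v, hv⟩, rfl⟩ := Submodule.mkQ_surjective _ a
  refine ⟨_, mem_dual_sqrtTwoE8 hv, ?_⟩
  rw [e8Class_mk]
  congr 2
  simp [smul_smul]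

theorem e8Class_eq_zero {x : E8Space} (hx : x ∈ latticeE8) :
    e8Class ⟨x, hx⟩ = 0 ↔ ∃ y ∈ latticeE8, x = (2 : ℝ) • y := by
  rw [e8Class_mk, Submodule.mkQ_apply, Submodule.Quotient.mk_eq_zero, ← sqrt_two_inv_smul_mem_iff]
  rfl

theorem discQuad_e8Class {x : E8Space} (hx : x ∈ latticeE8) {n : ℤ}
    (hn : inner ℝ x x = 2 * (n : ℝ)) : discQuad (e8Class ⟨x, hx⟩) = n := by
  refine discQuadFun_mk (sqrt_two_inv_smul_mem_dual hx) ?_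
  have h2 : (Real.sqrt 2)⁻¹ * (Real.sqrt 2)⁻¹ = 2⁻¹ := by
    rw [← mul_inv, Real.mul_self_sqrt (by norm_num)]
  rw [real_inner_smul_left, real_inner_smul_right, ← mul_assoc, h2, hn]
  ring

theorem polar_e8Class {x y : E8Space} (hx : x ∈ latticeE8) (hy : y ∈ latticeE8) {n : ℤ}
    (hn : inner ℝ x y = (n : ℝ)) :
    polar discQuad (e8Class ⟨x, hx⟩) (e8Class ⟨y, hy⟩) = n := by
  refine polar_discQuadFun_mk (sqrt_two_inv_smul_mem_dual hx) (sqrt_two_inv_smul_mem_dual hy) ?_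
  have h2 : (Real.sqrt 2)⁻¹ * (Real.sqrt 2)⁻¹ = 2⁻¹ := by
    rw [← mul_inv, Real.mul_self_sqrt (by norm_num)]
  rw [real_inner_smul_left, real_inner_smul_right, ← mul_assoc _ _ (inner ℝ x y), h2, hn]
  ring

theorem intCast_zmod_two_eq_zero_iff (n : ℤ) : (n : ZMod 2) = 0 ↔ Even n := by
  rw [ZMod.intCast_zmod_eq_zero_iff_dvd, even_iff_two_dvd]
  rfl

/-- If `x` has even inner product with all of `E₈`, then `x/2` lies in the dual, hence in `E₈`. -/
theorem discQuad_nondegenerate (a : DiscGroup sqrtTwoE8)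
    (h : ∀ b, polar discQuad a b = 0) : a = 0 := by
  obtain ⟨x, hx, rfl⟩ := e8Class_surjective a
  rw [e8Class_eq_zero]
  refine ⟨(2⁻¹ : ℝ) • x, mem_latticeE8_of_dual fun y hy => ?_, by simp [smul_smul]⟩
  obtain ⟨n, hn⟩ := latticeE8_integral hx hy
  have h1 := h (e8Class ⟨y, hy⟩)
  rw [polar_e8Class hx hy hn, intCast_zmod_two_eq_zero_iff] at h1
  obtain ⟨m, rfl⟩ := h1
  refine ⟨m, ?_⟩
  rw [real_inner_smul_left, hn]
  push_cast
  ring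

/-- The class of a simple root. -/
def rootClass (k : Fin 8) : DiscGroup sqrtTwoE8 := e8Class ⟨simpleRoot k, simpleRoot_mem k⟩

theorem discQuad_rootClass (k : Fin 8) : discQuad (rootClass k) = 1 := by
  rw [rootClass, discQuad_e8Class (n := 1)]
  · rfl
  · rw [inner_simpleRoot]
    have : cartanE8 k k = 2 := by revert k; decide
    rw [this]; norm_num

theorem polar_rootClass (k l : Fin 8) :
    polar discQuad (rootClass k) (rootClass l) = (cartanE8 k l : ZMod 2) :=
  polar_e8Class _ _ (inner_simpleRoot k l)

theorem polar_fundWeight_rootClass (k l : Fin 8) :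
    polar discQuad (e8Class ⟨fundWeight k, fundWeight_mem k⟩) (rootClass l) =
      if k = l then 1 else 0 := by
  rw [rootClass, polar_e8Class (n := if k = l then 1 else 0)]
  · split_ifs <;> rfl
  · rw [inner_fundWeight]; split_ifs <;> simp

theorem exists_polar_rootClass (k : Fin 8) (hk : k ≠ 0) :
    ∃ l < k, polar discQuad (rootClass l) (rootClass k) = 1 :=
  ⟨_, dynkinParent_lt hk, by rw [polar_rootClass, cartanE8_dynkinParent hk]; rfl⟩

theorem linearIndependent_rootClass : LinearIndependent (ZMod 2) rootClass := by
  rw [Fintype.linearIndependent_iff]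
  intro g hg k
  have := congrArg (polarBilin discQuad (e8Class ⟨fundWeight k, fundWeight_mem k⟩)) hg
  simpa only [map_sum, map_smul, polarBilin_apply_apply, polar_fundWeight_rootClass, map_zero,
    smul_eq_mul, mul_ite, mul_one, mul_zero, Finset.sum_ite_eq, Finset.mem_univ, if_true] using this

/-- The spanning statement for `E₈³` is projected to its first summand. -/
theorem latticeE8_le_span : latticeE8 ≤ Submodule.span ℤ (Set.range simpleRoot) := by
  intro x hx
  have h : (PiLp.single 2 0 x : TripleSpace) ∈ Submodule.span ℤ (Set.range slotRoot) := by
    rw [← tripleE8_eq_span]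
    exact single_mem_tripleE8 0 hx
  let f : TripleSpace →ₗ[ℤ] E8Space :=
    { toFun := fun v => v 0, map_add' := fun _ _ => rfl, map_smul' := fun _ _ => rfl }
  have h2 := Submodule.mem_map_of_mem (f := f) h
  rw [Submodule.map_span] at h2
  have h3 : f (PiLp.single 2 0 x : TripleSpace) = x :=
    PiLp.single_eq_same (β := fun _ => E8Space) 2 (0 : Fin 3) x
  rw [h3] at h2
  refine Submodule.span_le.2 ?_ h2
  rintro _ ⟨_, ⟨p, rfl⟩, rfl⟩
  change (slotRoot p) 0 ∈ _
  rw [slotRoot]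
  by_cases hp : 0 = p.1
  · rw [← hp, PiLp.single_eq_same]
    exact Submodule.subset_span ⟨_, rfl⟩
  · rw [PiLp.single_eq_of_ne _ hp]
    exact zero_mem _

theorem span_rootClass : Submodule.span (ZMod 2) (Set.range rootClass) = ⊤ := by
  rw [eq_top_iff]
  rintro a -
  obtain ⟨x, hx, rfl⟩ := e8Class_surjective a
  let N : Submodule ℤ latticeE8 :=
    (Submodule.span (ZMod 2) (Set.range rootClass)).toAddSubgroup.toIntSubmodule.comap e8Class
  have h : Submodule.span ℤ (Set.range simpleRoot) ≤ N.map latticeE8.subtype := by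
    rw [Submodule.span_le]
    rintro _ ⟨k, rfl⟩
    exact ⟨⟨_, simpleRoot_mem k⟩, Submodule.subset_span ⟨k, rfl⟩, rfl⟩
  obtain ⟨y, hy, rfl⟩ := h (latticeE8_le_span hx)
  exact hy

instance : FiniteDimensional (ZMod 2) (DiscGroup sqrtTwoE8) :=
  Module.Finite.of_basis (Basis.mk linearIndependent_rootClass span_rootClass.ge)

theorem finrank_discGroup : finrank (ZMod 2) (DiscGroup sqrtTwoE8) = 8 := by
  rw [finrank_eq_card_basis (Basis.mk linearIndependent_rootClass span_rootClass.ge)]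
  rfl

/-- A totally singular subspace of half the dimension. -/
theorem exists_totallySingular_discQuad : ∃ U : Submodule (ZMod 2) (DiscGroup sqrtTwoE8),
    IsTotallySingular discQuad U ∧ finrank (ZMod 2) U = 4 := by
  -- The generators are sums of two orthogonal simple roots, chosen with mutually even inner
  -- products. The nodes `a i` are distinct and avoid all `b j`, so the fundamental weights at `a i`
  -- are dual to the generators and prove independence.
  let a : Fin 4 → Fin 8 := ![1, 2, 3, 5]
  let b : Fin 4 → Fin 8 := ![7, 6, 7, 7]
  let u : Fin 4 → DiscGroup sqrtTwoE8 := fun i => rootClass (a i) + rootClass (b i)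
  have huu : ∀ i j, polar discQuad (u i) (u j) = 0 := by
    intro i j
    simp only [u, polar_add_left, polar_add_right, polar_rootClass]
    fin_cases i <;> fin_cases j <;> decide
  have hu : ∀ i, discQuad (u i) = 0 := by
    intro i
    rw [QuadraticMap.map_add discQuad, discQuad_rootClass, discQuad_rootClass, polar_rootClass]
    fin_cases i <;> decide
  refine ⟨Submodule.span (ZMod 2) (Set.range u), isTotallySingular_span ?_ ?_, ?_⟩
  · rintro _ ⟨i, rfl⟩
    exact hu i
  · rintro _ ⟨i, rfl⟩ _ ⟨j, rfl⟩
    exact huu i j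
  · have hli : LinearIndependent (ZMod 2) u := by
      rw [Fintype.linearIndependent_iff]
      intro g hg i
      have h1 := congrArg (polarBilin discQuad (e8Class ⟨fundWeight (a i), fundWeight_mem _⟩)) hg
      have h2 : ∀ j, polar discQuad (e8Class ⟨fundWeight (a i), fundWeight_mem _⟩) (u j) =
          if i = j then 1 else 0 := by
        intro j
        simp only [u, polar_add_right, polar_fundWeight_rootClass]
        fin_cases i <;> fin_cases j <;> decide
      simpa only [map_sum, map_smul, polarBilin_apply_apply, h2, map_zero,
        smul_eq_mul, mul_ite, mul_one, mul_zero, Finset.sum_ite_eq, Finset.mem_univ, if_true] using h1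
    rw [finrank_span_eq_card hli]
    rfl

/-- A maximal totally singular subspace of `R(L)³` is its own orthogonal space. -/
theorem orthogonal_le_of_isMaxTotallySingular
    {S : Submodule (ZMod 2) (Fin 3 → DiscGroup sqrtTwoE8)}
    (hS : IsMaxTotallySingular (quadPow discQuad 3) S) :
    LinearMap.BilinForm.orthogonal (polarBilin (quadPow discQuad 3)) S ≤ S := by
  obtain ⟨U, hU, hU4⟩ := exists_totallySingular_discQuad
  refine hS.orthogonal_le (U := Submodule.pi Set.univ fun _ => U)
    (quadPow_polarBilin_nondegenerate discQuad_nondegenerate) ?_ ?_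
  · intro v hv
    rw [QuadraticMap.pi_apply]
    exact Finset.sum_eq_zero fun i _ => hU _ (hv i (Set.mem_univ i))
  · have e : (Submodule.pi Set.univ fun _ : Fin 3 => U) ≃ₗ[ZMod 2] (Fin 3 → U) :=
      { toFun := fun v i => ⟨v.1 i, v.2 i (Set.mem_univ i)⟩
        invFun := fun v => ⟨fun i => v i, fun i _ => (v i).2⟩
        map_add' := fun _ _ => rfl
        map_smul' := fun _ _ => rfl
        left_inv := fun _ => rfl
        right_inv := fun _ => rfl }
    rw [e.finrank_eq, finrank_pi_fintype, finrank_pi_fintype]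
    simp [hU4, finrank_discGroup]

end Classes

/-! ### Weights in `R(L)³` as halved minimal norms. -/

section GlueClasses

open QuadraticMap Module

/-- The canonical map `E₈³ → R(L)³`, `x ↦ x / √2 + L³`, for `L = √2 E₈`. -/
def glueClass : tripleE8 →ₗ[ℤ] (Fin 3 → DiscGroup sqrtTwoE8) where
  toFun x i := e8Class ⟨x.1 i, x.2 i⟩
  map_add' x y := funext fun i => map_add e8Class ⟨x.1 i, x.2 i⟩ ⟨y.1 i, y.2 i⟩
  map_smul' c x := funext fun i => map_smul e8Class c ⟨x.1 i, x.2 i⟩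

theorem glueClass_apply (x : tripleE8) (i : Fin 3) :
    glueClass x i = e8Class ⟨x.1 i, x.2 i⟩ := rfl

theorem glueClass_surjective : Function.Surjective glueClass := by
  intro a
  choose x hx h using fun i => e8Class_surjective (a i)
  exact ⟨⟨WithLp.toLp 2 x, hx⟩, funext h⟩

theorem glueClass_eq_zero {x : tripleE8} :
    glueClass x = 0 ↔ ∃ y ∈ tripleE8, x.1 = (2 : ℝ) • y := by
  constructor
  · intro h
    choose y hy hxy using fun i => (e8Class_eq_zero (x.2 i)).1 (congrFun h i)
    exact ⟨WithLp.toLp 2 y, hy, PiLp.ext hxy⟩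
  · rintro ⟨y, hy, h⟩
    exact funext fun i => (e8Class_eq_zero (x.2 i)).2 ⟨y i, hy i, by rw [h]; rfl⟩

theorem polar_glueClass {x y : tripleE8} {n : ℤ} (hn : inner ℝ x.1 y.1 = (n : ℝ)) :
    polar (quadPow discQuad 3) (glueClass x) (glueClass y) = n := by
  choose m hm using fun i => latticeE8_integral (x.2 i) (y.2 i)
  have h : n = ∑ i, m i := by
    rw [PiLp.inner_apply] at hn
    simp only [hm] at hn
    exact_mod_cast hn.symm
  rw [polar_quadPow, h, Int.cast_sum]
  exact Finset.sum_congr rfl fun i _ => polar_e8Class _ _ (hm i)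

theorem quadPow_glueClass {x : tripleE8} {n : ℤ} (hn : inner ℝ x.1 x.1 = 2 * (n : ℝ)) :
    quadPow discQuad 3 (glueClass x) = n := by
  choose m hm using fun i => latticeE8_even (x.2 i)
  have h : n = ∑ i, m i := by
    rw [PiLp.inner_apply] at hn
    simp only [hm, ← Finset.mul_sum] at hn
    have : (n : ℝ) = ∑ i, (m i : ℝ) := by linarith
    exact_mod_cast this
  rw [QuadraticMap.pi_apply, h, Int.cast_sum]
  exact Finset.sum_congr rfl fun i _ => discQuad_e8Class _ (hm i)

theorem exists_nat_inner_self {x : E8Space} (hx : x ∈ latticeE8) :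
    ∃ n : ℕ, inner ℝ x x = 2 * (n : ℝ) := by
  obtain ⟨n, hn⟩ := latticeE8_even hx
  have h0 : (0 : ℝ) ≤ inner ℝ x x := real_inner_self_nonneg
  rw [hn] at h0
  have h1 : 0 ≤ n := by
    have : (0 : ℝ) ≤ n := by linarith
    exact_mod_cast this
  lift n to ℕ using h1
  exact ⟨n, by exact_mod_cast hn⟩

/-- The weight is a lower bound for half the norm. -/
theorem wt_e8Class_le {x : E8Space} (hx : x ∈ latticeE8) {n : ℕ} (hn : inner ℝ x x = 2 * (n : ℝ)) :
    wt discQuad (e8Class ⟨x, hx⟩) ≤ n := by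
  have hq := discQuad_e8Class hx (n := n) (by exact_mod_cast hn)
  have h0 : n = 0 → e8Class ⟨x, hx⟩ = 0 := by
    rintro rfl
    have : x = 0 := by
      rw [← inner_self_eq_zero (𝕜 := ℝ), hn]; simp
    subst this
    exact map_zero e8Class
  unfold wt
  split_ifs with h1 h2
  · omega
  · by_contra h
    exact h1 (h0 (by omega))
  · by_contra h
    have h3 : n = 0 ∨ n = 1 := by omega
    rcases h3 with rfl | rfl
    · exact h1 (h0 rfl)
    · exact h2 (by rw [hq]; rfl)

/-- Together with `wt_e8Class_le`, this makes the weight half the minimal norm of a class. -/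
theorem exists_short_e8Class (a : DiscGroup sqrtTwoE8) :
    ∃ x hx, e8Class ⟨x, hx⟩ = a ∧ inner ℝ x x = 2 * (wt discQuad a : ℝ) := by
  by_cases ha : a = 0
  · subst ha
    exact ⟨0, zero_mem _, map_zero e8Class, by simp [wt_zero]⟩
  obtain ⟨v, hv, rfl⟩ := e8Class_surjective a
  obtain ⟨e, he, hle⟩ := exists_short_mem_latticeE8 hv
  have he2 : (2 : ℝ) • e ∈ latticeE8 := by rw [two_smul]; exact add_mem he he
  have hx : v - (2 : ℝ) • e ∈ latticeE8 := sub_mem hv he2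
  have hcl : e8Class ⟨_, hx⟩ = e8Class ⟨v, hv⟩ := by
    have h1 : e8Class ⟨_, he2⟩ = 0 := (e8Class_eq_zero he2).2 ⟨e, he, rfl⟩
    have h2 : e8Class ⟨_, hx⟩ = e8Class ⟨v, hv⟩ - e8Class ⟨_, he2⟩ :=
      map_sub e8Class ⟨v, hv⟩ ⟨_, he2⟩
    rw [h2, h1, sub_zero]
  obtain ⟨n, hn⟩ := exists_nat_inner_self hx
  refine ⟨_, hx, hcl, ?_⟩
  rw [← hcl] at ha ⊢
  have h1 := wt_e8Class_le hx hn
  have h2 : n ≤ 2 := by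
    rw [hn] at hle
    have : (n : ℝ) ≤ 2 := by linarith
    exact_mod_cast this
  have hq := discQuad_e8Class hx (n := n) (by exact_mod_cast hn)
  -- The weight is nonzero, at most `n ≤ 2`, and congruent to `n` mod 2, since both reduce to the
  -- value of the form.
  have h3 : wt discQuad (e8Class ⟨_, hx⟩) = n := by
    have h4 := natCast_wt discQuad (e8Class ⟨_, hx⟩)
    have h5 : wt discQuad (e8Class ⟨_, hx⟩) ≠ 0 := by
      unfold wt; rw [if_neg ha]; split_ifs <;> simp
    rw [hq, Int.cast_natCast, ZMod.natCast_eq_natCast_iff'] at h4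
    omega
  rw [h3, hn]

theorem exists_short_glueClass (a : Fin 3 → DiscGroup sqrtTwoE8) :
    ∃ x : tripleE8, glueClass x = a ∧ inner ℝ x.1 x.1 = 2 * (wtPow discQuad 3 a : ℝ) := by
  choose x hx h hn using fun i => exists_short_e8Class (a i)
  refine ⟨⟨WithLp.toLp 2 x, hx⟩, funext h, ?_⟩
  rw [PiLp.inner_apply, wtPow, Nat.cast_sum, Finset.mul_sum]
  exact Finset.sum_congr rfl fun i _ => hn i

theorem wtPow_glueClass_le (x : tripleE8) :
    2 * (wtPow discQuad 3 (glueClass x) : ℝ) ≤ inner ℝ x.1 x.1 := by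
  rw [PiLp.inner_apply, wtPow, Nat.cast_sum, Finset.mul_sum]
  refine Finset.sum_le_sum fun i _ => ?_
  obtain ⟨n, hn⟩ := exists_nat_inner_self (x.2 i)
  rw [hn]
  have := wt_e8Class_le (x.2 i) hn
  gcongr
  exact_mod_cast this

theorem glueClass_slotRoot (p : Fin 3 × Fin 8) :
    glueClass ⟨slotRoot p, slotRoot_mem p⟩ = Pi.single p.1 (rootClass p.2) := by
  funext i
  rw [glueClass_apply]
  by_cases h : i = p.1
  · subst h
    rw [Pi.single_eq_same, rootClass]
    congr 2
    exact PiLp.single_eq_same (β := fun _ => E8Space) 2 p.1 (simpleRoot p.2)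
  · rw [Pi.single_eq_of_ne h, e8Class_eq_zero]
    refine ⟨0, zero_mem _, ?_⟩
    rw [smul_zero]
    exact PiLp.single_eq_of_ne (β := fun _ => E8Space) 2 h (simpleRoot p.2)

/-- The classes of the simple roots span `R(L)³`, so agreement there is enough. -/
theorem span_glueClass_slotRoot {f g : (Fin 3 → DiscGroup sqrtTwoE8) →ₗ[ZMod 2]
      (Fin 3 → DiscGroup sqrtTwoE8)}
    (h : ∀ p, f (glueClass ⟨slotRoot p, slotRoot_mem p⟩) =
      g (glueClass ⟨slotRoot p, slotRoot_mem p⟩)) : f = g := by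
  apply LinearMap.pi_ext'
  intro i
  refine LinearMap.ext_on_range span_rootClass fun k => ?_
  have := h (i, k)
  rw [glueClass_slotRoot] at this
  exact this

end GlueClasses

/-! ### The action of `Aut(E₈³)` on `R(L)³`. -/

section InducedAutomorphisms

open QuadraticMap Module

/-- The action of an automorphism of `E₈³` on the lattice. -/
def latticeAutMap (γ : latticeAut tripleE8) : tripleE8 →ₗ[ℤ] tripleE8 where
  toFun x := ⟨γ.1 x.1, (γ.2 x.1).2 x.2⟩
  map_add' _ _ := Subtype.ext (map_add γ.1 _ _)
  map_smul' c x := Subtype.ext (map_zsmul γ.1 c x.1)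

theorem glueClass_latticeAutMap (γ : latticeAut tripleE8) {x y : tripleE8}
    (h : glueClass x = glueClass y) :
    glueClass (latticeAutMap γ x) = glueClass (latticeAutMap γ y) := by
  rw [← sub_eq_zero, ← map_sub] at h
  obtain ⟨z, hz, hxy⟩ := glueClass_eq_zero.1 h
  rw [← sub_eq_zero, ← map_sub, ← map_sub]
  refine glueClass_eq_zero.2 ⟨γ.1 z, (γ.2 z).2 hz, ?_⟩
  change γ.1 (x - y).1 = _
  rw [hxy, map_smul]

/-- The map of `R(L)³` induced by an automorphism of `E₈³`. -/
def inducedMap (γ : latticeAut tripleE8) (a : Fin 3 → DiscGroup sqrtTwoE8) :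
    Fin 3 → DiscGroup sqrtTwoE8 :=
  glueClass (latticeAutMap γ (Function.surjInv glueClass_surjective a))

theorem inducedMap_glueClass (γ : latticeAut tripleE8) (x : tripleE8) :
    inducedMap γ (glueClass x) = glueClass (latticeAutMap γ x) :=
  glueClass_latticeAutMap γ (Function.surjInv_eq _ _)

theorem inducedMap_mul (γ δ : latticeAut tripleE8) (a : Fin 3 → DiscGroup sqrtTwoE8) :
    inducedMap (γ * δ) a = inducedMap γ (inducedMap δ a) := by
  obtain ⟨x, rfl⟩ := glueClass_surjective a
  rw [inducedMap_glueClass, inducedMap_glueClass, inducedMap_glueClass]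
  rfl

theorem inducedMap_one (a : Fin 3 → DiscGroup sqrtTwoE8) : inducedMap 1 a = a := by
  obtain ⟨x, rfl⟩ := glueClass_surjective a
  rw [inducedMap_glueClass]
  rfl

def inducedLinearMap (γ : latticeAut tripleE8) :
    (Fin 3 → DiscGroup sqrtTwoE8) →ₗ[ZMod 2] (Fin 3 → DiscGroup sqrtTwoE8) :=
  AddMonoidHom.toZModLinearMap 2 <| AddMonoidHom.mk' (inducedMap γ) fun a b => by
    obtain ⟨x, rfl⟩ := glueClass_surjective a
    obtain ⟨y, rfl⟩ := glueClass_surjective b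
    rw [← map_add, inducedMap_glueClass, inducedMap_glueClass, inducedMap_glueClass, map_add, map_add]

/-- The action of `Aut(E₈³)` on `R(L)³`. -/
def inducedAut : latticeAut tripleE8 →*
    ((Fin 3 → DiscGroup sqrtTwoE8) ≃ₗ[ZMod 2] (Fin 3 → DiscGroup sqrtTwoE8)) :=
  MonoidHom.mk' (fun γ => LinearEquiv.ofLinearMap (inducedLinearMap γ) (inducedLinearMap γ⁻¹)
    (LinearMap.ext fun a => by
      change inducedMap γ (inducedMap γ⁻¹ a) = a
      rw [← inducedMap_mul, mul_inv_cancel, inducedMap_one])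
    (LinearMap.ext fun a => by
      change inducedMap γ⁻¹ (inducedMap γ a) = a
      rw [← inducedMap_mul, inv_mul_cancel, inducedMap_one])) fun γ δ =>
    LinearEquiv.ext (inducedMap_mul γ δ)

theorem inducedAut_glueClass (γ : latticeAut tripleE8) (x : tripleE8) :
    inducedAut γ (glueClass x) = glueClass (latticeAutMap γ x) :=
  inducedMap_glueClass γ x

/-- An isometry cannot increase the minimal norm of a class, hence not the weight; applying this to
its inverse gives equality. -/
theorem inducedAut_mem_autWt (γ : latticeAut tripleE8) : inducedAut γ ∈ autWt discQuad 3 := by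
  have hle : ∀ (γ : latticeAut tripleE8) a, wtPow discQuad 3 (inducedAut γ a) ≤ wtPow discQuad 3 a := by
    intro γ a
    obtain ⟨x, rfl, hx⟩ := exists_short_glueClass a
    have h1 := wtPow_glueClass_le (latticeAutMap γ x)
    rw [inducedAut_glueClass]
    have h2 : inner ℝ (latticeAutMap γ x).1 (latticeAutMap γ x).1 = inner ℝ x.1 x.1 :=
      γ.1.inner_map_map _ _
    rw [h2, hx] at h1
    have h3 : (wtPow discQuad 3 (glueClass (latticeAutMap γ x)) : ℝ) ≤
      wtPow discQuad 3 (glueClass x) := by linarith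
    exact_mod_cast h3
  intro a
  refine le_antisymm (hle γ a) ?_
  have := hle γ⁻¹ (inducedAut γ a)
  rwa [← LinearEquiv.mul_apply, ← map_mul, inv_mul_cancel, map_one] at this

/-- Signs disappear in a group of exponent 2. This permits the adjustment of signs when lifting and
also produces the kernel. -/
theorem sign_smul_eq {ε : ℤ} (hε : ε * ε = 1) (a : Fin 3 → DiscGroup sqrtTwoE8) : ε • a = a := by
  rcases mul_self_eq_one_iff.1 hε with rfl | rfl
  · simp
  · rw [neg_smul, one_smul]
    funext i
    rw [← sub_eq_zero, Pi.neg_apply, neg_sub_left, neg_eq_zero, ← two_nsmul,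
      ← Nat.cast_smul_eq_nsmul (ZMod 2)]
    exact zero_smul _ _

end InducedAutomorphisms

/-! ### Surjectivity and kernel of the action. -/

section LiftingIsometries

open QuadraticMap Module

/-- The sign at a node is the product of the prescribed edge signs along the path to node `0`; no
cycle imposes a condition. -/
theorem exists_dynkin_signs (s : Fin 8 → ℤ) (hs : ∀ k, s k * s k = 1) :
    ∃ ε : Fin 8 → ℤ, (∀ k, ε k * ε k = 1) ∧ ∀ k, k ≠ 0 → ε k = s k * ε (dynkinParent k) := by
  refine ⟨![1, s 1, s 2 * s 1, s 3 * (s 2 * s 1), s 4 * (s 2 * s 1), s 5 * (s 4 * (s 2 * s 1)),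
    s 6 * (s 5 * (s 4 * (s 2 * s 1))), s 7 * (s 6 * (s 5 * (s 4 * (s 2 * s 1))))], ?_, ?_⟩
  · intro k
    have hs' : ∀ k c, s k * c * (s k * c) = c * c := fun k c => by
      rw [mul_mul_mul_comm, hs, one_mul]
    fin_cases k <;> simp [hs, hs']
  · intro k hk
    fin_cases k <;> simp [dynkinParent] at hk ⊢

/-- Every automorphism of `(R(L)³, w³)` lifts to an isometry. -/
theorem exists_isometry_of_mem_autWt {g : (Fin 3 → DiscGroup sqrtTwoE8) ≃ₗ[ZMod 2]
      (Fin 3 → DiscGroup sqrtTwoE8)} (hg : g ∈ autWt discQuad 3) :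
    ∃ γ : latticeAut tripleE8, inducedAut γ = g := by
  let b : Fin 3 × Fin 8 → Fin 3 → DiscGroup sqrtTwoE8 :=
    fun p => glueClass ⟨slotRoot p, slotRoot_mem p⟩
  have hb : ∀ p q, polar (quadPow discQuad 3) (b p) (b q) = slotGram p q := fun p q =>
    polar_glueClass (inner_slotRoot p q)
  -- The class `g (b p)` has weight one, so `u p` is a root. Preservation of the polar form
  -- determines the inner products of these roots mod 2.
  choose u hu hn using fun p => exists_short_glueClass (g (b p))
  have hn2 : ∀ p, inner ℝ (u p).1 (u p).1 = (2 : ℝ) := by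
    intro p
    rw [hn, hg, show b p = _ from glueClass_slotRoot p, wtPow_single,
      wt_of_eq_one (discQuad_rootClass _)]
    norm_num
  choose d hd using fun p q => tripleE8_integral (u p).2 (u q).2
  have hdpar : ∀ p q, (d p q : ZMod 2) = slotGram p q := by
    intro p q
    rw [← hb, ← polar_of_mem_autWt hg, ← hu, ← hu, polar_glueClass (hd p q)]
  have hd2 : ∀ p, d p p = 2 := by
    intro p
    have := hn2 p
    rw [hd] at this
    exact_mod_cast this
  have hdcomm : ∀ p q, d p q = d q p := by
    intro p q
    have := real_inner_comm (u p).1 (u q).1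
    rw [hd, hd] at this
    exact_mod_cast this.symm
  have hbinj : Function.Injective b := by
    intro p q hpq
    by_contra hne
    have h1 : polar (quadPow discQuad 3) (glueClass ⟨slotWeight p, slotWeight_mem p⟩) (b p) = 1 := by
      rw [polar_glueClass (n := 1)]
      · rfl
      · rw [inner_slotWeight, if_pos rfl]; simp
    have h2 : polar (quadPow discQuad 3) (glueClass ⟨slotWeight p, slotWeight_mem p⟩) (b q) = 0 := by
      rw [polar_glueClass (n := 0)]
      · rfl
      · rw [inner_slotWeight, if_neg hne]; simp
    rw [← hpq, h1] at h2
    exact one_ne_zero h2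
  -- The roots `u p` and `±u q` have different classes, so `|u p - ε • u q|² = 4 - 2 ε d p q` is
  -- positive for both signs. With the parity this leaves `0` for even entries and `±1` for odd
  -- ones.
  have hdne : ∀ p q, p ≠ q → |d p q| ≤ 1 := by
    intro p q hpq
    have hne : ∀ ε : ℤ, ε * ε = 1 → (u p).1 ≠ (ε : ℝ) • (u q).1 := by
      intro ε hε h
      refine hpq (hbinj (g.injective ?_))
      rw [← hu, ← hu]
      have h3 : u p = ε • u q := Subtype.ext (by
        rw [h]; exact Int.cast_smul_eq_zsmul ℝ ε (u q).1)
      rw [h3, map_smul, sign_smul_eq hε]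
    have hpos : ∀ ε : ℤ, ε * ε = 1 → 2 * ε * d p q < 4 := by
      intro ε hε
      have h1 : (0 : ℝ) < inner ℝ ((u p).1 - (ε : ℝ) • (u q).1) ((u p).1 - (ε : ℝ) • (u q).1) :=
        real_inner_self_pos.2 (sub_ne_zero.2 (hne ε hε))
      rw [inner_sub_left, inner_sub_right, inner_sub_right, real_inner_smul_left,
        real_inner_smul_right, real_inner_smul_left, real_inner_smul_right, hd, hd, hd, hd, hd2, hd2,
        hdcomm q p] at h1
      have h2 : (ε : ℝ) * ε = 1 := by exact_mod_cast hε
      have h3 : (2 * ε * d p q : ℝ) < 4 := by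
        have : (ε : ℝ) * (ε * ((2 : ℤ) : ℝ)) = 2 := by rw [← mul_assoc, h2]; norm_num
        rw [this] at h1
        push_cast at h1
        linarith
      exact_mod_cast h3
    have h1 := hpos 1 rfl
    have h2 := hpos (-1) rfl
    rw [abs_le]
    constructor <;> omega
  have hodd : ∀ i k, k ≠ 0 → -d (i, dynkinParent k) (i, k) * -d (i, dynkinParent k) (i, k) = 1 := by
    intro i k hk
    have h1 := hdne (i, dynkinParent k) (i, k) (fun h => (dynkinParent_lt hk).ne (congrArg Prod.snd h))
    have h2 := hdpar (i, dynkinParent k) (i, k)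
    rw [slotGram, if_pos rfl, cartanE8_dynkinParent hk] at h2
    rw [abs_le] at h1
    have h3 : d (i, dynkinParent k) (i, k) ≠ 0 := by
      intro h0
      rw [h0] at h2
      revert h2
      decide
    have h4 : d (i, dynkinParent k) (i, k) = 1 ∨ d (i, dynkinParent k) (i, k) = -1 := by omega
    rcases h4 with h4 | h4 <;> rw [h4] <;> norm_num
  -- The signs are chosen to make every edge inner product equal to `-1`, as in the Cartan matrix.
  have hsign : ∀ i, ∃ ε : Fin 8 → ℤ, (∀ k, ε k * ε k = 1) ∧
      ∀ k, k ≠ 0 → ε k = -d (i, dynkinParent k) (i, k) * ε (dynkinParent k) := by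
    intro i
    obtain ⟨ε, h1, h2⟩ := exists_dynkin_signs
      (fun k => if k = 0 then 1 else -d (i, dynkinParent k) (i, k)) (by
        intro k
        split_ifs with hk
        · rfl
        · exact hodd i k hk)
    exact ⟨ε, h1, fun k hk => by rw [h2 k hk, if_neg hk]⟩
  choose ε hε hεd using hsign
  have hadj : ∀ i k, k ≠ 0 → ε i (dynkinParent k) * (ε i k * d (i, dynkinParent k) (i, k)) = -1 := by
    intro i k hk
    rw [hεd i k hk]
    linear_combination (-(d (i, dynkinParent k) (i, k)) ^ 2) * hε i (dynkinParent k) - hodd i k hk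
  let v : Fin 3 × Fin 8 → tripleE8 := fun p => ε p.1 p.2 • u p
  have hv : ∀ p q, inner ℝ (v p).1 (v q).1 = ((ε p.1 p.2 * (ε q.1 q.2 * d p q) : ℤ) : ℝ) := by
    intro p q
    change inner ℝ (ε p.1 p.2 • (u p).1) (ε q.1 q.2 • (u q).1) = _
    rw [← Int.cast_smul_eq_zsmul ℝ, ← Int.cast_smul_eq_zsmul ℝ, real_inner_smul_left,
      real_inner_smul_right, hd]
    push_cast
    rfl
  have hgram : ∀ p q, ε p.1 p.2 * (ε q.1 q.2 * d p q) = slotGram p q := by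
    have hzero : ∀ p q, p ≠ q → slotGram p q = 0 → d p q = 0 := by
      intro p q hpq h0
      have h1 := hdne p q hpq
      have h2 := hdpar p q
      rw [h0, Int.cast_zero, intCast_zmod_two_eq_zero_iff] at h2
      rw [abs_le] at h1
      obtain ⟨m, hm⟩ := h2
      omega
    rintro ⟨i, k⟩ ⟨j, l⟩
    by_cases hij : i = j
    · subst hij
      rcases cartanE8_cases k l with ⟨rfl, hc⟩ | ⟨hk, rfl, hc⟩ | ⟨hl, rfl, hc⟩ | ⟨hkl, hc⟩
      · rw [hd2, slotGram, if_pos rfl, hc, ← mul_assoc, hε, one_mul]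
      · rw [slotGram, if_pos rfl, hc, ← hadj i k hk, hdcomm]
        ring
      · rw [slotGram, if_pos rfl, hc, ← hadj i l hl]
      · have h0 : slotGram (i, k) (i, l) = 0 := by rw [slotGram, if_pos rfl, hc]
        rw [h0, hzero _ _ (fun h => hkl (congrArg Prod.snd h)) h0, mul_zero, mul_zero]
    · have h0 : slotGram (i, k) (j, l) = 0 := by rw [slotGram, if_neg hij]
      rw [h0, hzero _ _ (fun h => hij (congrArg Prod.fst h)) h0, mul_zero, mul_zero]
  obtain ⟨γ, hγ⟩ := exists_isometry_of_gram (fun p => (v p).1) (fun p q => by rw [hv, hgram])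
  have hγm : γ ∈ latticeAut tripleE8 := mem_latticeAut_tripleE8 fun p => by rw [hγ]; exact (v p).2
  refine ⟨⟨γ, hγm⟩, LinearEquiv.toLinearMap_injective (span_glueClass_slotRoot fun p => ?_)⟩
  have h1 : latticeAutMap ⟨γ, hγm⟩ ⟨slotRoot p, slotRoot_mem p⟩ = v p := Subtype.ext (hγ p)
  change inducedAut _ _ = g _
  rw [inducedAut_glueClass, h1, map_smul, sign_smul_eq (hε _ _), hu]

/-- An isometry acting trivially on `R(L)³` is a sign on each summand. -/
theorem exists_signs_of_inducedAut_eq_one {γ : latticeAut tripleE8} (h : inducedAut γ = 1) :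
    ∃ ε : Fin 3 → ℤ, (∀ i, ε i * ε i = 1) ∧ ∀ x i, γ.1 x i = (ε i : ℝ) • x i := by
  have hpm : ∀ p, ∃ ε : ℤ, ε * ε = 1 ∧ γ.1 (slotRoot p) = (ε : ℝ) • slotRoot p := by
    intro p
    let r : tripleE8 := ⟨slotRoot p, slotRoot_mem p⟩
    have h1 : glueClass (latticeAutMap γ r - r) = 0 := by
      rw [map_sub, ← inducedAut_glueClass, h]
      exact sub_self _
    -- Write `r` for the root, `γ r - r = 2y` and `c = (γ r, r)`. Comparing norms gives `4 - 2c =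
    -- 8n` with `(y, y) = 2n`, and `c ≥ -2` leaves only `n = 0` (`γ r = r`) and `n = 1` (`γ r =
    -- -r`).
    obtain ⟨y, hy, hxy⟩ := glueClass_eq_zero.1 h1
    change γ.1 (slotRoot p) - slotRoot p = _ at hxy
    have hnr : inner ℝ (slotRoot p) (slotRoot p) = (2 : ℝ) := by
      rw [inner_slotRoot, slotGram, if_pos rfl]
      have : cartanE8 p.2 p.2 = 2 := by
        generalize p.2 = k
        revert k; decide
      rw [this]; norm_num
    obtain ⟨n, hn⟩ := tripleE8_even hy
    have hng : inner ℝ (γ.1 (slotRoot p)) (γ.1 (slotRoot p)) = (2 : ℝ) := by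
      rw [γ.1.inner_map_map, hnr]
    generalize hc : inner ℝ (γ.1 (slotRoot p)) (slotRoot p) = c
    have h2 : 4 - 2 * c = 8 * (n : ℝ) := by
      have h3 := congrArg (fun v : TripleSpace => inner ℝ v v) hxy
      simp only [inner_sub_left, inner_sub_right, real_inner_smul_left, real_inner_smul_right, hnr,
        hng, hc, hn] at h3
      rw [real_inner_comm, hc] at h3
      linarith
    have h3 : (0 : ℝ) ≤ inner ℝ (γ.1 (slotRoot p) + slotRoot p) (γ.1 (slotRoot p) + slotRoot p) :=
      real_inner_self_nonneg
    rw [inner_add_left, inner_add_right, inner_add_right, hnr, hng, hc, real_inner_comm, hc] at h3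
    have h4 : (0 : ℝ) ≤ inner ℝ y y := real_inner_self_nonneg
    rw [hn] at h4
    have h5 : 0 ≤ n := by
      have : (0 : ℝ) ≤ n := by linarith
      exact_mod_cast this
    have h6 : n ≤ 1 := by
      have : (n : ℝ) ≤ 1 := by linarith
      exact_mod_cast this
    have h7 : n = 0 ∨ n = 1 := by omega
    rcases h7 with rfl | rfl
    · refine ⟨1, rfl, ?_⟩
      have : y = 0 := by rw [← inner_self_eq_zero (𝕜 := ℝ), hn]; simp
      rw [this, smul_zero, sub_eq_zero] at hxy
      rw [hxy]; simp
    · refine ⟨-1, rfl, ?_⟩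
      have : γ.1 (slotRoot p) + slotRoot p = 0 := by
        rw [← inner_self_eq_zero (𝕜 := ℝ), inner_add_left, inner_add_right, inner_add_right, hnr,
          hng, hc, real_inner_comm, hc]
        push_cast at h2
        linarith
      rw [eq_neg_of_add_eq_zero_left this]
      simp
  choose ε hε hγ using hpm
  -- Adjacent simple roots have nonzero inner product, so their signs agree; connectedness of each
  -- diagram does the rest.
  have hpar : ∀ i k, ε (i, k) = ε (i, 0) := by
    intro i k
    induction k using WellFoundedLT.induction with
    | ind k ih =>
      by_cases hk : k = 0
      · rw [hk]
      rw [← ih _ (dynkinParent_lt hk)]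
      have h1 := γ.1.inner_map_map (slotRoot (i, dynkinParent k)) (slotRoot (i, k))
      rw [hγ, hγ, real_inner_smul_left, real_inner_smul_right, inner_slotRoot, slotGram, if_pos rfl,
        cartanE8_dynkinParent hk] at h1
      have h2 : ε (i, dynkinParent k) * ε (i, k) = 1 := by
        have : (ε (i, dynkinParent k) : ℝ) * ε (i, k) = 1 := by push_cast at h1; linarith
        exact_mod_cast this
      have h3 := hε (i, dynkinParent k)
      have h4 : ε (i, dynkinParent k) ≠ 0 := by
        intro h0; rw [h0] at h3; simp at h3
      exact mul_left_cancel₀ h4 (h2.trans h3.symm)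
  refine ⟨fun i => ε (i, 0), fun i => hε _, fun x i => ?_⟩
  conv_lhs => rw [eq_sum_slotRoot x]
  conv_rhs => rw [eq_sum_slotRoot x]
  rw [map_sum, WithLp.ofLp_sum, WithLp.ofLp_sum, Finset.sum_apply, Finset.sum_apply,
    Finset.smul_sum]
  refine Finset.sum_congr rfl fun p _ => ?_
  rw [map_smul, hγ, smul_comm]
  simp only [PiLp.smul_apply]
  by_cases hp : i = p.1
  · rw [show p = (p.1, p.2) from rfl, hpar, hp]
  · rw [slotRoot, PiLp.single_eq_of_ne _ hp]
    simp

end LiftingIsometries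

/-! ### Lattice properties of `𝔏(S)` read off from `S`. -/

section GlueLattices

open QuadraticMap Module

variable {S : Submodule (ZMod 2) (Fin 3 → DiscGroup sqrtTwoE8)}

theorem inner_sqrt_two_smul (v w : TripleSpace) :
    inner ℝ (Real.sqrt 2 • v) (Real.sqrt 2 • w) = 2 * inner ℝ v w := by
  rw [real_inner_smul_left, real_inner_smul_right, ← mul_assoc, Real.mul_self_sqrt (by norm_num)]

theorem sqrt_two_smul_inv_smul (x : TripleSpace) : Real.sqrt 2 • (Real.sqrt 2)⁻¹ • x = x := by
  rw [smul_smul, mul_inv_cancel₀ (by positivity), one_smul]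

theorem inv_smul_sqrt_two_smul (x : TripleSpace) : (Real.sqrt 2)⁻¹ • Real.sqrt 2 • x = x := by
  rw [smul_smul, inv_mul_cancel₀ (by positivity), one_smul]

/-- Scaling by `√2` turns the dual lattice into `E₈³`, so membership becomes a condition on a class
of `E₈³/2E₈³`. -/
theorem mem_latticeOf_iff {v : TripleSpace} : v ∈ latticeOf sqrtTwoE8 S ↔
    ∃ h : Real.sqrt 2 • v ∈ tripleE8, glueClass ⟨_, h⟩ ∈ S := by
  have key : ∀ (hv : v ∈ powLattice (dualLattice sqrtTwoE8) 3) (h : Real.sqrt 2 • v ∈ tripleE8),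
      discMapPow sqrtTwoE8 3 ⟨v, hv⟩ = glueClass ⟨_, h⟩ := by
    intro hv h
    funext i
    rw [glueClass_apply, e8Class_mk]
    change discMap sqrtTwoE8 ⟨v i, hv i⟩ = _
    congr 2
    change v i = (Real.sqrt 2)⁻¹ • Real.sqrt 2 • v i
    rw [smul_smul, inv_mul_cancel₀ (by positivity), one_smul]
  constructor
  · rintro ⟨⟨w, hw⟩, hwS, rfl⟩
    have h : Real.sqrt 2 • w ∈ tripleE8 := fun i => mem_dual_sqrtTwoE8_iff.1 (hw i)
    refine ⟨h, ?_⟩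
    have hwS' : discMapPow sqrtTwoE8 3 ⟨w, hw⟩ ∈ S := hwS
    have e := key hw h
    change discMapPow sqrtTwoE8 3 ⟨w, hw⟩ = _ at e
    rw [e] at hwS'
    exact hwS'
  · rintro ⟨h, hS⟩
    have hv : v ∈ powLattice (dualLattice sqrtTwoE8) 3 := fun i => mem_dual_sqrtTwoE8_iff.2 (h i)
    refine ⟨⟨v, hv⟩, ?_, rfl⟩
    change discMapPow sqrtTwoE8 3 ⟨v, hv⟩ ∈ S
    rw [key hv h]
    exact hS

theorem mem_powLattice_sqrtTwoE8_iff {v : TripleSpace} :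
    v ∈ powLattice sqrtTwoE8 3 ↔ (Real.sqrt 2)⁻¹ • v ∈ tripleE8 := by
  refine forall_congr' fun i => ?_
  change v i ∈ sqrtTwoE8 ↔ (Real.sqrt 2)⁻¹ • v i ∈ latticeE8
  rw [sqrtTwoE8, Submodule.mem_smul_pointwise_iff_exists]
  constructor
  · rintro ⟨y, hy, h⟩
    rw [← h, smul_smul, inv_mul_cancel₀ (by positivity), one_smul]
    exact hy
  · intro h
    refine ⟨_, h, ?_⟩
    rw [smul_smul, mul_inv_cancel₀ (by positivity), one_smul]

theorem sqrt_two_smul_mem_powLattice {x : TripleSpace} (hx : x ∈ tripleE8) :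
    Real.sqrt 2 • x ∈ powLattice sqrtTwoE8 3 := by
  rwa [mem_powLattice_sqrtTwoE8_iff, inv_smul_sqrt_two_smul]

theorem powLattice_le_latticeOf : powLattice sqrtTwoE8 3 ≤ latticeOf sqrtTwoE8 S := by
  intro v hv
  have e : Real.sqrt 2 • v = (2 : ℝ) • (Real.sqrt 2)⁻¹ • v := by
    conv_lhs => rw [← sqrt_two_smul_inv_smul v]
    rw [smul_smul, Real.mul_self_sqrt (by norm_num)]
  rw [mem_powLattice_sqrtTwoE8_iff] at hv
  have h : Real.sqrt 2 • v ∈ tripleE8 := by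
    rw [e, two_smul]; exact add_mem hv hv
  rw [mem_latticeOf_iff]
  refine ⟨h, ?_⟩
  rw [glueClass_eq_zero.2 ⟨_, hv, e⟩]
  exact zero_mem _

theorem latticeAut_powLattice : latticeAut (powLattice sqrtTwoE8 3) = latticeAut tripleE8 := by
  ext γ
  constructor
  · intro h x
    have := h (Real.sqrt 2 • x)
    rwa [map_smul, mem_powLattice_sqrtTwoE8_iff, mem_powLattice_sqrtTwoE8_iff,
      inv_smul_sqrt_two_smul, inv_smul_sqrt_two_smul] at this
  · intro h v
    rw [mem_powLattice_sqrtTwoE8_iff, mem_powLattice_sqrtTwoE8_iff, ← map_smul]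
    exact h _

/-- `γ` maps `𝔏(S)` onto `𝔏(T)` if the induced map sends `S` onto `T`. -/
theorem map_mem_latticeOf_iff {T : Submodule (ZMod 2) (Fin 3 → DiscGroup sqrtTwoE8)}
    (γ : latticeAut tripleE8) (h : ∀ a, inducedAut γ a ∈ T ↔ a ∈ S) (v : TripleSpace) :
    γ.1 v ∈ latticeOf sqrtTwoE8 T ↔ v ∈ latticeOf sqrtTwoE8 S := by
  rw [mem_latticeOf_iff, mem_latticeOf_iff]
  have hm : Real.sqrt 2 • γ.1 v ∈ tripleE8 ↔ Real.sqrt 2 • v ∈ tripleE8 := by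
    rw [← map_smul]; exact γ.2 _
  have key : ∀ h1 h2, glueClass ⟨Real.sqrt 2 • γ.1 v, h1⟩ ∈ T ↔
      glueClass ⟨Real.sqrt 2 • v, h2⟩ ∈ S := by
    intro h1 h2
    rw [← h, inducedAut_glueClass]
    have : latticeAutMap γ ⟨Real.sqrt 2 • v, h2⟩ = ⟨Real.sqrt 2 • γ.1 v, h1⟩ :=
      Subtype.ext (map_smul γ.1 _ _)
    rw [this]
  exact ⟨fun ⟨h1, h2⟩ => ⟨hm.1 h1, (key _ _).1 h2⟩, fun ⟨h1, h2⟩ => ⟨hm.2 h1, (key _ _).2 h2⟩⟩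

theorem mem_latticeAut_latticeOf_iff (γ : latticeAut tripleE8) :
    γ.1 ∈ latticeAut (latticeOf sqrtTwoE8 S) ↔ inducedAut γ ∈ subspaceStabilizer S := by
  refine ⟨fun h a => ?_, fun h => map_mem_latticeOf_iff γ h⟩
  obtain ⟨x, rfl⟩ := glueClass_surjective a
  have h1 : ∀ y : tripleE8, glueClass y ∈ S ↔ (Real.sqrt 2)⁻¹ • y.1 ∈ latticeOf sqrtTwoE8 S := by
    intro y
    rw [mem_latticeOf_iff]
    have e : ∀ h, (⟨Real.sqrt 2 • (Real.sqrt 2)⁻¹ • y.1, h⟩ : tripleE8) = y := fun h =>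
      Subtype.ext (sqrt_two_smul_inv_smul _)
    refine ⟨fun hy => ⟨by rw [sqrt_two_smul_inv_smul]; exact y.2, by rwa [e]⟩, ?_⟩
    rintro ⟨h2, h3⟩
    rwa [e] at h3
  rw [inducedAut_glueClass, h1, h1]
  have := h ((Real.sqrt 2)⁻¹ • x.1)
  rwa [map_smul] at this

/-- `(v, v)` is half the norm of `√2 v`, whose parity is the value of the quadratic form. -/
theorem latticeOf_even (hS : IsTotallySingular (quadPow discQuad 3) S) {v : TripleSpace}
    (hv : v ∈ latticeOf sqrtTwoE8 S) : ∃ n : ℤ, inner ℝ v v = 2 * (n : ℝ) := by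
  obtain ⟨h, hc⟩ := mem_latticeOf_iff.1 hv
  obtain ⟨k, hk⟩ := tripleE8_even h
  have h1 := quadPow_glueClass (x := ⟨_, h⟩) hk
  rw [hS _ hc, eq_comm, intCast_zmod_two_eq_zero_iff] at h1
  obtain ⟨n, rfl⟩ := h1
  rw [inner_sqrt_two_smul] at hk
  refine ⟨n, ?_⟩
  push_cast at hk
  linarith

theorem latticeOf_integral (hS : IsTotallySingular (quadPow discQuad 3) S) {v w : TripleSpace}
    (hv : v ∈ latticeOf sqrtTwoE8 S) (hw : w ∈ latticeOf sqrtTwoE8 S) :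
    ∃ n : ℤ, inner ℝ v w = (n : ℝ) := by
  obtain ⟨a, ha⟩ := latticeOf_even hS hv
  obtain ⟨b, hb⟩ := latticeOf_even hS hw
  obtain ⟨c, hc⟩ := latticeOf_even hS (add_mem hv hw)
  refine ⟨c - a - b, ?_⟩
  rw [inner_add_left, inner_add_right, inner_add_right, real_inner_comm v w] at hc
  push_cast
  linarith

/-- A nonzero class of `√2 v` has weight at least 4, hence norm at least 8. If the class is zero,
then `√2 v = 2y` and `(v, v) = 2 (y, y) ≥ 4`. -/
theorem four_le_inner_self_of_mem_latticeOf (hw : ∀ v ∈ S, v ≠ 0 → 4 ≤ wtPow discQuad 3 v)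
    {v : TripleSpace} (hv : v ∈ latticeOf sqrtTwoE8 S) (hv0 : v ≠ 0) : (4 : ℝ) ≤ inner ℝ v v := by
  obtain ⟨h, hc⟩ := mem_latticeOf_iff.1 hv
  have e := inner_sqrt_two_smul v v
  by_cases h0 : glueClass ⟨_, h⟩ = 0
  · obtain ⟨y, hy, hxy⟩ := glueClass_eq_zero.1 h0
    obtain ⟨n, hn⟩ := tripleE8_even hy
    have hxy : Real.sqrt 2 • v = (2 : ℝ) • y := hxy
    rw [hxy, real_inner_smul_left, real_inner_smul_right, hn] at e
    have h1 : (0 : ℝ) < inner ℝ v v := real_inner_self_pos.2 hv0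
    have h2 : 1 ≤ n := by
      have : (0 : ℝ) < n := by linarith
      exact_mod_cast this
    have h3 : (1 : ℝ) ≤ n := by exact_mod_cast h2
    linarith
  · have h1 := wtPow_glueClass_le ⟨_, h⟩
    have h2 : (4 : ℝ) ≤ wtPow discQuad 3 (glueClass ⟨_, h⟩) := by exact_mod_cast hw _ hc h0
    change _ ≤ inner ℝ (Real.sqrt 2 • v) (Real.sqrt 2 • v) at h1
    linarith

theorem sqrt_two_smul_mem_tripleE8 {v : TripleSpace}
    (h : ∀ w ∈ powLattice sqrtTwoE8 3, ∃ n : ℤ, inner ℝ v w = (n : ℝ)) :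
    Real.sqrt 2 • v ∈ tripleE8 := by
  refine mem_tripleE8_of_dual fun y hy => ?_
  obtain ⟨n, hn⟩ := h _ (sqrt_two_smul_mem_powLattice hy)
  refine ⟨n, ?_⟩
  rw [real_inner_smul_left, ← real_inner_smul_right, hn]

/-- Integral pairing with `L³` places `√2 v` in `E₈³`; integral pairing with all of `𝔏(S)` makes its
class orthogonal to `S`. -/
theorem mem_latticeOf_of_dual
    (hS : LinearMap.BilinForm.orthogonal (polarBilin (quadPow discQuad 3)) S ≤ S) {v : TripleSpace}
    (h : ∀ w ∈ latticeOf sqrtTwoE8 S, ∃ n : ℤ, inner ℝ v w = (n : ℝ)) :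
    v ∈ latticeOf sqrtTwoE8 S := by
  have hv : Real.sqrt 2 • v ∈ tripleE8 :=
    sqrt_two_smul_mem_tripleE8 fun w hw => h w (powLattice_le_latticeOf hw)
  rw [mem_latticeOf_iff]
  refine ⟨hv, hS fun a ha => ?_⟩
  obtain ⟨x, rfl⟩ := glueClass_surjective a
  have hx : (Real.sqrt 2)⁻¹ • x.1 ∈ latticeOf sqrtTwoE8 S := by
    have e : ∀ h, (⟨Real.sqrt 2 • (Real.sqrt 2)⁻¹ • x.1, h⟩ : tripleE8) = x := fun h =>
      Subtype.ext (sqrt_two_smul_inv_smul _)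
    exact mem_latticeOf_iff.2 ⟨by rw [sqrt_two_smul_inv_smul]; exact x.2, by rwa [e]⟩
  obtain ⟨n, hn⟩ := h _ hx
  change polar (quadPow discQuad 3) _ _ = 0
  rw [polar_comm, polar_glueClass (n := 2 * n), intCast_zmod_two_eq_zero_iff]
  · exact even_two_mul n
  · change inner ℝ (Real.sqrt 2 • v) x.1 = _
    conv_lhs => rw [← sqrt_two_smul_inv_smul x.1]
    rw [inner_sqrt_two_smul, hn]
    push_cast
    ring

end GlueLattices

/-! ### Transitivity on the sublattices isomorphic to `L³`. -/

section Frames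

open QuadraticMap Module

variable {S : Submodule (ZMod 2) (Fin 3 → DiscGroup sqrtTwoE8)}

/-- A lattice isomorphic to `L³` is the image of `L³` under an isometry. -/
theorem exists_isometry_of_latticeIsomorphic {J : Submodule ℤ TripleSpace}
    (hJ : LatticeIsomorphic J (powLattice sqrtTwoE8 3)) :
    ∃ h : TripleSpace ≃ₗᵢ[ℝ] TripleSpace, ∀ v, h v ∈ J ↔ v ∈ powLattice sqrtTwoE8 3 := by
  obtain ⟨f, hf⟩ := hJ
  let A : tripleE8 →ₗ[ℤ] TripleSpace :=
    { toFun := fun x => (f.symm ⟨Real.sqrt 2 • x.1, sqrt_two_smul_mem_powLattice x.2⟩ : J).1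
      map_add' := fun x y => by
        rw [← Submodule.coe_add, ← map_add]
        congr 2
        exact Subtype.ext (smul_add _ _ _)
      map_smul' := fun c x => by
        rw [RingHom.id_apply, ← Submodule.coe_smul, ← map_smul]
        congr 2
        exact Subtype.ext (smul_comm _ _ _) }
  have hA : ∀ x y : tripleE8, inner ℝ (A x) (A y) = 2 * inner ℝ x.1 y.1 := by
    intro x y
    have e := hf (f.symm ⟨Real.sqrt 2 • x.1, sqrt_two_smul_mem_powLattice x.2⟩)
      (f.symm ⟨Real.sqrt 2 • y.1, sqrt_two_smul_mem_powLattice y.2⟩)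
    rw [f.apply_symm_apply, f.apply_symm_apply] at e
    rw [← inner_sqrt_two_smul]
    exact e.symm
  -- `A` doubles inner products, so the images of the simple roots divided by `√2` have the Gram
  -- matrix of the simple roots.
  obtain ⟨h, hh⟩ := exists_isometry_of_gram
    (fun p => (Real.sqrt 2)⁻¹ • A ⟨slotRoot p, slotRoot_mem p⟩) (fun p q => by
      have e := inner_sqrt_two_smul ((Real.sqrt 2)⁻¹ • A ⟨slotRoot p, slotRoot_mem p⟩)
        ((Real.sqrt 2)⁻¹ • A ⟨slotRoot q, slotRoot_mem q⟩)
      rw [sqrt_two_smul_inv_smul, sqrt_two_smul_inv_smul, hA, inner_slotRoot] at e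
      linarith)
  let B : tripleE8 →ₗ[ℤ] TripleSpace :=
    { toFun := fun x => Real.sqrt 2 • h x.1
      map_add' := fun x y => by rw [Submodule.coe_add, map_add, smul_add]
      map_smul' := fun c x => by
        rw [Submodule.coe_smul, map_zsmul, smul_comm]; rfl }
  have hAB : ∀ x, A x = B x := by
    have h1 : Submodule.span ℤ (Set.range slotRoot) ≤ (LinearMap.eqLocus A B).map tripleE8.subtype := by
      rw [Submodule.span_le]
      rintro _ ⟨p, rfl⟩
      refine ⟨⟨_, slotRoot_mem p⟩, ?_, rfl⟩
      change A _ = Real.sqrt 2 • h (slotRoot p)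
      rw [hh, sqrt_two_smul_inv_smul]
    intro x
    obtain ⟨y, hy, hyx⟩ := h1 (tripleE8_eq_span.le x.2)
    obtain rfl : y = x := Subtype.ext hyx
    exact hy
  have hfs : ∀ (v : TripleSpace) (hv : v ∈ powLattice sqrtTwoE8 3), h v = (f.symm ⟨v, hv⟩ : J).1 := by
    intro v hv
    have h1 := hAB ⟨_, mem_powLattice_sqrtTwoE8_iff.1 hv⟩
    change (f.symm ⟨Real.sqrt 2 • (Real.sqrt 2)⁻¹ • v, _⟩ : J).1 =
      Real.sqrt 2 • h ((Real.sqrt 2)⁻¹ • v) at h1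
    have h2 : Real.sqrt 2 • h ((Real.sqrt 2)⁻¹ • v) = h v := by
      rw [← map_smul, sqrt_two_smul_inv_smul]
    rw [← h2, ← h1]
    congr 2
    exact Subtype.ext (sqrt_two_smul_inv_smul v)
  refine ⟨h, fun v => ⟨fun hv => ?_, fun hv => ?_⟩⟩
  · have h1 := hfs _ (f ⟨h v, hv⟩).2
    have h2 : f.symm ⟨(f ⟨h v, hv⟩).1, (f ⟨h v, hv⟩).2⟩ = ⟨h v, hv⟩ := f.symm_apply_apply _
    rw [h2] at h1
    rw [← h.injective h1]
    exact (f ⟨h v, hv⟩).2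
  · rw [hfs v hv]
    exact Subtype.prop _

/-- Self-orthogonal totally singular subspaces of minimal weight at least four are conjugate
under isometries of `L³`. -/
theorem exists_inducedAut_mem_iff {T : Submodule (ZMod 2) (Fin 3 → DiscGroup sqrtTwoE8)}
    (hS : IsTotallySingular (quadPow discQuad 3) S)
    (hS' : LinearMap.BilinForm.orthogonal (polarBilin (quadPow discQuad 3)) S ≤ S)
    (hSw : ∀ v ∈ S, v ≠ 0 → 4 ≤ wtPow discQuad 3 v)
    (hT : IsTotallySingular (quadPow discQuad 3) T)
    (hT' : LinearMap.BilinForm.orthogonal (polarBilin (quadPow discQuad 3)) T ≤ T)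
    (hTw : ∀ v ∈ T, v ≠ 0 → 4 ≤ wtPow discQuad 3 v) :
    ∃ γ : latticeAut tripleE8, ∀ a, inducedAut γ a ∈ T ↔ a ∈ S := by
  obtain ⟨ι, hι, hιS⟩ := exists_glue_frames discQuad_nondegenerate finrank_discGroup S hS hS' hSw
  obtain ⟨κ, hκ, hκT⟩ := exists_glue_frames discQuad_nondegenerate finrank_discGroup T hT hT' hTw
  -- Passing slotwise from the frames of `S` to those of `T` preserves the form, hence the weight,
  -- and matches the two copies of the glue code.
  let g : (Fin 3 → DiscGroup sqrtTwoE8) ≃ₗ[ZMod 2] (Fin 3 → DiscGroup sqrtTwoE8) :=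
    LinearEquiv.piCongrRight fun i => (ι i).symm.trans (κ i)
  have hg : g ∈ autWt discQuad 3 := by
    intro v
    refine Finset.sum_congr rfl fun i _ => wt_eq_wt ?_ ?_
    · exact LinearEquiv.map_eq_zero_iff ((ι i).symm.trans (κ i))
    · change discQuad (κ i ((ι i).symm (v i))) = _
      rw [hκ, ← hι i, LinearEquiv.apply_symm_apply]
  obtain ⟨γ, hγ⟩ := exists_isometry_of_mem_autWt hg
  refine ⟨γ, fun a => ?_⟩
  have h1 := hκT fun i => (ι i).symm (a i)
  have h2 := hιS fun i => (ι i).symm (a i)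
  simp only [LinearEquiv.apply_symm_apply] at h2
  rw [hγ]
  exact h1.trans h2.symm

/-- The automorphism group of `𝔏(S)` moves `L³` to every sublattice isomorphic to it. -/
theorem exists_mem_latticeAut_of_latticeIsomorphic
    (hS : IsTotallySingular (quadPow discQuad 3) S)
    (hS' : LinearMap.BilinForm.orthogonal (polarBilin (quadPow discQuad 3)) S ≤ S)
    (hSw : ∀ v ∈ S, v ≠ 0 → 4 ≤ wtPow discQuad 3 v) {J : Submodule ℤ TripleSpace}
    (hJS : J ≤ latticeOf sqrtTwoE8 S) (hJ : LatticeIsomorphic J (powLattice sqrtTwoE8 3)) :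
    ∃ g ∈ latticeAut (latticeOf sqrtTwoE8 S), ∀ v, g v ∈ J ↔ v ∈ powLattice sqrtTwoE8 3 := by
  obtain ⟨h, hh⟩ := exists_isometry_of_latticeIsomorphic hJ
  -- `X` is the rescaled intersection of `h⁻¹(𝔏(S))` with the dual of `L³`, and `T` is its image in
  -- `R(L)³`. Membership in `T` does not depend on the representative because `h` maps `L³` to `J ≤
  -- 𝔏(S)`.
  let X : Submodule ℤ tripleE8 :=
    { carrier := {x | h ((Real.sqrt 2)⁻¹ • x.1) ∈ latticeOf sqrtTwoE8 S}
      add_mem' := fun {x y} hx hy => by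
        rw [Set.mem_ofPred_eq, Submodule.coe_add, smul_add, map_add]
        exact add_mem hx hy
      zero_mem' := by
        rw [Set.mem_ofPred_eq, Submodule.coe_zero, smul_zero, map_zero]
        exact zero_mem _
      smul_mem' := fun c x hx => by
        rw [Set.mem_ofPred_eq, Submodule.coe_smul, smul_comm, map_zsmul]
        exact Submodule.smul_mem _ _ hx }
  let T : Submodule (ZMod 2) (Fin 3 → DiscGroup sqrtTwoE8) :=
    AddSubgroup.toZModSubmodule 2 (X.map glueClass).toAddSubgroup
  have hTX : ∀ x, glueClass x ∈ T ↔ h ((Real.sqrt 2)⁻¹ • x.1) ∈ latticeOf sqrtTwoE8 S := by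
    intro x
    refine ⟨?_, fun hx => ⟨x, hx, rfl⟩⟩
    rintro ⟨y, hy, hyx⟩
    have h0 : glueClass (x - y) = 0 := by rw [map_sub, ← hyx, sub_self]
    obtain ⟨z, hz, hxz⟩ := glueClass_eq_zero.1 h0
    have h1 : x.1 = y.1 + (2 : ℝ) • z := by
      rw [← hxz]; simp
    have h2 : (Real.sqrt 2)⁻¹ • (2 : ℝ) • z = Real.sqrt 2 • z := by
      conv_rhs => rw [← inv_smul_sqrt_two_smul (Real.sqrt 2 • z), smul_smul (Real.sqrt 2),
        Real.mul_self_sqrt (by norm_num)]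
    rw [h1, smul_add, map_add, h2]
    exact add_mem hy (hJS ((hh _).2 (sqrt_two_smul_mem_powLattice hz)))
  have hTv : ∀ v, h v ∈ latticeOf sqrtTwoE8 S ↔ v ∈ latticeOf sqrtTwoE8 T := by
    intro v
    constructor
    · intro hv
      have h1 : Real.sqrt 2 • v ∈ tripleE8 := sqrt_two_smul_mem_tripleE8 fun w hw => by
        rw [← h.inner_map_map]
        exact latticeOf_integral hS hv (hJS ((hh _).2 hw))
      refine mem_latticeOf_iff.2 ⟨h1, ?_⟩
      rw [hTX]
      rwa [inv_smul_sqrt_two_smul]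
    · intro hv
      obtain ⟨h1, h2⟩ := mem_latticeOf_iff.1 hv
      rwa [hTX, inv_smul_sqrt_two_smul] at h2
  have hinner : ∀ x y : TripleSpace,
      inner ℝ x y = 2 * inner ℝ (h ((Real.sqrt 2)⁻¹ • x)) (h ((Real.sqrt 2)⁻¹ • y)) := by
    intro x y
    rw [h.inner_map_map, ← inner_sqrt_two_smul, sqrt_two_smul_inv_smul, sqrt_two_smul_inv_smul]
  -- The properties of `T` come from those of the isometric lattice `𝔏(S)`: evenness gives total
  -- singularity, minimal norm 4 gives minimal weight 4, and containing the dual gives containment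
  -- of the orthogonal space.
  have hT : IsTotallySingular (quadPow discQuad 3) T := by
    intro a ha
    obtain ⟨x, rfl⟩ := glueClass_surjective a
    obtain ⟨n, hn⟩ := latticeOf_even hS ((hTX x).1 ha)
    rw [quadPow_glueClass (n := 2 * n), intCast_zmod_two_eq_zero_iff]
    · exact even_two_mul n
    · rw [hinner, hn]; push_cast; ring
  have hTw : ∀ v ∈ T, v ≠ 0 → 4 ≤ wtPow discQuad 3 v := by
    intro a ha ha0
    obtain ⟨x, rfl, hx⟩ := exists_short_glueClass a
    have hx0 : h ((Real.sqrt 2)⁻¹ • x.1) ≠ 0 := by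
      intro h0
      rw [LinearIsometryEquiv.map_eq_zero_iff, smul_eq_zero_iff_right (by positivity)] at h0
      exact ha0 (by rw [show x = 0 from Subtype.ext h0, map_zero])
    have h1 := four_le_inner_self_of_mem_latticeOf hSw ((hTX x).1 ha) hx0
    rw [hinner] at hx
    have h2 : (4 : ℝ) ≤ wtPow discQuad 3 (glueClass x) := by linarith
    exact_mod_cast h2
  have hT' : LinearMap.BilinForm.orthogonal (polarBilin (quadPow discQuad 3)) T ≤ T := by
    intro a ha
    obtain ⟨x, rfl⟩ := glueClass_surjective a
    rw [hTX]
    refine mem_latticeOf_of_dual hS' fun w hw => ?_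
    obtain ⟨w, rfl⟩ := h.surjective w
    obtain ⟨h1, h2⟩ := mem_latticeOf_iff.1 ((hTv w).1 hw)
    obtain ⟨n, hn⟩ := tripleE8_integral x.2 h1
    have h3 : polar (quadPow discQuad 3) (glueClass ⟨_, h1⟩) (glueClass x) = 0 := ha _ h2
    rw [polar_comm, polar_glueClass (y := ⟨_, h1⟩) hn, intCast_zmod_two_eq_zero_iff] at h3
    obtain ⟨m, rfl⟩ := h3
    refine ⟨m, ?_⟩
    rw [hinner, inv_smul_sqrt_two_smul] at hn
    push_cast at hn
    linarith
  obtain ⟨γ, hγ⟩ := exists_inducedAut_mem_iff hS hS' hSw hT hT' hTw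
  -- `γ` carries `𝔏(S)` to `𝔏(T)` and preserves `L³`; `h` then carries `𝔏(T)` back to `𝔏(S)` and
  -- `L³` to `J`.
  refine ⟨h * γ.1, fun v => ?_, fun v => ?_⟩
  · change h (γ.1 v) ∈ _ ↔ _
    rw [hTv, map_mem_latticeOf_iff γ hγ]
  · change h (γ.1 v) ∈ _ ↔ _
    rw [hh]
    have : γ.1 ∈ latticeAut (powLattice sqrtTwoE8 3) := by
      rw [latticeAut_powLattice]; exact γ.2
    exact this v

end Frames

/-! ### The group `2³` of sign changes. -/

section SignChanges

/-- The isometry `± 1`, the sign given by an element of `𝔽₂`. -/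
def signIsometry (z : ZMod 2) : E8Space ≃ₗᵢ[ℝ] E8Space :=
  if z = 0 then 1 else LinearIsometryEquiv.neg ℝ

theorem signIsometry_add (a b : ZMod 2) (x : E8Space) :
    signIsometry (a + b) x = signIsometry a (signIsometry b x) := by
  rcases zmod_two_eq a with rfl | rfl <;> rcases zmod_two_eq b with rfl | rfl <;>
    simp [signIsometry, CharTwo.add_self_eq_zero]

/-- Sign changes on the three summands. -/
def signChange : Multiplicative (Fin 3 → ZMod 2) →* (TripleSpace ≃ₗᵢ[ℝ] TripleSpace) :=
  MonoidHom.mk' (fun x => LinearIsometryEquiv.piLpCongrRight 2 fun i => signIsometry (x.toAdd i))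
    fun x y => by
      ext v i : 3
      exact congrArg (fun w : E8Space => w _) (signIsometry_add (x.toAdd i) (y.toAdd i) (v i))

theorem signChange_apply (x : Multiplicative (Fin 3 → ZMod 2)) (v : TripleSpace) (i : Fin 3) :
    signChange x v i = signIsometry (x.toAdd i) (v i) := rfl

end SignChanges

/-! ### Sign changes as the kernel of the action. -/

section SignKernel

open QuadraticMap Module

theorem signIsometry_eq (z : ZMod 2) : ∃ ε : ℤ, ε * ε = 1 ∧ ∀ x, signIsometry z x = ε • x := by
  rcases zmod_two_eq z with rfl | rfl
  · exact ⟨1, rfl, fun x => by simp [signIsometry]⟩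
  · exact ⟨-1, rfl, fun x => by simp [signIsometry]⟩

theorem signChange_injective : Function.Injective signChange := by
  intro x y h
  have key : ∀ a b : ZMod 2, (∀ v, signIsometry a v = signIsometry b v) → a = b := by
    intro a b hab
    have h1 := hab (EuclideanSpace.single 0 1)
    have h2 := congrArg (fun v : E8Space => v 0) h1
    rcases zmod_two_eq a with rfl | rfl <;> rcases zmod_two_eq b with rfl | rfl <;>
      simp [signIsometry] at h2 ⊢ <;> norm_num at h2
  refine Multiplicative.toAdd.injective (funext fun i => key _ _ fun v => ?_)
  have h1 := congrArg (fun w : TripleSpace => w i)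
    (DFunLike.congr_fun h (WithLp.toLp 2 fun _ => v : TripleSpace))
  exact h1

theorem signChange_mem_latticeAut (x : Multiplicative (Fin 3 → ZMod 2)) :
    signChange x ∈ latticeAut tripleE8 := by
  refine fun v => forall_congr' fun i => ?_
  rw [signChange_apply]
  obtain ⟨ε, hε, h⟩ := signIsometry_eq (x.toAdd i)
  rw [h]
  refine ⟨fun hv => ?_, fun hv => Submodule.smul_mem _ _ hv⟩
  have := Submodule.smul_mem _ ε hv
  rwa [smul_smul, hε, one_smul] at this

theorem inducedAut_signChange (x : Multiplicative (Fin 3 → ZMod 2)) :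
    inducedAut ⟨signChange x, signChange_mem_latticeAut x⟩ = 1 := by
  ext1 a
  obtain ⟨y, rfl⟩ := glueClass_surjective a
  rw [inducedAut_glueClass]
  refine funext fun i => ?_
  obtain ⟨ε, hε, h⟩ := signIsometry_eq (x.toAdd i)
  have e : e8Class ⟨_, (latticeAutMap ⟨signChange x, signChange_mem_latticeAut x⟩ y).2 i⟩ =
    e8Class (ε • ⟨y.1 i, y.2 i⟩) := congrArg e8Class (Subtype.ext (h _))
  refine e.trans ?_
  rw [map_smul]
  exact congrFun (sign_smul_eq hε fun _ => e8Class ⟨y.1 i, y.2 i⟩) i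

theorem exists_eq_signChange {γ : latticeAut tripleE8} (h : inducedAut γ = 1) :
    ∃ x, signChange x = γ.1 := by
  obtain ⟨ε, hε, hγ⟩ := exists_signs_of_inducedAut_eq_one h
  refine ⟨Multiplicative.ofAdd fun i => if ε i = 1 then 0 else 1, ?_⟩
  ext1 v
  refine PiLp.ext fun i => ?_
  rw [signChange_apply, hγ, toAdd_ofAdd]
  rcases mul_self_eq_one_iff.1 (hε i) with h1 | h1 <;> simp [h1, signIsometry]

end SignKernel

/-! ### The extension by sign changes. -/

section Stabilizer

/-- An extension of stabilizers obtained from a homomorphism with known kernel. -/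
theorem nonempty_groupExtension_subgroupOf {N G G' : Type*} [Group N] [Group G] [Group G']
    {K H : Subgroup G} {K' H' : Subgroup G'} (i : N →* G) (hi : Function.Injective i)
    (hiH : ∀ n, i n ∈ H) (φ : H →* G') (hφ : ∀ a, φ a ∈ K') (hφK : ∀ a : H, a.1 ∈ K ↔ φ a ∈ H')
    (hsurj : ∀ g ∈ K', ∃ a, φ a = g) (hiφ : ∀ n, φ ⟨i n, hiH n⟩ = 1)
    (hker : ∀ a, φ a = 1 → ∃ n, i n = a.1) :
    Nonempty (GroupExtension N (H.subgroupOf K) (H'.subgroupOf K')) := by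
  have hiK : ∀ n, i n ∈ K := fun n => (hφK ⟨i n, hiH n⟩).2 (by rw [hiφ]; exact one_mem _)
  let inl : N →* H.subgroupOf K :=
    { toFun := fun n => ⟨⟨i n, hiK n⟩, hiH n⟩
      map_one' := by ext; simp
      map_mul' := fun a b => by ext; simp }
  let r : H.subgroupOf K →* H'.subgroupOf K' :=
    { toFun := fun e => ⟨⟨φ ⟨e.1.1, e.2⟩, hφ _⟩, (hφK ⟨e.1.1, e.2⟩).1 e.1.2⟩
      map_one' := by ext; exact map_one φ
      map_mul' := fun a b => by ext; exact map_mul φ ⟨a.1.1, a.2⟩ ⟨b.1.1, b.2⟩ }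
  refine ⟨⟨inl, r, fun a b h => hi (congrArg (fun x => x.1.1) h), ?_, ?_⟩⟩
  · ext e
    rw [MonoidHom.mem_range, MonoidHom.mem_ker]
    constructor
    · rintro ⟨n, rfl⟩
      exact Subtype.ext (Subtype.ext (hiφ n))
    · intro h
      obtain ⟨n, hn⟩ := hker ⟨e.1.1, e.2⟩ (congrArg (fun x => x.1.1) h)
      exact ⟨n, Subtype.ext (Subtype.ext hn)⟩
  · rintro ⟨⟨g, hg⟩, hgH⟩
    obtain ⟨a, rfl⟩ := hsurj g hg
    exact ⟨⟨⟨a.1, (hφK a).2 hgH⟩, a.2⟩, rfl⟩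

/-- The stabilizer of `L³` in `Aut(𝔏(S))` is an extension of the stabilizer of `S` in
`Aut(R(L)³, w³)` by the group of sign changes. -/
theorem nonempty_stabilizer_extension
    (S : Submodule (ZMod 2) (Fin 3 → DiscGroup sqrtTwoE8)) :
    Nonempty (GroupExtension (Multiplicative (Fin 3 → ZMod 2))
      ((latticeAut (powLattice sqrtTwoE8 3)).subgroupOf (latticeAut (latticeOf sqrtTwoE8 S)))
      ((subspaceStabilizer S).subgroupOf (autWt discQuad 3))) := by
  -- `L³` is a multiple of `E₈³`, so they have the same isometries and the action of `Aut(E₈³)`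
  -- applies.
  rw [latticeAut_powLattice]
  exact nonempty_groupExtension_subgroupOf signChange signChange_injective
    signChange_mem_latticeAut inducedAut inducedAut_mem_autWt
    (fun γ => mem_latticeAut_latticeOf_iff γ) (fun _ hg => exists_isometry_of_mem_autWt hg)
    inducedAut_signChange (fun _ h => exists_eq_signChange h)

end Stabilizer

end
theorem corollary3p11
    (S : Submodule (ZMod 2) (Fin 3 → DiscGroup sqrtTwoE8))
    (hS : IsMaxTotallySingular (quadPow discQuad 3) S)
    (hw : ∀ v ∈ S, v ≠ 0 → 4 ≤ wtPow discQuad 3 v) :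
    -- `Aut(𝔏(S))` is transitive on the sublattices isomorphic to `(√2 E₈)³`
    (∀ J K : Submodule ℤ (PiLp 2 fun _ : Fin 3 => EuclideanSpace ℝ (Fin 8)),
      J ≤ latticeOf sqrtTwoE8 S → LatticeIsomorphic J (powLattice sqrtTwoE8 3) →
      K ≤ latticeOf sqrtTwoE8 S → LatticeIsomorphic K (powLattice sqrtTwoE8 3) →
      ∃ g ∈ latticeAut (latticeOf sqrtTwoE8 S), g '' J = (K : Set _)) ∧
    -- the stabilizer of `(√2 E₈)³` in `Aut(𝔏(S))` is an extension of the stabilizer of `S` in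
    -- `Aut(R(L)³, w³)` by `2³`
    Nonempty (GroupExtension (Multiplicative (Fin 3 → ZMod 2))
      ((latticeAut (powLattice sqrtTwoE8 3)).subgroupOf (latticeAut (latticeOf sqrtTwoE8 S)))
      ((subspaceStabilizer S).subgroupOf (autWt discQuad 3))) ∧
    -- the stabilizer of `S` is a split extension `2¹² : (SL₄(2) × Sym₃)`
    ∃ X : GroupExtension (Multiplicative (Fin 12 → ZMod 2))
        ((subspaceStabilizer S).subgroupOf (autWt discQuad 3))
        (Matrix.SpecialLinearGroup (Fin 4) (ZMod 2) × Equiv.Perm (Fin 3)),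
      Nonempty X.Splitting := by
  have hS' := orthogonal_le_of_isMaxTotallySingular hS
  refine ⟨fun J K hJ hJL hK hKL => ?_, nonempty_stabilizer_extension S, ?_⟩
  · obtain ⟨g, hg, hgJ⟩ := exists_mem_latticeAut_of_latticeIsomorphic hS.prop hS' hw hJ hJL
    obtain ⟨h, hh, hhK⟩ := exists_mem_latticeAut_of_latticeIsomorphic hS.prop hS' hw hK hKL
    -- Both `J` and `K` are images of `L³` under automorphisms of `𝔏(S)`, so `L³` serves as base
    -- point.
    refine ⟨h * g⁻¹, mul_mem hh (inv_mem hg), Set.ext fun v => ⟨?_, fun hv => ?_⟩⟩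
    · rintro ⟨u, hu, rfl⟩
      refine (hhK (g⁻¹ u)).2 ((hgJ _).1 ?_)
      rw [show g (g⁻¹ u) = u from g.apply_symm_apply u]
      exact hu
    · obtain ⟨w, rfl⟩ := h.surjective v
      refine ⟨g w, (hgJ w).2 ((hhK w).1 hv), ?_⟩
      exact congrArg h (g.symm_apply_apply w)
  · obtain ⟨ι, hι, hιS⟩ := exists_glue_frames discQuad_nondegenerate finrank_discGroup S hS.prop hS' hw
    exact exists_split_extension_stabilizer rootClass discQuad_rootClass span_rootClass
      exists_polar_rootClass ι hι hιS
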